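/- **Setting.** Let $n\ge 1$, $m\ge 2$, $X\in\mathbb R^{n\times p}$, $D\in\mathbb R^{m\times p}$, $X^*:=X^T/n$, $\mathcal L:=\mathrm{Im}(X^T)+\mathrm{Im}(D^T)$, and let $\beta^\star\in\mathcal L$ with $D\beta^\star\neq 0$. Put $S:=\mathrm{supp}(D\beta^\star)$, $s:=|S|\ge 1$, and $\mathcal M:=\{\beta: D_{S^c}\beta=0\}$, where $D_{S^c}$ consists of the rows of $D$ outside $S$. Let $y=X\beta^\star+\epsilon$, where $\epsilon_1,\dots,\epsilon_n$ are i.i.d. with $\mathbb E\,e^{t\epsilon_i}\le e^{\sigma^2t^2/2}$ for all $t\in\mathbb R$, $\sigma>0$. Let $\lambda_D,\Lambda_D,\Lambda_X>0$ be such that all nonzero singular values of $D$ and of $D_{S^c}$ are at least $\lambda_D$, the largest singular value of $D$ is at most $\Lambda_D$, and the largest singular value of $X^*X$ is at most $\Lambda_X^2$. Let $\lambda_1$ be the smallest nonzero singular value of $X/\sqrt n$ restricted to $\ker D$, with $\lambda_1:=+\infty$, $1/\lambda_1:=0$ if $X\ker D=\{0\}$ (each expression below is then read as its limit for $\lambda_1\to\infty$),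 and let $r':=\dim(X\ker D)$. For $\nu>0$ let $$\ell(\beta,\gamma)=\frac1{2n}\|y-X\beta\|_2^2+\frac1{2\nu}\|\gamma-D\beta\|_2^2,\qquad H(\nu)=\nabla^2\ell=\begin{pmatrix}X^*X+D^TD/\nu&-D^T/\nu\\-D/\nu&I_m/\nu\end{pmatrix},$$ and let $H_{(\beta,S),(\beta,S)}$ and $H_{S^c,(\beta,S)}$ be the submatrices with the columns belonging to $\beta$ and to $\gamma_S$, and with the rows belonging to $\beta,\gamma_S$ and to $\gamma_{S^c}$, respectively. For $\kappa>0$, a solution of Split LBISS (Split Linearized Bregman Inverse Scale Space) is a triple of functions $\rho,\gamma:[0,\infty)\to\mathbb R^m$, $\beta:[0,\infty)\to\mathbb R^p$ that are continuous and right continuously differentiable, with $\rho(0)=\gamma(0)=0$, $\beta(0)=0$, such that for all $t\ge0$, with right derivatives, $$\dot\beta/\kappa=-\nabla_\beta\ell(\beta,\gamma),\qquad \dot\rho+\dot\gamma/\kappa=-\nabla_\gamma\ell(\beta,\gamma),\qquad \rho(t)\in\partial\|\gamma(t)\|_1 .$$ **Assumptions.** (RSC) There is $\lambda>0$ with $\beta^TX^*X\beta\ge\lambda\|\beta\|_2^2$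 for all $\beta\in\mathcal L\cap\mathcal M$. (IRR($\nu$)) For the given $\nu>0$ and some $\eta\in(0,1]$, $$\sup_{\rho\in[-1,1]^s}\Big\|H_{S^c,(\beta,S)}(\nu)\,H_{(\beta,S),(\beta,S)}(\nu)^\dagger\binom{0_p}{\rho}\Big\|_\infty\le1-\eta .$$ **Conclusion.** There is $C>0$ such that for every $\nu>0$ $$(\beta^T,\gamma_S^T)\,H_{(\beta,S),(\beta,S)}(\nu)\binom{\beta}{\gamma_S}\ \ge\ \frac{C}{1+\nu}\Big\|\binom{\beta}{\gamma_S}\Big\|_2^2\qquad(\beta\in\mathcal L,\ \gamma_S\in\mathbb R^s).\tag{1}$$ Moreover, let $C>0$ be any constant for which (1) holds at the given $\nu$, let $\lambda_H:=C/(1+\nu)$, let $\kappa$ satisfy $$\kappa\ge\frac4\eta\Big(1+\frac1{\lambda_D}+\frac{\Lambda_X}{\lambda_1\lambda_D}\Big)\Big(1+\sqrt{\tfrac{2(1+\nu\Lambda_X^2+\Lambda_D^2)}{\lambda_H\nu}}\Big)\Big((1+\Lambda_D)\|\beta^\star\|_2+\frac{2\sigma}{\lambda_H}\Big(\frac{\Lambda_X}{\lambda_D}+\frac{\Lambda_X}{\lambda_D^2}+\frac{\lambda_H\lambda_D^2+\Lambda_X^2}{\lambda_1\lambda_D^2}\Big)\Big),$$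 and let $\bar\tau:=\frac{\eta}{8\sigma}\cdot\frac{\lambda_D}{\Lambda_X}\sqrt{\frac n{\log m}}$. Then there is an event of probability at least $1-6/m-3\exp(-4n/5)$ on which every solution $(\rho,\beta,\gamma)$ of Split LBISS has all of the following properties. 1. (No false positives) $\mathrm{supp}(\gamma(t))\subseteq S$ for $0\le t\le\bar\tau$. 2. (Sign consistency) If $$\min_{j\in S}|(D\beta^\star)_j|\ \ge\ \frac{16\sigma}{\eta\lambda_H}\cdot\frac{\Lambda_X\Lambda_D}{\lambda_D^2}\big(2\log s+5+\max(0,\log(8\Lambda_D))\big)\sqrt{\frac{\log m}n},$$ then $\mathrm{sign}(\gamma(\bar\tau))=\mathrm{sign}(D\beta^\star)$. 3. ($\ell_2$ bound for $\gamma$) $$\|\gamma(\bar\tau)-D\beta^\star\|_2\le\frac{42\sigma}{\eta\lambda_H}\cdot\frac{\Lambda_X}{\lambda_D}\sqrt{\frac{s\log m}n}.$$ 4. ($\ell_2$ bound for $\beta$) $$\|\beta(\bar\tau)-\beta^\star\|_2\le\frac{42\sigma}{\eta\lambda_H}\cdot\frac{\lambda_1\Lambda_X(1+\lambda_D)+\Lambda_X^2}{\lambda_1\lambda_D^2}\sqrt{\frac{s\log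 m}n}+\frac{2\sigma}{\lambda_1}\sqrt{\frac{r'\log m}n}+\nu\cdot2\sigma\cdot\frac{\lambda_1\Lambda_X+\Lambda_X^2}{\lambda_1\lambda_D^2}.$$ -/

import Mathlib

open MeasureTheory ProbabilityTheory
open scoped NNReal Matrix

namespace SplitLBISS

noncomputable section

/-! ### Norms, singular values, pseudoinverse -/

/-- Euclidean norm of a coordinate vector. -/
def l2norm {ι : Type*} [Fintype ι] (v : ι → ℝ) : ℝ := ‖WithLp.toLp 2 v‖

/-- The singular values of a matrix, in decreasing order (extended by zeros). -/
def singVals {a b : Type*} [Fintype a] [Fintype b] [DecidableEq b]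
    (A : Matrix a b ℝ) : ℕ →₀ ℝ :=
  (Matrix.toEuclideanLin A).singularValues

/-- The smallest nonzero singular value of `A` is at least `c`
(no condition when `A` has no nonzero singular value). -/
def MinPosSingGE {a b : Type*} [Fintype a] [Fintype b] [DecidableEq b]
    (A : Matrix a b ℝ) (c : ℝ) : Prop :=
  ∀ i ∈ (singVals A).support, c ≤ singVals A i

/-- The largest singular value of `A` is at most `c`. -/
def MaxSingLE {a b : Type*} [Fintype a] [Fintype b] [DecidableEq b]
    (A : Matrix a b ℝ) (c : ℝ) : Prop :=
  singVals A 0 ≤ c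

/-- The four Penrose equations: `B` is the Moore-Penrose pseudoinverse of `A`. -/
structure IsMoorePenrose {a b : Type*} [Fintype a] [Fintype b]
    (A : Matrix a b ℝ) (B : Matrix b a ℝ) : Prop where
  mul_mul_left : A * B * A = A
  mul_mul_right : B * A * B = B
  symm_left : (A * B)ᵀ = A * B
  symm_right : (B * A)ᵀ = B * A

theorem IsMoorePenrose.unique {a b : Type*} [Fintype a] [Fintype b]
    {A : Matrix a b ℝ} {B C : Matrix b a ℝ}
    (hB : IsMoorePenrose A B) (hC : IsMoorePenrose A C) : B = C := by
  have h1 : A * B = A * C := by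
    calc A * B = (A * C * A) * B := by rw [hC.mul_mul_left]
      _ = (A * C)ᵀ * (A * B)ᵀ := by rw [hC.symm_left, hB.symm_left]; simp only [Matrix.mul_assoc]
      _ = (A * B * A * C)ᵀ := by rw [← Matrix.transpose_mul]; simp only [Matrix.mul_assoc]
      _ = A * C := by rw [hB.mul_mul_left, hC.symm_left]
  have h2 : B * A = C * A := by
    calc B * A = B * (A * C * A) := by rw [hC.mul_mul_left]
      _ = (B * A)ᵀ * (C * A)ᵀ := by rw [hC.symm_right, hB.symm_right]; simp only [Matrix.mul_assoc]
      _ = (C * (A * B * A))ᵀ := by rw [← Matrix.transpose_mul]; simp only [Matrix.mul_assoc]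
      _ = C * A := by rw [hB.mul_mul_left, hC.symm_right]
  calc B = B * A * B := hB.mul_mul_right.symm
    _ = C * A * C := by rw [h2, Matrix.mul_assoc, h1, ← Matrix.mul_assoc]
    _ = C := hC.mul_mul_right

theorem exists_isMoorePenrose_of_symm {b : Type*} [Fintype b] [DecidableEq b]
    (G : Matrix b b ℝ) (hG : G.IsHermitian) :
    ∃ B : Matrix b b ℝ, IsMoorePenrose G B ∧ Bᵀ = B := by
  set U : Matrix b b ℝ := (hG.eigenvectorUnitary : Matrix b b ℝ) with hU
  set d : b → ℝ := hG.eigenvalues with hd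
  have hUU : Uᵀ * U = 1 := by
    have := Unitary.coe_star_mul_self hG.eigenvectorUnitary
    simpa [Matrix.star_eq_conjTranspose, Matrix.conjTranspose_eq_transpose_of_trivial] using this
  have hspec : G = U * Matrix.diagonal d * Uᵀ := by
    have := hG.spectral_theorem
    simpa [Unitary.conjStarAlgAut_apply, Matrix.star_eq_conjTranspose,
      Matrix.conjTranspose_eq_transpose_of_trivial, Function.comp_def] using this
  have key : ∀ x y : b → ℝ, (U * Matrix.diagonal x * Uᵀ) * (U * Matrix.diagonal y * Uᵀ)
      = U * Matrix.diagonal (fun i => x i * y i) * Uᵀ := by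
    intro x y
    calc (U * Matrix.diagonal x * Uᵀ) * (U * Matrix.diagonal y * Uᵀ)
        = U * Matrix.diagonal x * (Uᵀ * U) * Matrix.diagonal y * Uᵀ := by
          simp only [Matrix.mul_assoc]
      _ = U * (Matrix.diagonal x * Matrix.diagonal y) * Uᵀ := by
          rw [hUU, Matrix.mul_one]; simp only [Matrix.mul_assoc]
      _ = _ := by rw [Matrix.diagonal_mul_diagonal]
  have tr : ∀ x : b → ℝ, (U * Matrix.diagonal x * Uᵀ)ᵀ = U * Matrix.diagonal x * Uᵀ := by
    intro x
    simp [Matrix.transpose_mul, Matrix.mul_assoc]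
  refine ⟨U * Matrix.diagonal (fun i => (d i)⁻¹) * Uᵀ, ⟨?_, ?_, ?_, ?_⟩, tr _⟩
  · rw [hspec, key, key]
    congr 3
    ext i
    simp
  · rw [hspec, key, key]
    congr 3
    ext i
    by_cases h : d i = 0
    · simp [h]
    · field_simp
  · rw [hspec, key, tr]
  · rw [hspec, key, tr]

theorem exists_isMoorePenrose {a b : Type*} [Fintype a] [Fintype b]
    (A : Matrix a b ℝ) : ∃ B : Matrix b a ℝ, IsMoorePenrose A B := by
  classical
  have hG : (Aᵀ * A).IsHermitian := by
    simpa [Matrix.conjTranspose_eq_transpose_of_trivial] using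
      Matrix.isHermitian_conjTranspose_mul_self A
  obtain ⟨B, hB, hBs⟩ := exists_isMoorePenrose_of_symm (Aᵀ * A) hG
  have hz : A * (B * (Aᵀ * A)) = A := by
    have h0 : (A * (B * (Aᵀ * A)) - A)ᵀ * (A * (B * (Aᵀ * A)) - A) = 0 := by
      have e : Aᵀ * (A * (B * (Aᵀ * A)) - A) = 0 := by
        rw [Matrix.mul_sub, sub_eq_zero]
        simpa only [Matrix.mul_assoc] using hB.mul_mul_left
      have e2 : (A * (B * (Aᵀ * A)) - A)ᵀ = (B * (Aᵀ * A) - 1)ᵀ * Aᵀ := by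
        rw [← Matrix.transpose_mul, Matrix.mul_sub, Matrix.mul_one]
      rw [e2, Matrix.mul_assoc, e, Matrix.mul_zero]
    have := Matrix.conjTranspose_mul_self_eq_zero
      (A := A * (B * (Aᵀ * A)) - A)
    rw [Matrix.conjTranspose_eq_transpose_of_trivial] at this
    exact sub_eq_zero.mp (this.mp h0)
  refine ⟨B * Aᵀ, ?_, ?_, ?_, ?_⟩
  · simpa only [Matrix.mul_assoc] using hz
  · have := hB.mul_mul_right
    calc B * Aᵀ * A * (B * Aᵀ) = (B * (Aᵀ * A) * B) * Aᵀ := by simp only [Matrix.mul_assoc]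
      _ = B * Aᵀ := by rw [this]
  · simp [Matrix.transpose_mul, hBs, Matrix.mul_assoc]
  · have := hB.symm_right
    simpa only [Matrix.mul_assoc] using this

/-- The Moore-Penrose pseudoinverse of a real matrix. -/
def pinv {a b : Type*} [Fintype a] [Fintype b] (A : Matrix a b ℝ) : Matrix b a ℝ :=
  (exists_isMoorePenrose A).choose

theorem pinv_spec {a b : Type*} [Fintype a] [Fintype b] (A : Matrix a b ℝ) :
    IsMoorePenrose A (pinv A) :=
  (exists_isMoorePenrose A).choose_spec

/-! ### The model -/

variable {n p m : ℕ}

/-- The support of a vector. -/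
def supp (v : Fin m → ℝ) : Finset (Fin m) := Finset.univ.filter (fun j => v j ≠ 0)

/-- `X^* = Xᵀ / n`. -/
def starMat (X : Matrix (Fin n) (Fin p) ℝ) : Matrix (Fin p) (Fin n) ℝ := (n : ℝ)⁻¹ • Xᵀ

/-- The rows of `D` outside `S`. -/
def rowsCompl (D : Matrix (Fin m) (Fin p) ℝ) (S : Finset (Fin m)) :
    Matrix {j // j ∉ S} (Fin p) ℝ :=
  D.submatrix Subtype.val id

/-- The subspace `Im Xᵀ + Im Dᵀ`, i.e. the orthogonal complement of `ker X ∩ ker D`. -/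
def subspaceL (X : Matrix (Fin n) (Fin p) ℝ) (D : Matrix (Fin m) (Fin p) ℝ) :
    Submodule ℝ (Fin p → ℝ) :=
  LinearMap.range Xᵀ.mulVecLin ⊔ LinearMap.range Dᵀ.mulVecLin

/-- The model subspace `{β : D_{Sᶜ} β = 0}`. -/
def subspaceM (D : Matrix (Fin m) (Fin p) ℝ) (S : Finset (Fin m)) :
    Submodule ℝ (Fin p → ℝ) :=
  LinearMap.ker (rowsCompl D S).mulVecLin

/-- The split loss `‖y - Xβ‖² / (2n) + ‖γ - Dβ‖² / (2ν)`. -/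
def loss (X : Matrix (Fin n) (Fin p) ℝ) (D : Matrix (Fin m) (Fin p) ℝ) (y : Fin n → ℝ) (ν : ℝ)
    (β : Fin p → ℝ) (γ : Fin m → ℝ) : ℝ :=
  1 / (2 * n) * l2norm (y - X *ᵥ β) ^ 2 + 1 / (2 * ν) * l2norm (γ - D *ᵥ β) ^ 2

/-- The partial gradient of the loss in `β`. -/
def gradBeta (X : Matrix (Fin n) (Fin p) ℝ) (D : Matrix (Fin m) (Fin p) ℝ) (y : Fin n → ℝ)
    (ν : ℝ) (β : Fin p → ℝ) (γ : Fin m → ℝ) : Fin p → ℝ :=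
  starMat X *ᵥ (X *ᵥ β - y) + ν⁻¹ • (Dᵀ *ᵥ (D *ᵥ β - γ))

/-- The partial gradient of the loss in `γ`. -/
def gradGamma (D : Matrix (Fin m) (Fin p) ℝ) (ν : ℝ) (β : Fin p → ℝ) (γ : Fin m → ℝ) :
    Fin m → ℝ :=
  ν⁻¹ • (γ - D *ᵥ β)

theorem l2norm_sq {ι : Type*} [Fintype ι] (v : ι → ℝ) : l2norm v ^ 2 = v ⬝ᵥ v := by
  rw [l2norm, EuclideanSpace.norm_sq_eq]
  simp [dotProduct, ← sq]

/-- `gradBeta` and `gradGamma` are the partial gradients of `loss`: exact second order expansion. -/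
theorem loss_expansion (X : Matrix (Fin n) (Fin p) ℝ) (D : Matrix (Fin m) (Fin p) ℝ)
    (y : Fin n → ℝ) (ν : ℝ) (β h : Fin p → ℝ) (γ g : Fin m → ℝ) :
    loss X D y ν (β + h) (γ + g) = loss X D y ν β γ
      + gradBeta X D y ν β γ ⬝ᵥ h + gradGamma D ν β γ ⬝ᵥ g
      + (1 / (2 * n) * l2norm (X *ᵥ h) ^ 2 + 1 / (2 * ν) * l2norm (g - D *ᵥ h) ^ 2) := by
  have tX : ∀ w : Fin n → ℝ, (Xᵀ *ᵥ w) ⬝ᵥ h = w ⬝ᵥ (X *ᵥ h) := by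
    intro w
    rw [Matrix.mulVec_transpose, Matrix.dotProduct_mulVec]
  have tD : ∀ w : Fin m → ℝ, (Dᵀ *ᵥ w) ⬝ᵥ h = w ⬝ᵥ (D *ᵥ h) := by
    intro w
    rw [Matrix.mulVec_transpose, Matrix.dotProduct_mulVec]
  simp only [loss, gradBeta, gradGamma, starMat, l2norm_sq, Matrix.mulVec_add, Matrix.smul_mulVec,
    add_dotProduct, smul_dotProduct, tX, tD, sub_dotProduct, dotProduct_sub, dotProduct_add,
    smul_eq_mul, mul_inv, one_div]
  rw [dotProduct_comm (X *ᵥ h) y, dotProduct_comm (X *ᵥ h) (X *ᵥ β), dotProduct_comm (X *ᵥ β) y,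
    dotProduct_comm (D *ᵥ h) γ, dotProduct_comm (D *ᵥ h) g, dotProduct_comm (D *ᵥ β) g,
    dotProduct_comm (D *ᵥ β) γ, dotProduct_comm (D *ᵥ h) (D *ᵥ β), dotProduct_comm g γ]
  ring

/-- `ρ ∈ ∂‖γ‖₁`. -/
def IsSubgradL1 (ρ γ : Fin m → ℝ) : Prop :=
  ∀ u : Fin m → ℝ, ∑ j, |γ j| + ∑ j, ρ j * (u j - γ j) ≤ ∑ j, |u j|

/-- `f` is continuous on `[0, ∞)` and right continuously differentiable there,
with right derivative `f'`. -/
structure RightC1 {k : ℕ} (f f' : ℝ → Fin k → ℝ) : Prop where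
  cont : ContinuousOn f (Set.Ici 0)
  deriv : ∀ t, 0 ≤ t → HasDerivWithinAt f (f' t) (Set.Ici t) t
  cont_deriv : ∀ t, 0 ≤ t → ContinuousWithinAt f' (Set.Ici t) t

/-- `(ρ, β, γ)` is a solution on `[0, ∞)` of the Split Linearized Bregman Inverse Scale Space
dynamics for the data `(y, X, D)` and the parameters `ν`, `κ`. -/
def IsSplitLBISS (X : Matrix (Fin n) (Fin p) ℝ) (D : Matrix (Fin m) (Fin p) ℝ) (y : Fin n → ℝ)
    (ν κ : ℝ) (ρ : ℝ → Fin m → ℝ) (β : ℝ → Fin p → ℝ) (γ : ℝ → Fin m → ℝ) : Prop :=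
  ρ 0 = 0 ∧ β 0 = 0 ∧ γ 0 = 0 ∧
  ∃ (ρ' : ℝ → Fin m → ℝ) (β' : ℝ → Fin p → ℝ) (γ' : ℝ → Fin m → ℝ),
    RightC1 ρ ρ' ∧ RightC1 β β' ∧ RightC1 γ γ' ∧
    ∀ t, 0 ≤ t →
      κ⁻¹ • β' t = -gradBeta X D y ν (β t) (γ t) ∧
      ρ' t + κ⁻¹ • γ' t = -gradGamma D ν (β t) (γ t) ∧
      IsSubgradL1 (ρ t) (γ t)

/-! ### Assumptions -/

/-- The Hessian `H(ν)` of the loss. -/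
def hessian (X : Matrix (Fin n) (Fin p) ℝ) (D : Matrix (Fin m) (Fin p) ℝ) (ν : ℝ) :
    Matrix (Fin p ⊕ Fin m) (Fin p ⊕ Fin m) ℝ :=
  Matrix.fromBlocks (starMat X * X + ν⁻¹ • (Dᵀ * D)) (-(ν⁻¹ • Dᵀ)) (-(ν⁻¹ • D))
    (ν⁻¹ • (1 : Matrix (Fin m) (Fin m) ℝ))

/-- `H_{(β,S),(β,S)}(ν)`. -/
def hessianS (X : Matrix (Fin n) (Fin p) ℝ) (D : Matrix (Fin m) (Fin p) ℝ) (S : Finset (Fin m))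
    (ν : ℝ) : Matrix (Fin p ⊕ {j // j ∈ S}) (Fin p ⊕ {j // j ∈ S}) ℝ :=
  (hessian X D ν).submatrix (Sum.map id Subtype.val) (Sum.map id Subtype.val)

/-- `H_{Sᶜ,(β,S)}(ν)`. -/
def hessianSc (X : Matrix (Fin n) (Fin p) ℝ) (D : Matrix (Fin m) (Fin p) ℝ) (S : Finset (Fin m))
    (ν : ℝ) : Matrix {j // j ∉ S} (Fin p ⊕ {j // j ∈ S}) ℝ :=
  (hessian X D ν).submatrix (fun i => Sum.inr i.val) (Sum.map id Subtype.val)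

/-- Restricted strong convexity: `X^* X` is positive definite on the intersection of the two
subspaces above. -/
def RSC (X : Matrix (Fin n) (Fin p) ℝ) (D : Matrix (Fin m) (Fin p) ℝ) (S : Finset (Fin m)) :
    Prop :=
  ∃ lam : ℝ, 0 < lam ∧ ∀ β ∈ subspaceL X D ⊓ subspaceM D S,
    lam * l2norm β ^ 2 ≤ β ⬝ᵥ ((starMat X * X) *ᵥ β)

/-- `(βᵀ, γ_Sᵀ) H_{(β,S),(β,S)}(ν) (β; γ_S) ≥ C / (1 + ν) * ‖(β; γ_S)‖²` for all `β` in
`Im Xᵀ + Im Dᵀ` and all `γ_S`. -/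
def HessianBound (X : Matrix (Fin n) (Fin p) ℝ) (D : Matrix (Fin m) (Fin p) ℝ)
    (S : Finset (Fin m)) (ν C : ℝ) : Prop :=
  ∀ β ∈ subspaceL X D, ∀ γ : {j // j ∈ S} → ℝ,
    C / (1 + ν) * l2norm (Sum.elim β γ) ^ 2 ≤
      Sum.elim β γ ⬝ᵥ (hessianS X D S ν *ᵥ Sum.elim β γ)

/-- The irrepresentable condition IRR(`ν`) with constant `η`. -/
def IRR (X : Matrix (Fin n) (Fin p) ℝ) (D : Matrix (Fin m) (Fin p) ℝ) (S : Finset (Fin m))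
    (ν η : ℝ) : Prop :=
  ∀ ρ : {j // j ∈ S} → ℝ, (∀ j, ρ j ∈ Set.Icc (-1 : ℝ) 1) →
    ∀ i, |((hessianSc X D S ν * pinv (hessianS X D S ν)) *ᵥ
      Sum.elim (0 : Fin p → ℝ) ρ) i| ≤ 1 - η

/-! ### Constants -/

/-- The restriction of `X / √n` to `ker D`. -/
def restrictedX (X : Matrix (Fin n) (Fin p) ℝ) (D : Matrix (Fin m) (Fin p) ℝ) :
    LinearMap.ker (Matrix.toEuclideanLin D) →ₗ[ℝ] EuclideanSpace ℝ (Fin n) :=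
  (Matrix.toEuclideanLin ((√(n : ℝ))⁻¹ • X)).domRestrict (LinearMap.ker (Matrix.toEuclideanLin D))

/-- `r' = dim X(ker D)`. -/
def rPrime (X : Matrix (Fin n) (Fin p) ℝ) (D : Matrix (Fin m) (Fin p) ℝ) : ℕ :=
  Module.finrank ℝ ((LinearMap.ker (Matrix.toEuclideanLin D)).map (Matrix.toEuclideanLin X))

open Classical in
/-- `1 / λ₁`, where `λ₁` is the smallest nonzero singular value of the restriction of `X / √n`
to `ker D`; `λ₁ = +∞`, so that `1 / λ₁ = 0`, if there is no nonzero singular value. -/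
def invLambdaOne (X : Matrix (Fin n) (Fin p) ℝ) (D : Matrix (Fin m) (Fin p) ℝ) : ℝ :=
  if h : (restrictedX X D).singularValues.support.Nonempty then
    1 / (restrictedX X D).singularValues.support.inf' h (restrictedX X D).singularValues
  else 0

/-- The lower bound on `κ`; `iL` stands for `1 / λ₁`, and `normβ` for the norm of the true
parameter. -/
def kappaLower (iL lamD LamD LamX lamH η σ ν normβ : ℝ) : ℝ :=
  4 / η * (1 + 1 / lamD + LamX * iL / lamD)
    * (1 + √(2 * (1 + ν * LamX ^ 2 + LamD ^ 2) / (lamH * ν)))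
    * ((1 + LamD) * normβ + 2 * σ / lamH *
        (LamX / lamD + LamX / lamD ^ 2 + (lamH * lamD ^ 2 + LamX ^ 2) * iL / lamD ^ 2))

/-- The stopping time `τ̄`. -/
def tauBar (n m : ℕ) (lamD LamX η σ : ℝ) : ℝ :=
  η / (8 * σ) * (lamD / LamX) * √(n / Real.log m)

/-- The smallest magnitude of an entry of `v` on `S`. -/
def minAbs (v : Fin m → ℝ) (S : Finset (Fin m)) : ℝ := ⨅ j : {j // j ∈ S}, |v j|

end

end SplitLBISS

set_option linter.unusedSectionVars false

namespace SplitLBISS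

open scoped RealInnerProductSpace
open Set Filter Topology

/-! ### Consequences of bounds on singular values -/

section SingularValues

variable {E F : Type*} [NormedAddCommGroup E] [InnerProductSpace ℝ E] [FiniteDimensional ℝ E]
  [NormedAddCommGroup F] [InnerProductSpace ℝ F] [FiniteDimensional ℝ F]

/-! Write `A` for the design divided by √n and `D₁`, `D₂` for the rows of the transform on and off
the support. The comparison point is the oracle `βo = βs + δ`, `γo = D₁ βo`, where `δ` solves (A†A +
D₂†D₂/ν) δ = A†e. It minimizes the split loss under the constraint that `γ` vanishes off the
support. As long as the path respects this constraint, its gradient is the restricted Hessian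
applied to the distance from the oracle.

Convergence to the oracle rests on one energy Ψ: the ℓ¹ Bregman distance from `γ` to `γo` plus
(2κ)⁻¹ times the squared error. Complementarity of `ρ` and `γ` gives Ψ' = -g, with g the Hessian
form of the error, and monotonicity of the subdifferential makes g nonincreasing
(`SplitFlow.dissipation`). Coercivity (1) and the lower bound on κ give Ψ² ≤ a g, hence g(t) ≤ 4a/t²
(`Dissipation.rate_le`), which is the ℓ₂ rate. While the error is larger than the smallest oracle
entry, even Ψ ≤ const · g holds, so the energy decays exponentially and the signs are eventually
right (`Dissipation.rate_lt`).

Absence of false positives comes from an exactly integrable identity. Multiplying the on-support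
dynamics by H_{Sᶜ,(β,S)} H_{(β,S),(β,S)}† expresses the off-support dual variable as a term in `ρ`,
at most 1 - η by irrepresentability, a term of size 1/κ, at most η/2 by the choice of κ, and a noise
drift, at most η/4 until the stopping time (`IrrRow.abs_dual_le`). The total is below 1, so a
continuity argument prevents the path from leaving the support (`FullFlow.offSupport_eq_zero`).

The oracle error is linear in the noise. `SplitBounds.norm_D₂_normalEq_le` and
`SplitBounds.norm_D_normalEq_le` bound the relevant functionals by Λ_X/λ_D, so each coordinate has a
scalar sub-Gaussian tail. Norms of projected noise are handled by averaging over an auxiliary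
Gaussian vector (`measureReal_sum_sq_inner_ge_le`). On the resulting event everything is
deterministic (`FullFlow.consistency`). -/

theorem norm_sq_eq_sum_singularValues (T : E →ₗ[ℝ] F) (y : E) :
    ‖T y‖ ^ 2 = ∑ i : Fin (Module.finrank ℝ E), T.singularValues i ^ 2 *
      ⟪T.isSymmetric_adjoint_comp_self.eigenvectorBasis rfl i, y⟫ ^ 2 := by
  set hT := T.isSymmetric_adjoint_comp_self
  set b := hT.eigenvectorBasis rfl
  have h1 : ‖T y‖ ^ 2 = ⟪(LinearMap.adjoint T ∘ₗ T) y, y⟫ := by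
    rw [LinearMap.comp_apply, LinearMap.adjoint_inner_left, real_inner_self_eq_norm_sq]
  rw [h1, ← b.sum_inner_mul_inner]
  refine Finset.sum_congr rfl fun i _ => ?_
  rw [hT y (b i), hT.apply_eigenvectorBasis, T.sq_singularValues_fin rfl]
  simp only [RCLike.ofReal_real_eq_id, id_eq, inner_smul_right]
  rw [real_inner_comm]
  ring

/-- Deleting the components of `x` along right singular vectors of singular value zero does not
change the image, and on the remaining span the map expands by at least `c`. This is the form in
which the lower bounds on nonzero singular values are used. -/
theorem exists_map_eq_norm_le (T : E →ₗ[ℝ] F) {c : ℝ} (hc : 0 ≤ c)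
    (h : ∀ i ∈ T.singularValues.support, c ≤ T.singularValues i) (x : E) :
    ∃ x', T x' = T x ∧ c * ‖x'‖ ≤ ‖T x‖ := by
  classical
  set hT := T.isSymmetric_adjoint_comp_self
  set b := hT.eigenvectorBasis rfl with hb
  set x' : E := ∑ i : Fin (Module.finrank ℝ E), (if T.singularValues i = 0 then 0 else ⟪b i, x⟫) • b i with hx'
  have hcoord : ∀ i, ⟪b i, x'⟫ = if T.singularValues i = 0 then 0 else ⟪b i, x⟫ := by
    intro i
    rw [hx', b.orthonormal.inner_right_fintype]
  have h0 : ‖T (x' - x)‖ ^ 2 = 0 := by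
    rw [norm_sq_eq_sum_singularValues]
    refine Finset.sum_eq_zero fun i _ => ?_
    rw [← hb, inner_sub_right, hcoord]
    split_ifs with h0 <;> simp [h0]
  have hTx : T x' = T x := by
    rw [← sub_eq_zero, ← map_sub]
    simpa using h0
  refine ⟨x', hTx, ?_⟩
  rw [← hTx]
  refine le_of_sq_le_sq ?_ (norm_nonneg _)
  rw [mul_pow, norm_sq_eq_sum_singularValues, ← b.sum_sq_norm_inner_right x', Finset.mul_sum]
  refine Finset.sum_le_sum fun i _ => ?_
  rw [← hb, Real.norm_eq_abs, sq_abs, hcoord]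
  split_ifs with h0
  · simp
  · have := h i (Finsupp.mem_support_iff.2 h0)
    gcongr

theorem norm_map_le_of_singularValues (T : E →ₗ[ℝ] F) {c : ℝ} (h : T.singularValues 0 ≤ c)
    (x : E) : ‖T x‖ ≤ c * ‖x‖ := by
  have hc : 0 ≤ c := (T.singularValues_nonneg 0).trans h
  refine le_of_sq_le_sq ?_ (by positivity)
  rw [mul_pow, norm_sq_eq_sum_singularValues,
    ← (T.isSymmetric_adjoint_comp_self.eigenvectorBasis rfl).sum_sq_norm_inner_right x,
    Finset.mul_sum]
  refine Finset.sum_le_sum fun i _ => ?_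
  rw [Real.norm_eq_abs, sq_abs]
  have h1 := T.singularValues_nonneg i
  have h2 := (T.singularValues_antitone (Nat.zero_le i)).trans h
  gcongr

end SingularValues

/-! ### The split quadratic form -/

section Geometry

variable {E N F₁ F₂ : Type*}
  [NormedAddCommGroup E] [InnerProductSpace ℝ E] [FiniteDimensional ℝ E]
  [NormedAddCommGroup N] [InnerProductSpace ℝ N] [FiniteDimensional ℝ N]
  [NormedAddCommGroup F₁] [InnerProductSpace ℝ F₁] [FiniteDimensional ℝ F₁]
  [NormedAddCommGroup F₂] [InnerProductSpace ℝ F₂] [FiniteDimensional ℝ F₂]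
  {A : E →L[ℝ] N} {D₁ : E →L[ℝ] F₁} {D₂ : E →L[ℝ] F₂}
  {ν lamD LamD LamX lamH iL : ℝ}

/-- The common kernel of the three maps. -/
def commonKer (A : E →L[ℝ] N) (D₁ : E →L[ℝ] F₁) (D₂ : E →L[ℝ] F₂) : Submodule ℝ E :=
  LinearMap.ker A.toLinearMap ⊓ LinearMap.ker D₁.toLinearMap ⊓ LinearMap.ker D₂.toLinearMap

theorem mem_commonKer {z : E} : z ∈ commonKer A D₁ D₂ ↔ A z = 0 ∧ D₁ z = 0 ∧ D₂ z = 0 := by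
  simp [commonKer, and_assoc]

/-- The quadratic form of `H_{(β,S),(β,S)}`, in coordinate-free form. -/
noncomputable def splitForm (A : E →L[ℝ] N) (D₁ : E →L[ℝ] F₁) (D₂ : E →L[ℝ] F₂) (ν : ℝ)
    (β : E) (γ : F₁) : ℝ :=
  ‖A β‖ ^ 2 + ν⁻¹ * (‖D₂ β‖ ^ 2 + ‖D₁ β - γ‖ ^ 2)

/-- The quantitative hypotheses on the design `A` and the two blocks of the transform. -/
structure SplitBounds (A : E →L[ℝ] N) (D₁ : E →L[ℝ] F₁) (D₂ : E →L[ℝ] F₂)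
    (ν lamD LamD LamX lamH iL : ℝ) : Prop where
  ν_pos : 0 < ν
  lamD_pos : 0 < lamD
  LamD_pos : 0 < LamD
  LamX_pos : 0 < LamX
  lamH_pos : 0 < lamH
  lamH_le : lamH ≤ ν⁻¹
  iL_nonneg : 0 ≤ iL
  norm_A : ∀ x, ‖A x‖ ≤ LamX * ‖x‖
  norm_D : ∀ x, ‖D₁ x‖ ^ 2 + ‖D₂ x‖ ^ 2 ≤ LamD ^ 2 * ‖x‖ ^ 2
  lift_D : ∀ x, ∃ x', D₁ x' = D₁ x ∧ D₂ x' = D₂ x ∧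
    lamD ^ 2 * ‖x'‖ ^ 2 ≤ ‖D₁ x‖ ^ 2 + ‖D₂ x‖ ^ 2
  lift_D₂ : ∀ x, ∃ x', D₂ x' = D₂ x ∧ lamD * ‖x'‖ ≤ ‖D₂ x‖
  lift_A : ∀ x, D₁ x = 0 → D₂ x = 0 → ∃ x', D₁ x' = 0 ∧ D₂ x' = 0 ∧ A x' = A x ∧
    ‖x'‖ ≤ iL * ‖A x‖
  form_ge : ∀ β ∈ (commonKer A D₁ D₂)ᗮ, ∀ γ,
    lamH * (‖β‖ ^ 2 + ‖γ‖ ^ 2) ≤ splitForm A D₁ D₂ ν β γ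

/-- The weak normal equation `(A†A + D₂†D₂ / ν) w = b`. -/
def NormalEq (A : E →L[ℝ] N) (D₂ : E →L[ℝ] F₂) (ν : ℝ) (w b : E) : Prop :=
  ∀ x, ⟪A w, A x⟫ + ν⁻¹ * ⟪D₂ w, D₂ x⟫ = ⟪b, x⟫

theorem exists_mem_orthogonal_congr (x : E) : ∃ x' ∈ (commonKer A D₁ D₂)ᗮ,
    A x' = A x ∧ D₁ x' = D₁ x ∧ D₂ x' = D₂ x ∧ ∀ b ∈ (commonKer A D₁ D₂)ᗮ, ⟪b, x'⟫ = ⟪b, x⟫ := by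
  set K := commonKer A D₁ D₂
  obtain ⟨y, hy, z, hz, rfl⟩ := K.exists_add_mem_mem_orthogonal x
  obtain ⟨h1, h2, h3⟩ := mem_commonKer.1 hy
  refine ⟨z, hz, by simp [h1], by simp [h2], by simp [h3], fun b hb => ?_⟩
  rw [inner_add_right, Submodule.inner_left_of_mem_orthogonal hy hb, zero_add]

/-- The two points differ by an element of the common kernel, and the representative orthogonal to
that kernel has least norm. Any explicitly built preimage thus bounds the norm. -/
theorem norm_le_of_mem_orthogonal {x x' : E} (hx : x ∈ (commonKer A D₁ D₂)ᗮ)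
    (hA : A x' = A x) (h1 : D₁ x' = D₁ x) (h2 : D₂ x' = D₂ x) : ‖x‖ ≤ ‖x'‖ := by
  have hk : x' - x ∈ commonKer A D₁ D₂ := mem_commonKer.2 (by simp [hA, h1, h2])
  have h0 := Submodule.inner_left_of_mem_orthogonal hk hx
  rw [inner_sub_right, sub_eq_zero, real_inner_self_eq_norm_sq] at h0
  have := real_inner_le_norm x x'
  rcases (norm_nonneg x).eq_or_lt with h | h
  · rw [← h]; positivity
  · nlinarith

namespace SplitBounds

/-- The form does not see the common kernel, so orthogonality of `β` can be dropped if only the `γ`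
half of the coercivity bound is kept. -/
theorem form_ge_gamma (H : SplitBounds A D₁ D₂ ν lamD LamD LamX lamH iL) (β : E) (γ : F₁) :
    lamH * ‖γ‖ ^ 2 ≤ splitForm A D₁ D₂ ν β γ := by
  obtain ⟨β', hβ', hA, h1, h2, -⟩ := exists_mem_orthogonal_congr (A := A) (D₁ := D₁) (D₂ := D₂) β
  have := H.form_ge β' hβ' γ
  have h3 : splitForm A D₁ D₂ ν β' γ = splitForm A D₁ D₂ ν β γ := by
    simp only [splitForm, hA, h1, h2]
  have := H.lamH_pos
  nlinarith [mul_nonneg this.le (sq_nonneg ‖β'‖)]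

/-- The normal operator is injective on the orthogonal complement of the common kernel. A linear
solution operator is needed, since it makes the oracle error a linear function of the noise. -/
theorem exists_normalEq_inverse (H : SplitBounds A D₁ D₂ ν lamD LamD LamX lamH iL) :
    ∃ R : E →ₗ[ℝ] E, ∀ b ∈ (commonKer A D₁ D₂)ᗮ,
      R b ∈ (commonKer A D₁ D₂)ᗮ ∧ NormalEq A D₂ ν (R b) b := by
  set L := (commonKer A D₁ D₂)ᗮ with hL
  set M : E →ₗ[ℝ] E := LinearMap.adjoint A.toLinearMap ∘ₗ A.toLinearMap +
    ν⁻¹ • (LinearMap.adjoint D₂.toLinearMap ∘ₗ D₂.toLinearMap) with hM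
  have hMi : ∀ w x, ⟪M w, x⟫ = ⟪A w, A x⟫ + ν⁻¹ * ⟪D₂ w, D₂ x⟫ := by
    intro w x
    simp [hM, inner_add_left, inner_smul_left, LinearMap.adjoint_inner_left]
  have hML : ∀ w, M w ∈ L := by
    intro w
    rw [hL, Submodule.mem_orthogonal']
    intro z hz
    obtain ⟨h1, -, h3⟩ := mem_commonKer.1 hz
    rw [hMi, h1, h3]; simp
  set ML : L →ₗ[ℝ] L := M.restrict (fun w _ => hML w) with hMLdef
  have hinj : Function.Injective ML := by
    rw [← LinearMap.ker_eq_bot, LinearMap.ker_eq_bot']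
    rintro ⟨w, hw⟩ h0
    have hMw : M w = 0 := congrArg Subtype.val h0
    have h1 := hMi w w
    rw [hMw, inner_zero_left, real_inner_self_eq_norm_sq, real_inner_self_eq_norm_sq] at h1
    -- The choice `γ = D₁ w` cancels the on-support residual and leaves exactly the form of the
    -- normal operator.
    have h2 := H.form_ge w hw (D₁ w)
    have hν := inv_pos.2 H.ν_pos
    have : lamH * ‖w‖ ^ 2 ≤ 0 := by
      rw [splitForm] at h2
      simp only [sub_self, norm_zero] at h2
      have := mul_nonneg H.lamH_pos.le (sq_nonneg ‖D₁ w‖)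
      nlinarith
    have hw0 : ‖w‖ ^ 2 ≤ 0 := by
      by_contra! hc
      nlinarith [mul_pos H.lamH_pos hc]
    have : w = 0 := by
      rw [← norm_eq_zero]; nlinarith [norm_nonneg w]
    simp [this]
  set e := LinearEquiv.ofInjectiveEndo ML hinj
  refine ⟨L.subtype ∘ₗ e.symm.toLinearMap ∘ₗ (L.orthogonalProjectionOnto).toLinearMap,
    fun b hb => ⟨by simp, fun x => ?_⟩⟩
  have h1 : ((L.subtype ∘ₗ e.symm.toLinearMap ∘ₗ (L.orthogonalProjectionOnto).toLinearMap) b) =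
      (e.symm ⟨b, hb⟩ : E) := by
    simp only [LinearMap.comp_apply, ContinuousLinearMap.coe_coe, LinearEquiv.coe_coe,
      Submodule.subtype_apply]
    rw [show L.orthogonalProjectionOnto b = ⟨b, hb⟩ from
      Submodule.orthogonalProjectionOnto_mem_subspace_eq_self (K := L) ⟨b, hb⟩]
  rw [h1, ← hMi]
  have h2 : ML (e.symm ⟨b, hb⟩) = ⟨b, hb⟩ := LinearEquiv.apply_symm_apply e ⟨b, hb⟩
  have h3 := congrArg Subtype.val h2
  rw [hMLdef, LinearMap.coe_restrict_apply] at h3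
  rw [h3]

theorem adjoint_A_mem (e : N) : LinearMap.adjoint A.toLinearMap e ∈ (commonKer A D₁ D₂)ᗮ := by
  rw [Submodule.mem_orthogonal']
  intro z hz
  rw [LinearMap.adjoint_inner_left]
  simp [(mem_commonKer.1 hz).1]

theorem adjoint_D₂_mem (e : F₂) : LinearMap.adjoint D₂.toLinearMap e ∈ (commonKer A D₁ D₂)ᗮ := by
  rw [Submodule.mem_orthogonal']
  intro z hz
  rw [LinearMap.adjoint_inner_left]
  simp [(mem_commonKer.1 hz).2.2]

variable {e : N} {δ : E}

/-- Testing the normal equation against a short preimage `w` of `D₂ δ` gives ν⁻¹‖D₂δ‖² = ⟪e - Aδ,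
Aw⟫, and the residual is no longer than `e`. The factor ν⁻¹ is kept because the drift of the
off-support dual variable carries it. -/
theorem norm_D₂_normalEq_le (H : SplitBounds A D₁ D₂ ν lamD LamD LamX lamH iL)
    (hδ : NormalEq A D₂ ν δ (LinearMap.adjoint A.toLinearMap e)) :
    ν⁻¹ * ‖D₂ δ‖ ≤ LamX / lamD * ‖e‖ := by
  have hν := inv_pos.2 H.ν_pos
  have hδ' : ∀ x, ⟪A δ, A x⟫ + ν⁻¹ * ⟪D₂ δ, D₂ x⟫ = ⟪e, A x⟫ := by
    intro x; rw [hδ x, LinearMap.adjoint_inner_left]; rfl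
  have h1 : ‖e - A δ‖ ≤ ‖e‖ := by
    have h2 := hδ' δ
    rw [real_inner_self_eq_norm_sq, real_inner_self_eq_norm_sq] at h2
    refine le_of_sq_le_sq ?_ (norm_nonneg _)
    rw [norm_sub_sq_real]
    nlinarith [mul_nonneg hν.le (sq_nonneg ‖D₂ δ‖), sq_nonneg ‖A δ‖]
  obtain ⟨w, hw, hwn⟩ := H.lift_D₂ δ
  have h2 := hδ' w
  rw [hw, real_inner_self_eq_norm_sq] at h2
  have h3 : ν⁻¹ * ‖D₂ δ‖ ^ 2 = ⟪e - A δ, A w⟫ := by rw [inner_sub_left]; linarith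
  have h4 : ⟪e - A δ, A w⟫ ≤ ‖e‖ * (LamX * ‖w‖) :=
    (real_inner_le_norm _ _).trans (mul_le_mul h1 (H.norm_A w) (norm_nonneg _) (norm_nonneg _))
  have h5 : ‖w‖ ≤ ‖D₂ δ‖ / lamD := by
    rw [le_div_iff₀ H.lamD_pos]; linarith
  rcases (norm_nonneg (D₂ δ)).eq_or_lt with h | h
  · rw [← h]
    have := H.LamX_pos; have := H.lamD_pos
    simp only [mul_zero]
    positivity
  · have h6 : ν⁻¹ * ‖D₂ δ‖ ^ 2 ≤ ‖e‖ * (LamX * (‖D₂ δ‖ / lamD)) := by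
      rw [h3]
      refine h4.trans ?_
      have := H.LamX_pos
      gcongr
    have h7 : ‖e‖ * (LamX * (‖D₂ δ‖ / lamD)) = (LamX / lamD * ‖e‖) * ‖D₂ δ‖ := by ring
    rw [h7, pow_two, ← mul_assoc] at h6
    exact le_of_mul_le_mul_right h6 h

/-- The part of `A δ` coming from the kernel of the transform is removed first, so that what remains
is controlled by the transform alone. The remaining energy `h` is at most Λ_X/λ_D ‖e‖ ‖Dδ‖ by the
normal equation and at least `lamH` ‖Dδ‖² by coercivity. -/
theorem norm_D_normalEq_le (H : SplitBounds A D₁ D₂ ν lamD LamD LamX lamH iL)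
    (hδ : NormalEq A D₂ ν δ (LinearMap.adjoint A.toLinearMap e)) :
    lamH * √(‖D₁ δ‖ ^ 2 + ‖D₂ δ‖ ^ 2) ≤ LamX / lamD * ‖e‖ := by
  have hν := inv_pos.2 H.ν_pos
  have hH := H.lamH_pos
  have hδ' : ∀ x, ⟪A δ, A x⟫ + ν⁻¹ * ⟪D₂ δ, D₂ x⟫ = ⟪e, A x⟫ := by
    intro x; rw [hδ x, LinearMap.adjoint_inner_left]; rfl
  -- remove from `A δ` its component in the image of the kernel of the transform
  set K := LinearMap.ker D₁.toLinearMap ⊓ LinearMap.ker D₂.toLinearMap with hK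
  obtain ⟨y, hy, z, hz, hyz⟩ := (K.map A.toLinearMap).exists_add_mem_mem_orthogonal (A δ)
  obtain ⟨f, hf, rfl⟩ := hy
  have hf1 : D₁ f = 0 := by simpa using hf.1
  have hf2 : D₂ f = 0 := by simpa using hf.2
  have hz' : A (δ - f) = z := by
    rw [map_sub, hyz]; simp
  have horth : ∀ k, D₁ k = 0 → D₂ k = 0 → ⟪A (δ - f), A k⟫ = 0 := by
    intro k h1 h2
    rw [hz']
    exact Submodule.inner_left_of_mem_orthogonal
      (Submodule.mem_map_of_mem (f := A.toLinearMap) (show k ∈ K by simp [hK, h1, h2])) hz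
  set a := ‖D₁ δ‖
  set b := ‖D₂ δ‖
  set h := ‖A (δ - f)‖ ^ 2 + ν⁻¹ * b ^ 2 with hh
  obtain ⟨x, hx1, hx2, hxn⟩ := H.lift_D δ
  have hAx : ‖A (δ - f)‖ ≤ ‖A x‖ := by
    have h0 := horth (δ - f - x) (by simp [hf1, hx1]) (by simp [hf2, hx2])
    rw [map_sub A (δ - f) x, inner_sub_right, real_inner_self_eq_norm_sq, sub_eq_zero] at h0
    have := real_inner_le_norm (A (δ - f)) (A x)
    rcases (norm_nonneg (A (δ - f))).eq_or_lt with h | h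
    · rw [← h]; positivity
    · nlinarith
  have hle : h ≤ LamX / lamD * ‖e‖ * √(a ^ 2 + b ^ 2) := by
    have h1 := hδ' (δ - f)
    have h2 := horth f hf1 hf2
    have h3 : h = ⟪e, A (δ - f)⟫ := by
      rw [← h1, map_sub D₂, hf2, sub_zero, real_inner_self_eq_norm_sq, hh,
        ← real_inner_self_eq_norm_sq (A (δ - f))]
      congr 1
      nth_rw 1 [map_sub]
      rw [inner_sub_left, real_inner_comm, real_inner_comm _ (A f), h2, sub_zero, real_inner_comm]
    have h4 : lamD * ‖x‖ ≤ √(a ^ 2 + b ^ 2) := by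
      refine Real.le_sqrt_of_sq_le ?_
      rw [mul_pow]; exact hxn
    have h5 : ‖x‖ ≤ √(a ^ 2 + b ^ 2) / lamD := by
      rw [le_div_iff₀ H.lamD_pos]; linarith
    calc h ≤ ‖e‖ * ‖A (δ - f)‖ := by rw [h3]; exact real_inner_le_norm _ _
      _ ≤ ‖e‖ * (LamX * (√(a ^ 2 + b ^ 2) / lamD)) := by
        have := H.LamX_pos
        refine mul_le_mul_of_nonneg_left ?_ (norm_nonneg _)
        exact hAx.trans ((H.norm_A x).trans (by gcongr))
      _ = _ := by ring
  have hge : lamH * (a ^ 2 + b ^ 2) ≤ h := by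
    have hb : lamH * b ^ 2 ≤ lamH * ν * h := by
      have : b ^ 2 = ν * (ν⁻¹ * b ^ 2) := by
        rw [← mul_assoc, mul_inv_cancel₀ H.ν_pos.ne', one_mul]
      rw [this, ← mul_assoc]
      have := H.ν_pos
      gcongr
      rw [hh]; nlinarith [sq_nonneg ‖A (δ - f)‖]
    have hμ : lamH * ν ≤ 1 := by
      have := mul_le_mul_of_nonneg_right H.lamH_le H.ν_pos.le
      rwa [inv_mul_cancel₀ H.ν_pos.ne'] at this
    have hh0 : 0 ≤ h := by positivity
    -- The weights `lamH * ν` for the off-support part and `1 - lamH * ν` for the on-support part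
    -- add up to 1, so no constant is lost.
    have ha : lamH * a ^ 2 ≤ (1 - lamH * ν) * h := by
      rcases (norm_nonneg (D₁ δ)).eq_or_lt with h0 | h0
      · have : a = 0 := h0.symm
        rw [this]
        nlinarith [mul_nonneg (sub_nonneg.2 hμ) hh0]
      -- Coercivity is tested at every multiple `c • D₁ δ`. The discriminant condition replaces
      -- optimizing in `c`, and also covers `lamH = ν⁻¹`, where the quadratic degenerates.
      have hq : ∀ c : ℝ, 0 ≤ ((ν⁻¹ - lamH) * a ^ 2) * (c * c) + (-2 * ν⁻¹ * a ^ 2) * c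
          + (ν⁻¹ * a ^ 2 + h) := by
        intro c
        have h1 := H.form_ge_gamma (δ - f) (c • D₁ δ)
        have h2 : D₁ (δ - f) - c • D₁ δ = (1 - c) • D₁ δ := by
          rw [map_sub, hf1, sub_zero, sub_smul, one_smul]
        rw [splitForm, h2, map_sub D₂, hf2, sub_zero, norm_smul, norm_smul, mul_pow, mul_pow,
          Real.norm_eq_abs, Real.norm_eq_abs, sq_abs, sq_abs] at h1
        change lamH * (c ^ 2 * a ^ 2) ≤
          ‖A (δ - f)‖ ^ 2 + ν⁻¹ * (b ^ 2 + (1 - c) ^ 2 * a ^ 2) at h1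
        rw [hh]
        nlinarith
      have hd := discrim_le_zero hq
      rw [discrim] at hd
      have ha0 : 0 < a ^ 2 := pow_pos h0 2
      have hd2 : a ^ 2 * (ν⁻¹ ^ 2 * a ^ 2) ≤ a ^ 2 * ((ν⁻¹ - lamH) * (ν⁻¹ * a ^ 2 + h)) := by
        nlinarith
      have hd3 := le_of_mul_le_mul_left hd2 ha0
      have hd4 : lamH * ν⁻¹ * a ^ 2 ≤ (ν⁻¹ - lamH) * h := by nlinarith
      have hd5 := mul_le_mul_of_nonneg_left hd4 H.ν_pos.le
      have e1 : ν * (lamH * ν⁻¹ * a ^ 2) = lamH * a ^ 2 := by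
        have := H.ν_pos.ne'; field_simp
      have e2 : ν * ((ν⁻¹ - lamH) * h) = (1 - lamH * ν) * h := by
        have := H.ν_pos.ne'; field_simp
      rwa [e1, e2] at hd5
    nlinarith
  have hs : a ^ 2 + b ^ 2 = √(a ^ 2 + b ^ 2) * √(a ^ 2 + b ^ 2) :=
    (Real.mul_self_sqrt (by positivity)).symm
  rcases (Real.sqrt_nonneg (a ^ 2 + b ^ 2)).eq_or_lt with h0 | h0
  · rw [← h0]
    have := H.LamX_pos; have := H.lamD_pos
    simp only [mul_zero]
    positivity
  · refine le_of_mul_le_mul_right ?_ h0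
    rw [mul_assoc, ← hs]
    exact hge.trans hle

/-- Up to the common kernel, `δ` is a short preimage `x` of its transform plus a kernel element `f`
with `‖f‖ ≤ iL * ‖A f‖`. Testing the normal equation with `f` bounds `A f` by `x` and by the noise
seen from the image of the kernel, which `B` controls. -/
theorem norm_normalEq_le (H : SplitBounds A D₁ D₂ ν lamD LamD LamX lamH iL)
    (hδL : δ ∈ (commonKer A D₁ D₂)ᗮ)
    (hδ : NormalEq A D₂ ν δ (LinearMap.adjoint A.toLinearMap e)) {B : ℝ}
    (hB : ∀ f, D₁ f = 0 → D₂ f = 0 → ⟪e, A f⟫ ≤ B * ‖A f‖) (hB0 : 0 ≤ B) :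
    ‖δ‖ ≤ (1 + LamX * iL) * (√(‖D₁ δ‖ ^ 2 + ‖D₂ δ‖ ^ 2) / lamD) + iL * B := by
  obtain ⟨x, hx1, hx2, hxn⟩ := H.lift_D δ
  obtain ⟨f, hf1, hf2, hfA, hfn⟩ := H.lift_A (δ - x) (by simp [hx1]) (by simp [hx2])
  have hx : ‖x‖ ≤ √(‖D₁ δ‖ ^ 2 + ‖D₂ δ‖ ^ 2) / lamD := by
    rw [le_div_iff₀ H.lamD_pos, mul_comm]
    refine Real.le_sqrt_of_sq_le ?_
    rw [mul_pow]; exact hxn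
  have h1 : ‖δ‖ ≤ ‖x + f‖ :=
    norm_le_of_mem_orthogonal hδL (by simp [hfA]) (by simp [hx1, hf1]) (by simp [hx2, hf2])
  have h2 : ‖A f‖ ≤ B + LamX * ‖x‖ := by
    have h3 := hδ f
    rw [LinearMap.adjoint_inner_left, hf2, inner_zero_right, mul_zero, add_zero] at h3
    have h4 : A δ = A f + A x := by rw [hfA]; simp
    rw [h4, inner_add_left, real_inner_self_eq_norm_sq] at h3
    have h5 : -⟪A x, A f⟫ ≤ ‖A x‖ * ‖A f‖ := (neg_le_abs _).trans (abs_real_inner_le_norm _ _)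
    have h6 := hB f hf1 hf2
    have h7 := H.norm_A x
    have h8 : ‖A f‖ ^ 2 ≤ (B + LamX * ‖x‖) * ‖A f‖ := by
      have : ‖A f‖ ^ 2 = ⟪e, A f⟫ + -⟪A x, A f⟫ := by
        change ‖A f‖ ^ 2 + ⟪A x, A f⟫ = ⟪e, A f⟫ at h3
        linarith
      rw [this]
      nlinarith [mul_le_mul_of_nonneg_right h7 (norm_nonneg (A f))]
    rcases (norm_nonneg (A f)).eq_or_lt with h | h
    · rw [← h]
      have := H.LamX_pos
      positivity
    · rw [pow_two] at h8
      exact le_of_mul_le_mul_right h8 h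
  rw [← hfA] at hfn
  have h3 : ‖f‖ ≤ iL * (B + LamX * ‖x‖) := hfn.trans (mul_le_mul_of_nonneg_left h2 H.iL_nonneg)
  calc ‖δ‖ ≤ ‖x‖ + ‖f‖ := h1.trans (norm_add_le _ _)
    _ ≤ (1 + LamX * iL) * ‖x‖ + iL * B := by linarith
    _ ≤ _ := by
      have := H.LamX_pos; have := H.iL_nonneg
      gcongr

end SplitBounds

end Geometry

/-! ### Scalar differential inequalities with right derivatives -/

section Scalar

theorem image_le_add_of_right_deriv_le {f f' : ℝ → ℝ} {a b c : ℝ} (hab : a ≤ b)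
    (hf : ContinuousOn f (Icc a b)) (hf' : ∀ t ∈ Ico a b, HasDerivWithinAt f (f' t) (Ici t) t)
    (hc : ∀ t ∈ Ico a b, f' t ≤ c) : f b ≤ f a + c * (b - a) := by
  refine image_le_of_deriv_right_le_deriv_boundary (B := fun t => f a + c * (t - a))
    (B' := fun _ => c) hf hf' (by simp) (by fun_prop) (fun t _ => ?_) hc ⟨hab, le_rfl⟩
  have := (((hasDerivAt_id t).sub_const a).const_mul c).const_add (f a)
  simpa using this.hasDerivWithinAt

theorem antitoneOn_of_right_deriv_nonpos {f f' : ℝ → ℝ} {a b : ℝ}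
    (hf : ContinuousOn f (Icc a b)) (hf' : ∀ t ∈ Ico a b, HasDerivWithinAt f (f' t) (Ici t) t)
    (hc : ∀ t ∈ Ico a b, f' t ≤ 0) : AntitoneOn f (Icc a b) := by
  intro s hs t ht hst
  have := image_le_add_of_right_deriv_le hst (hf.mono (Icc_subset_Icc hs.1 ht.2))
    (fun u hu => hf' u ⟨hs.1.trans hu.1, hu.2.trans_le ht.2⟩)
    (fun u hu => hc u ⟨hs.1.trans hu.1, hu.2.trans_le ht.2⟩)
  simpa using this

/-- The product of the right derivatives is the limit of the product of difference quotients. This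
transfers monotonicity of the subdifferential to velocities. -/
theorem mul_nonneg_of_right_deriv {f g : ℝ → ℝ} {f' g' t : ℝ}
    (hf : HasDerivWithinAt f f' (Ici t) t) (hg : HasDerivWithinAt g g' (Ici t) t)
    (h : ∀ u, t < u → 0 ≤ (f u - f t) * (g u - g t)) : 0 ≤ f' * g' := by
  have hf2 := (hasDerivWithinAt_iff_tendsto_slope' (by simp)).1 hf.Ioi_of_Ici
  have hg2 := (hasDerivWithinAt_iff_tendsto_slope' (by simp)).1 hg.Ioi_of_Ici
  refine ge_of_tendsto (hf2.mul hg2) ?_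
  filter_upwards [self_mem_nhdsWithin] with u hu
  rw [slope_def_field, slope_def_field, div_mul_div_comm]
  have : 0 < u - t := sub_pos.2 hu
  exact div_nonneg (h u hu) (by positivity)

/-- A nonnegative energy `Ψ` dissipated at the nonincreasing rate `g`. -/
structure Dissipation (Ψ g : ℝ → ℝ) (T : ℝ) : Prop where
  cont : ContinuousOn Ψ (Icc 0 T)
  deriv : ∀ t ∈ Ico 0 T, HasDerivWithinAt Ψ (-g t) (Ici t) t
  anti : AntitoneOn g (Icc 0 T)
  rate_nonneg : ∀ t ∈ Icc 0 T, 0 ≤ g t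
  energy_nonneg : ∀ t ∈ Icc 0 T, 0 ≤ Ψ t

namespace Dissipation

variable {Ψ g : ℝ → ℝ} {T : ℝ}

theorem energy_anti (h : Dissipation Ψ g T) : AntitoneOn Ψ (Icc 0 T) :=
  antitoneOn_of_right_deriv_nonpos h.cont h.deriv
    fun t ht => neg_nonpos.2 (h.rate_nonneg t (Ico_subset_Icc_self ht))

/-- Since the rate is nonincreasing, the energy lost on the interval is at least its length times
the final rate. -/
theorem mul_rate_le (h : Dissipation Ψ g T) {s t : ℝ} (hs : 0 ≤ s) (hst : s ≤ t) (ht : t ≤ T) :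
    g t * (t - s) ≤ Ψ s := by
  have := image_le_add_of_right_deriv_le (c := -g t) hst
    (h.cont.mono (Icc_subset_Icc hs ht))
    (fun u hu => h.deriv u ⟨hs.trans hu.1, hu.2.trans_le ht⟩)
    (fun u hu => neg_le_neg (h.anti ⟨hs.trans hu.1, hu.2.le.trans ht⟩ ⟨hs.trans hst, ht⟩ hu.2.le))
  have h0 := h.energy_nonneg t ⟨hs.trans hst, ht⟩
  nlinarith

theorem energy_le_div (h : Dissipation Ψ g T) {a t : ℝ} (ha : 0 < a) (ht0 : 0 < t) (ht : t ≤ T)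
    (hΨ : ∀ u ∈ Icc 0 T, Ψ u ^ 2 ≤ a * g u) : Ψ t ≤ a / t := by
  have htm : t ∈ Icc 0 T := ⟨ht0.le, ht⟩
  rcases (h.energy_nonneg t htm).eq_or_lt with h0 | h0
  · rw [← h0]; positivity
  have hpos : ∀ u ∈ Icc 0 t, 0 < Ψ u := fun u hu =>
    h0.trans_le (h.energy_anti ⟨hu.1, hu.2.trans ht⟩ htm hu.2)
  have hc : ContinuousOn (fun u => -(Ψ u)⁻¹) (Icc 0 t) :=
    ((h.cont.mono (Icc_subset_Icc le_rfl ht)).inv₀ fun u hu => (hpos u hu).ne').neg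
  -- The inequality Ψ' ≤ -Ψ²/a says that 1/Ψ grows at speed at least 1/a.
  have key := image_le_add_of_right_deriv_le (c := -a⁻¹) ht0.le hc
    (f' := fun u => -(-(-g u) / Ψ u ^ 2))
    (fun u hu => ((h.deriv u ⟨hu.1, hu.2.trans_le ht⟩).fun_inv
      (hpos u ⟨hu.1, hu.2.le⟩).ne').fun_neg) (fun u hu => by
        have h1 := hpos u ⟨hu.1, hu.2.le⟩
        have h2 := hΨ u ⟨hu.1, hu.2.le.trans ht⟩
        rw [neg_neg, neg_le_neg_iff, le_div_iff₀ (by positivity), inv_mul_le_iff₀ ha]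
        exact h2)
  have h2 : 0 < (Ψ 0)⁻¹ := inv_pos.2 (hpos 0 ⟨le_rfl, ht0.le⟩)
  have h3 : t / a ≤ (Ψ t)⁻¹ := by
    rw [div_eq_inv_mul]; linarith
  rw [le_inv_comm₀ (by positivity) h0, inv_div] at h3
  exact h3

theorem rate_le (h : Dissipation Ψ g T) {a t : ℝ} (ha : 0 < a) (ht0 : 0 < t) (ht : t ≤ T)
    (hΨ : ∀ u ∈ Icc 0 T, Ψ u ^ 2 ≤ a * g u) : g t ≤ 4 * a / t ^ 2 := by
  -- The first half of the interval brings the energy below 2a/t; the second half converts this into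
  -- a bound on the rate.
  have h1 := h.energy_le_div ha (half_pos ht0) (by linarith) hΨ
  have h2 := h.mul_rate_le (half_pos ht0).le (half_le_self ht0.le) ht
  rw [le_div_iff₀ (by positivity)]
  rw [le_div_iff₀ (by positivity)] at h1
  nlinarith

theorem energy_le_exp (h : Dissipation Ψ g T) {r s t : ℝ} (hs : 0 ≤ s) (hst : s ≤ t) (ht : t ≤ T)
    (hΨ : ∀ u ∈ Icc s t, r * Ψ u ≤ g u) : Ψ t ≤ Ψ s * Real.exp (-(r * (t - s))) := by
  have hc : ContinuousOn (fun u => Ψ u * Real.exp (r * u)) (Icc s t) :=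
    (h.cont.mono (Icc_subset_Icc hs ht)).mul (by fun_prop)
  have key := antitoneOn_of_right_deriv_nonpos hc
    (f' := fun u => -g u * Real.exp (r * u) + Ψ u * (Real.exp (r * u) * r))
    (fun u hu => by
      have h1 := h.deriv u ⟨hs.trans hu.1, hu.2.trans_le ht⟩
      have h2 : HasDerivAt (fun u => Real.exp (r * u)) (Real.exp (r * u) * r) u := by
        simpa using ((hasDerivAt_id u).const_mul r).exp
      exact h1.mul h2.hasDerivWithinAt)
    (fun u hu => by
      have := hΨ u ⟨hu.1, hu.2.le⟩
      have h3 := Real.exp_pos (r * u)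
      nlinarith)
  have := key ⟨le_rfl, hst⟩ ⟨hst, le_rfl⟩ hst
  simp only at this
  rw [← div_le_iff₀ (Real.exp_pos _)] at this
  · rw [show -(r * (t - s)) = r * s - r * t by ring, Real.exp_sub, ← mul_div_assoc,
      le_div_iff₀ (Real.exp_pos _)]
    rwa [div_le_iff₀ (Real.exp_pos _)] at this

/-- The rate falls below `lamH * x ^ 2` once the energy had time to decay algebraically, then
exponentially. -/
theorem rate_lt (h : Dissipation Ψ g T) {lamH s x : ℝ} (hH : 0 < lamH) (hs : 1 ≤ s) (hx : 0 < x)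
    (hT : 3.6 * Real.log s + 9 ≤ lamH * x * T)
    (h1 : ∀ u ∈ Icc 0 T, Ψ u ^ 2 ≤ (17 / 8) ^ 2 * s / lamH * g u)
    (h2 : ∀ u ∈ Icc 0 T, lamH * x ^ 2 ≤ g u → Ψ u ≤ 17 / 8 / x * (g u / lamH)) :
    g T < lamH * x ^ 2 := by
  by_contra! hc
  have hlog : 0 ≤ Real.log s := Real.log_nonneg hs
  have hT0 : 0 < T := by
    by_contra! h0
    have : lamH * x * T ≤ 0 := mul_nonpos_of_nonneg_of_nonpos (by positivity) h0
    linarith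
  have hg : ∀ u ∈ Icc 0 T, lamH * x ^ 2 ≤ g u := fun u hu =>
    hc.trans (h.anti hu ⟨hT0.le, le_rfl⟩ hu.2)
  -- Algebraic decay on the first fifth removes the dependence on the initial energy, exponential
  -- decay on the next three fifths removes the factor `s`, and the last fifth turns energy into
  -- rate.
  have e1 := h.energy_le_div (t := T / 5) (by positivity) (by positivity) (by linarith) h1
  have e2 := h.energy_le_exp (r := lamH * x * (8 / 17)) (s := T / 5) (t := 4 * T / 5)
    (by positivity) (by linarith) (by linarith) (fun u hu => by
      have hu' : u ∈ Icc 0 T := ⟨by linarith [hu.1], by linarith [hu.2]⟩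
      have := mul_le_mul_of_nonneg_left (h2 u hu' (hg u hu'))
        (show 0 ≤ lamH * x * (8 / 17) by positivity)
      refine this.trans_eq ?_
      field_simp)
  have e3 := h.mul_rate_le (s := 4 * T / 5) (t := T) (by positivity) (by linarith) le_rfl
  have hexp : Real.exp (-(lamH * x * (8 / 17) * (4 * T / 5 - T / 5))) ≤ 1 / (3 * s) := by
    -- The exponent is 24/85 of `lamH * x * T`, and 24/85 times 3.6 and 9 exceeds 1 and 2
    -- respectively.
    have : -(lamH * x * (8 / 17) * (4 * T / 5 - T / 5)) ≤ -(2 + Real.log s) := by nlinarith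
    refine (Real.exp_le_exp.2 this).trans ?_
    rw [Real.exp_neg, Real.exp_add, Real.exp_log (by linarith), one_div]
    have h3 : (3 : ℝ) ≤ Real.exp 2 := by linarith [Real.add_one_le_exp (2 : ℝ)]
    gcongr
  have hchain : lamH * x ^ 2 * (T / 5) ≤ (17 / 8) ^ 2 * s / lamH / (T / 5) * (1 / (3 * s)) := by
    calc lamH * x ^ 2 * (T / 5) ≤ g T * (T - 4 * T / 5) := by
          rw [show T - 4 * T / 5 = T / 5 by ring]; gcongr
      _ ≤ Ψ (4 * T / 5) := e3
      _ ≤ _ := e2.trans (mul_le_mul e1 hexp (Real.exp_pos _).le (by positivity))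
  have h4 : (17 / 8) ^ 2 * s / lamH / (T / 5) * (1 / (3 * s)) =
      (17 / 8) ^ 2 * 5 / 3 / (lamH * T) := by
    field_simp
  rw [h4, le_div_iff₀ (by positivity)] at hchain
  -- The chain forces the square of `lamH * x * T` to be at most (17/8)² · 25/3, about 37.6, against
  -- 81.
  have h5 : 9 ≤ lamH * x * T := by linarith
  nlinarith

end Dissipation

end Scalar

/-! ### The flow on the true support -/

section Flow

variable {ι E N F₂ : Type*} [Fintype ι]
  [NormedAddCommGroup E] [InnerProductSpace ℝ E] [FiniteDimensional ℝ E]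
  [NormedAddCommGroup N] [InnerProductSpace ℝ N] [FiniteDimensional ℝ N]
  [NormedAddCommGroup F₂] [InnerProductSpace ℝ F₂] [FiniteDimensional ℝ F₂]
  {A : E →L[ℝ] N} {D₁ : E →L[ℝ] EuclideanSpace ℝ ι} {D₂ : E →L[ℝ] F₂}
  {ν κ lamD LamD LamX lamH iL T : ℝ} {βo : E}
  {ρ γ ρ' γ' : ℝ → EuclideanSpace ℝ ι} {β β' : ℝ → E}

/-- The dynamics restricted to the support, on `[0, T]`, with `βo` the oracle estimator. -/
structure SplitFlow (A : E →L[ℝ] N) (D₁ : E →L[ℝ] EuclideanSpace ℝ ι) (D₂ : E →L[ℝ] F₂)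
    (ν κ T : ℝ) (βo : E) (ρ γ ρ' γ' : ℝ → EuclideanSpace ℝ ι) (β β' : ℝ → E) : Prop where
  κ_pos : 0 < κ
  T_nonneg : 0 ≤ T
  ρ_zero : ρ 0 = 0
  γ_zero : γ 0 = 0
  β_zero : β 0 = 0
  cont_ρ : ContinuousOn ρ (Icc 0 T)
  cont_γ : ContinuousOn γ (Icc 0 T)
  cont_β : ContinuousOn β (Icc 0 T)
  deriv_ρ : ∀ t ∈ Ico 0 T, HasDerivWithinAt ρ (ρ' t) (Ici t) t
  deriv_γ : ∀ t ∈ Ico 0 T, HasDerivWithinAt γ (γ' t) (Ici t) t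
  deriv_β : ∀ t ∈ Ico 0 T, HasDerivWithinAt β (β' t) (Ici t) t
  flow_β : ∀ t ∈ Ico 0 T, ∀ x, κ⁻¹ * ⟪β' t, x⟫ = -(⟪A (β t - βo), A x⟫ +
    ν⁻¹ * (⟪D₂ (β t - βo), D₂ x⟫ + ⟪D₁ (β t) - γ t, D₁ x⟫))
  flow_γ : ∀ t ∈ Ico 0 T, ρ' t + κ⁻¹ • γ' t = ν⁻¹ • (D₁ (β t) - γ t)
  abs_ρ_le : ∀ t, 0 ≤ t → ∀ j, |ρ t j| ≤ 1
  ρ_mul_γ : ∀ t, 0 ≤ t → ∀ j, ρ t j * γ t j = |γ t j|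

theorem sum_abs_le_sqrt_card (d : EuclideanSpace ℝ ι) :
    ∑ j, |d j| ≤ √(Fintype.card ι) * ‖d‖ := by
  refine le_of_sq_le_sq ?_ (by positivity)
  rw [mul_pow, Real.sq_sqrt (by positivity), EuclideanSpace.norm_sq_eq]
  simpa using sq_sum_le_card_mul_sum_sq (s := Finset.univ) (f := fun j => |d j|)

/-- A component of the Bregman distance of the `ℓ¹` norm. -/
theorem bregman_component {r c o : ℝ} (hr : |r| ≤ 1) (hrc : r * c = |c|) :
    0 ≤ |o| - r * o ∧ |o| - r * o ≤ 2 * |c - o| ∧ (|c - o| < |o| → |o| - r * o = 0) := by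
  have h1 : |r * o| ≤ |o| := by
    rw [abs_mul]; exact mul_le_of_le_one_left (abs_nonneg _) hr
  have h2 := abs_le.1 h1
  -- In this range `c` has the sign of `o`, so the subgradient `r` equals that sign.
  have h3 : |c - o| < |o| → |o| - r * o = 0 := by
    intro h
    rcases lt_trichotomy o 0 with ho | ho | ho
    · rw [abs_of_neg ho] at h ⊢
      have hc : c < 0 := by linarith [(abs_lt.1 h).2]
      rw [abs_of_neg hc] at hrc
      have : r = -1 := mul_right_cancel₀ hc.ne (by linarith)
      rw [this]; ring
    · simp [ho]
    · rw [abs_of_pos ho] at h ⊢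
      have hc : 0 < c := by linarith [(abs_lt.1 h).1]
      rw [abs_of_pos hc] at hrc
      have : r = 1 := mul_right_cancel₀ hc.ne' (by linarith)
      rw [this]; ring
  refine ⟨by linarith [h2.2], ?_, h3⟩
  by_cases h : |c - o| < |o|
  · rw [h3 h]; positivity
  · push Not at h
    linarith [h2.1]

theorem hasDerivWithinAt_coord {f : ℝ → EuclideanSpace ℝ ι} {f' : EuclideanSpace ℝ ι} {t : ℝ}
    {s : Set ℝ} (h : HasDerivWithinAt f f' s t) (j : ι) :
    HasDerivWithinAt (fun u => f u j) (f' j) s t :=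
  (EuclideanSpace.proj (𝕜 := ℝ) j).hasFDerivAt.comp_hasDerivWithinAt t h

namespace SplitFlow

variable (hF : SplitFlow A D₁ D₂ ν κ T βo ρ γ ρ' γ' β β')
include hF

/-- Coordinatewise, this is monotonicity of the subdifferential of the absolute value. -/
theorem inner_deriv_nonneg {t : ℝ} (ht : t ∈ Ico 0 T) : 0 ≤ ⟪ρ' t, γ' t⟫ := by
  rw [PiLp.inner_apply]
  refine Finset.sum_nonneg fun j _ => ?_
  have := mul_nonneg_of_right_deriv (hasDerivWithinAt_coord (hF.deriv_γ t ht) j)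
    (hasDerivWithinAt_coord (hF.deriv_ρ t ht) j) (fun u hu => by
      have h0 := ht.1
      have h1 := hF.ρ_mul_γ u (by linarith) j
      have h2 := hF.ρ_mul_γ t h0 j
      have h3 : ρ u j * γ t j ≤ |γ t j| := (le_abs_self _).trans (by
        rw [abs_mul]; exact mul_le_of_le_one_left (abs_nonneg _) (hF.abs_ρ_le u (by linarith) j))
      have h4 : ρ t j * γ u j ≤ |γ u j| := (le_abs_self _).trans (by
        rw [abs_mul]; exact mul_le_of_le_one_left (abs_nonneg _) (hF.abs_ρ_le t h0 j))
      nlinarith)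
  simpa using this

/-- Where a coordinate of `γ` is nonzero, its sign persists to the right of `t`, so the
corresponding coordinate of `ρ` is locally constant there. -/
theorem inner_deriv_eq_zero {t : ℝ} (ht : t ∈ Ico 0 T) : ⟪ρ' t, γ t⟫ = 0 := by
  rw [PiLp.inner_apply]
  refine Finset.sum_eq_zero fun j _ => ?_
  by_cases h0 : γ t j = 0
  · simp [h0]
  have hd := hasDerivWithinAt_coord (hF.deriv_ρ t ht) j
  have hγ := (hasDerivWithinAt_coord (hF.deriv_γ t ht) j).continuousWithinAt
  have hev : (fun u => ρ u j) =ᶠ[𝓝[Ici t] t] fun _ => ρ t j := by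
    have h2 := hF.ρ_mul_γ t ht.1 j
    rcases lt_or_gt_of_ne h0 with h | h
    · filter_upwards [hγ.eventually (gt_mem_nhds h), self_mem_nhdsWithin] with u hu hu2
      have h1 := hF.ρ_mul_γ u (ht.1.trans hu2) j
      rw [abs_of_neg hu] at h1
      rw [abs_of_neg h] at h2
      have e1 : ρ u j = -1 := mul_right_cancel₀ hu.ne (by linarith)
      have e2 : ρ t j = -1 := mul_right_cancel₀ h.ne (by linarith)
      rw [e1, e2]
    · filter_upwards [hγ.eventually (lt_mem_nhds h), self_mem_nhdsWithin] with u hu hu2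
      have h1 := hF.ρ_mul_γ u (ht.1.trans hu2) j
      rw [abs_of_pos hu] at h1
      rw [abs_of_pos h] at h2
      have e1 : ρ u j = 1 := mul_right_cancel₀ hu.ne' (by linarith)
      have e2 : ρ t j = 1 := mul_right_cancel₀ h.ne' (by linarith)
      rw [e1, e2]
  have hd0 : HasDerivWithinAt (fun u => ρ u j) 0 (Ici t) t :=
    (hasDerivWithinAt_const t (Ici t) (ρ t j)).congr_of_eventuallyEq hev rfl
  have : ρ' t j = 0 := (uniqueDiffWithinAt_Ici t).eq_deriv _ hd hd0
  simp [this]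

/-- The velocity of `β` is orthogonal to the common kernel and the start is 0. Coercivity is
therefore available along the whole path. -/
theorem mem_orthogonal (hβo : βo ∈ (commonKer A D₁ D₂)ᗮ) {t : ℝ} (ht : t ∈ Icc 0 T) :
    β t - βo ∈ (commonKer A D₁ D₂)ᗮ := by
  refine Submodule.sub_mem _ ?_ hβo
  rw [Submodule.mem_orthogonal']
  intro z hz
  obtain ⟨h1, h2, h3⟩ := mem_commonKer.1 hz
  have := constant_of_has_deriv_right_zero (f := fun t => ⟪β t, z⟫) (a := 0) (b := T)
    (hF.cont_β.inner continuousOn_const) (fun u hu => by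
      have hd := (hF.deriv_β u hu).inner ℝ (hasDerivWithinAt_const u (Ici u) z)
      have h0 := hF.flow_β u hu z
      rw [h1, h2, h3] at h0
      simp only [inner_zero_right, add_zero, mul_zero, neg_zero, mul_eq_zero, inv_eq_zero,
        hF.κ_pos.ne', false_or] at h0
      simpa [h0] using hd) t ht
  rw [this, hF.β_zero, inner_zero_left]

/-- The loss is nonincreasing along the flow. -/
theorem form_antitone : AntitoneOn
    (fun t => splitForm A D₁ D₂ ν (β t - βo) (γ t - D₁ βo)) (Icc 0 T) := by
  have hκ := inv_pos.2 hF.κ_pos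
  have hc1 : ContinuousOn (fun t => β t - βo) (Icc 0 T) := hF.cont_β.sub continuousOn_const
  have hc2 : ContinuousOn (fun t => γ t - D₁ βo) (Icc 0 T) := hF.cont_γ.sub continuousOn_const
  refine antitoneOn_of_right_deriv_nonpos (f' := fun t => 2 * ⟪A (β t - βo), A (β' t)⟫ +
    ν⁻¹ * (2 * ⟪D₂ (β t - βo), D₂ (β' t)⟫ +
      2 * ⟪D₁ (β t - βo) - (γ t - D₁ βo), D₁ (β' t) - γ' t⟫)) ?_ ?_ ?_
  · unfold splitForm
    have e1 := A.continuous.comp_continuousOn hc1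
    have e2 := D₂.continuous.comp_continuousOn hc1
    have e3 := (D₁.continuous.comp_continuousOn hc1).sub hc2
    exact (e1.norm.pow 2).add (((e2.norm.pow 2).add (e3.norm.pow 2)).const_smul ν⁻¹)
  · intro t ht
    have d1 := (hF.deriv_β t ht).sub_const βo
    have d2 := (hF.deriv_γ t ht).sub_const (D₁ βo)
    have e1 := (A.hasFDerivAt.comp_hasDerivWithinAt t d1).norm_sq
    have e2 := (D₂.hasFDerivAt.comp_hasDerivWithinAt t d1).norm_sq
    have e3 := ((D₁.hasFDerivAt.comp_hasDerivWithinAt t d1).sub d2).norm_sq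
    exact e1.add ((e2.add e3).const_mul ν⁻¹)
  · intro t ht
    -- Pairing the dynamics with the velocities shows that the form decreases at rate 2(κ⁻¹‖β'‖² +
    -- κ⁻¹‖γ'‖² + ⟪ρ', γ'⟫).
    have h1 := hF.flow_β t ht (β' t)
    have h2 := congrArg (fun v => ⟪v, γ' t⟫) (hF.flow_γ t ht)
    have h3 := hF.inner_deriv_nonneg ht
    have h4 : D₁ (β t - βo) - (γ t - D₁ βo) = D₁ (β t) - γ t := by rw [map_sub]; abel
    simp only [inner_add_left, inner_smul_left, RCLike.conj_to_real,
      real_inner_self_eq_norm_sq] at h1 h2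
    rw [h4, inner_sub_right]
    nlinarith [mul_nonneg hκ.le (sq_nonneg ‖β' t‖), mul_nonneg hκ.le (sq_nonneg ‖γ' t‖)]

theorem dissipation (hν : 0 < ν) : Dissipation
    (fun t => ∑ j, (|D₁ βo j| - ρ t j * D₁ βo j) +
      (2 * κ)⁻¹ * (‖β t - βo‖ ^ 2 + ‖γ t - D₁ βo‖ ^ 2))
    (fun t => splitForm A D₁ D₂ ν (β t - βo) (γ t - D₁ βo)) T where
  cont := by
    have hc1 : ContinuousOn (fun t => β t - βo) (Icc 0 T) := hF.cont_β.sub continuousOn_const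
    have hc2 : ContinuousOn (fun t => γ t - D₁ βo) (Icc 0 T) := hF.cont_γ.sub continuousOn_const
    refine ContinuousOn.add (continuousOn_finsetSum _ fun j _ => ?_)
      (((hc1.norm.pow 2).add (hc2.norm.pow 2)).const_smul (2 * κ)⁻¹)
    have : ContinuousOn (fun t => ρ t j) (Icc 0 T) :=
      (EuclideanSpace.proj (𝕜 := ℝ) j).continuous.comp_continuousOn hF.cont_ρ
    fun_prop
  deriv := by
    intro t ht
    have hκ := hF.κ_pos
    have d1 := ((hF.deriv_β t ht).sub_const βo).norm_sq
    have d2 := ((hF.deriv_γ t ht).sub_const (D₁ βo)).norm_sq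
    have d3 : HasDerivWithinAt (fun t => ∑ j, (|D₁ βo j| - ρ t j * D₁ βo j))
        (∑ j, -(ρ' t j * D₁ βo j)) (Ici t) t :=
      HasDerivWithinAt.fun_sum fun j _ =>
        ((hasDerivWithinAt_coord (hF.deriv_ρ t ht) j).mul_const _).const_sub _
    refine (d3.add ((d1.add d2).const_mul (2 * κ)⁻¹)).congr_deriv ?_
    have e3 : ∑ j, -(ρ' t j * D₁ βo j) = -⟪ρ' t, D₁ βo⟫ := by
      rw [PiLp.inner_apply, Finset.sum_neg_distrib]
      simp [mul_comm]
    have h1 := hF.flow_β t ht (β t - βo)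
    have h2 := congrArg (fun v => ⟪v, γ t - D₁ βo⟫) (hF.flow_γ t ht)
    have h3 := hF.inner_deriv_eq_zero ht
    have h4 : D₁ (β t) - γ t = D₁ (β t - βo) - (γ t - D₁ βo) := by rw [map_sub]; abel
    -- Complementarity identifies the derivative of the Bregman term with a pairing against the
    -- error, so the dynamics can be substituted.
    have h5 : ⟪ρ' t, γ t - D₁ βo⟫ = -⟪ρ' t, D₁ βo⟫ := by rw [inner_sub_right, h3, zero_sub]
    rw [e3, splitForm]
    simp only [inner_add_left, inner_smul_left, RCLike.conj_to_real, h5, h4] at h1 h2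
    have h6 : ‖D₁ (β t - βo) - (γ t - D₁ βo)‖ ^ 2 =
        ⟪D₁ (β t - βo) - (γ t - D₁ βo), D₁ (β t - βo)⟫ -
        ⟪D₁ (β t - βo) - (γ t - D₁ βo), γ t - D₁ βo⟫ := by
      rw [← inner_sub_right, real_inner_self_eq_norm_sq]
    rw [real_inner_self_eq_norm_sq, real_inner_self_eq_norm_sq] at h1
    rw [h6, real_inner_comm _ (β t - βo), real_inner_comm _ (γ t - D₁ βo), mul_inv]
    linear_combination h1 + h2
  anti := hF.form_antitone
  rate_nonneg := by
    intro t _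
    have := inv_pos.2 hν
    simp only [splitForm]
    positivity
  energy_nonneg := by
    intro t ht
    have := hF.κ_pos
    refine add_nonneg (Finset.sum_nonneg fun j _ => ?_) (by positivity)
    exact (bregman_component (hF.abs_ρ_le t ht.1 j) (hF.ρ_mul_γ t ht.1 j)).1

end SplitFlow

end Flow

theorem sign_eq_of_abs_sub_lt {c o : ℝ} (h : |c - o| < |o|) : SignType.sign c = SignType.sign o := by
  rcases lt_trichotomy o 0 with ho | ho | ho
  · rw [abs_of_neg ho] at h
    rw [sign_neg ho, sign_neg (by linarith [(abs_lt.1 h).2])]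
  · rw [ho, abs_zero] at h
    exact absurd h (not_lt.2 (abs_nonneg _))
  · rw [abs_of_pos ho] at h
    rw [sign_pos ho, sign_pos (by linarith [(abs_lt.1 h).1])]

/-! ### Convergence to the oracle: ℓ₂ rate and signs. -/

section FlowBounds

variable {ι E N F₂ : Type*} [Fintype ι]
  [NormedAddCommGroup E] [InnerProductSpace ℝ E] [FiniteDimensional ℝ E]
  [NormedAddCommGroup N] [InnerProductSpace ℝ N] [FiniteDimensional ℝ N]
  [NormedAddCommGroup F₂] [InnerProductSpace ℝ F₂] [FiniteDimensional ℝ F₂]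
  {A : E →L[ℝ] N} {D₁ : E →L[ℝ] EuclideanSpace ℝ ι} {D₂ : E →L[ℝ] F₂}
  {ν κ lamD LamD LamX lamH iL T η : ℝ} {βo : E}
  {ρ γ ρ' γ' : ℝ → EuclideanSpace ℝ ι} {β β' : ℝ → E}

namespace SplitFlow

variable (hF : SplitFlow A D₁ D₂ ν κ T βo ρ γ ρ' γ' β β')
  (H : SplitBounds A D₁ D₂ ν lamD LamD LamX lamH iL)
include hF H

theorem form_le_init {t : ℝ} (ht : t ∈ Icc 0 T) :
    splitForm A D₁ D₂ ν (β t - βo) (γ t - D₁ βo) ≤ splitForm A D₁ D₂ ν βo (D₁ βo) := by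
  have := hF.form_antitone ⟨le_rfl, hF.T_nonneg⟩ ht ht.1
  refine this.trans_eq ?_
  simp [splitForm, hF.β_zero, hF.γ_zero]

theorem errors_le (hβo : βo ∈ (commonKer A D₁ D₂)ᗮ) {t q : ℝ} (ht : t ∈ Icc 0 T) (hq : 0 ≤ q)
    (h : splitForm A D₁ D₂ ν (β t - βo) (γ t - D₁ βo) ≤ lamH * q ^ 2) :
    ‖β t - βo‖ ≤ q ∧ ‖γ t - D₁ βo‖ ≤ q := by
  have h1 := (H.form_ge _ (hF.mem_orthogonal hβo ht) (γ t - D₁ βo)).trans h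
  have h2 := le_of_mul_le_mul_left h1 H.lamH_pos
  exact ⟨le_of_sq_le_sq (by nlinarith [sq_nonneg ‖γ t - D₁ βo‖]) hq,
    le_of_sq_le_sq (by nlinarith [sq_nonneg ‖β t - βo‖]) hq⟩

variable [Nonempty ι] (hβo : βo ∈ (commonKer A D₁ D₂)ᗮ)
  (hκ : splitForm A D₁ D₂ ν βo (D₁ βo) ≤ lamH * (κ / 4) ^ 2)
include hβo hκ

/-- With q² = g/`lamH`, the Bregman part is at most 2√s q, by comparing ℓ¹ and ℓ² norms. The
quadratic part is at most q²/(2κ) ≤ q/8, because q never exceeds κ/4. Together they give the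
constant 17/8. -/
theorem energy_sq_le {t : ℝ} (ht : t ∈ Icc 0 T) :
    (∑ j, (|D₁ βo j| - ρ t j * D₁ βo j) +
      (2 * κ)⁻¹ * (‖β t - βo‖ ^ 2 + ‖γ t - D₁ βo‖ ^ 2)) ^ 2 ≤
    (17 / 8) ^ 2 * (Fintype.card ι : ℝ) / lamH *
      splitForm A D₁ D₂ ν (β t - βo) (γ t - D₁ βo) := by
  have hH := H.lamH_pos
  have hκ0 := hF.κ_pos
  set g := splitForm A D₁ D₂ ν (β t - βo) (γ t - D₁ βo) with hg
  set q := √(g / lamH) with hq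
  have hg0 : 0 ≤ g := (hF.dissipation H.ν_pos).rate_nonneg t ht
  have hq2 : q ^ 2 = g / lamH := Real.sq_sqrt (by positivity)
  have hgq : g = lamH * q ^ 2 := by rw [hq2]; field_simp
  have hq0 : 0 ≤ q := Real.sqrt_nonneg _
  have h1 := H.form_ge _ (hF.mem_orthogonal hβo ht) (γ t - D₁ βo)
  rw [← hg, hgq] at h1
  have h2 := le_of_mul_le_mul_left h1 hH
  -- The loss only decreases, so the initial bound on the form holds throughout.
  have hqκ : q ≤ κ / 4 := by
    refine le_of_sq_le_sq ?_ (by positivity)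
    have := (hF.form_le_init H ht).trans hκ
    rw [← hg, hgq] at this
    exact le_of_mul_le_mul_left this hH
  obtain ⟨-, hdγ⟩ := hF.errors_le H hβo ht hq0 hgq.le
  have hs : 1 ≤ √(Fintype.card ι : ℝ) := by
    rw [Real.one_le_sqrt]
    exact_mod_cast Fintype.card_pos
  have hb : ∑ j, (|D₁ βo j| - ρ t j * D₁ βo j) ≤ 2 * (√(Fintype.card ι) * q) := by
    calc ∑ j, (|D₁ βo j| - ρ t j * D₁ βo j)
        ≤ ∑ j, 2 * |(γ t - D₁ βo) j| := Finset.sum_le_sum fun j _ =>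
          (bregman_component (hF.abs_ρ_le t ht.1 j) (hF.ρ_mul_γ t ht.1 j)).2.1
      _ ≤ 2 * (√(Fintype.card ι) * q) := by
          rw [← Finset.mul_sum]
          have := sum_abs_le_sqrt_card (γ t - D₁ βo)
          nlinarith
  have hsq : (2 * κ)⁻¹ * (‖β t - βo‖ ^ 2 + ‖γ t - D₁ βo‖ ^ 2) ≤ √(Fintype.card ι) * q / 8 := by
    rw [inv_mul_le_iff₀ (by positivity)]
    nlinarith [mul_le_mul_of_nonneg_left hqκ hq0, mul_nonneg hq0 (sub_nonneg.2 hs),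
      mul_nonneg hκ0.le (mul_nonneg hq0 (sub_nonneg.2 hs))]
  have h0 := (hF.dissipation H.ν_pos).energy_nonneg t ht
  calc _ ≤ (17 / 8 * (√(Fintype.card ι) * q)) ^ 2 := by
        refine pow_le_pow_left₀ h0 ?_ 2
        linarith
    _ = _ := by
        rw [mul_pow, mul_pow, hq2, Real.sq_sqrt (by positivity)]
        ring

theorem errors_le_at_end (hT : 0 < T) :
    ‖β T - βo‖ ≤ 17 / 4 * √(Fintype.card ι) / (lamH * T) ∧
    ‖γ T - D₁ βo‖ ≤ 17 / 4 * √(Fintype.card ι) / (lamH * T) := by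
  have hH := H.lamH_pos
  have hc : (0 : ℝ) < Fintype.card ι := by exact_mod_cast Fintype.card_pos
  refine hF.errors_le H hβo ⟨hT.le, le_rfl⟩ (by positivity) ?_
  refine ((hF.dissipation H.ν_pos).rate_le (by positivity) hT le_rfl
    fun u hu => hF.energy_sq_le H hβo hκ hu).trans_eq ?_
  rw [div_pow (17 / 4 * √(Fintype.card ι : ℝ)), mul_pow (17 / 4), Real.sq_sqrt hc.le]
  field_simp
  norm_num

theorem sign_at_end {x : ℝ} (hx : 0 < x) (hxo : ∀ j, x ≤ |D₁ βo j|)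
    (hT : 3.6 * Real.log (Fintype.card ι) + 9 ≤ lamH * x * T) (j : ι) :
    SignType.sign (γ T j) = SignType.sign (D₁ βo j) := by
  have hH := H.lamH_pos
  have hκ0 := hF.κ_pos
  have hTm : T ∈ Icc 0 T := ⟨hF.T_nonneg, le_rfl⟩
  have hlt := (hF.dissipation H.ν_pos).rate_lt hH
    (by exact_mod_cast Fintype.card_pos) hx hT
    (fun u hu => hF.energy_sq_le H hβo hκ hu) (fun t ht hxt => by
      set g := splitForm A D₁ D₂ ν (β t - βo) (γ t - D₁ βo) with hg
      have h1 := H.form_ge _ (hF.mem_orthogonal hβo ht) (γ t - D₁ βo)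
      rw [← hg, ← le_div_iff₀' hH] at h1
      have hxκ : x ≤ κ / 4 := by
        refine le_of_sq_le_sq ?_ (by positivity)
        exact le_of_mul_le_mul_left (hxt.trans ((hF.form_le_init H ht).trans hκ)) hH
      -- A coordinate contributes only if its error is at least `x`, and then the linear bound
      -- 2|error| is at most 2 error²/x. This avoids the factor √s.
      have hb : ∑ j, (|D₁ βo j| - ρ t j * D₁ βo j) ≤ 2 / x * ‖γ t - D₁ βo‖ ^ 2 := by
        rw [EuclideanSpace.norm_sq_eq, Finset.mul_sum]
        refine Finset.sum_le_sum fun j _ => ?_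
        obtain ⟨-, h3, h4⟩ := bregman_component (hF.abs_ρ_le t ht.1 j) (hF.ρ_mul_γ t ht.1 j)
          (o := D₁ βo j)
        by_cases hlt : |γ t j - D₁ βo j| < |D₁ βo j|
        · rw [h4 hlt]; positivity
        · push Not at hlt
          refine h3.trans ?_
          have := (hxo j).trans hlt
          rw [div_mul_eq_mul_div, le_div_iff₀ hx, Real.norm_eq_abs, PiLp.sub_apply]
          nlinarith
      have hk : (2 * κ)⁻¹ ≤ 1 / (8 * x) := by
        rw [inv_eq_one_div]
        exact one_div_le_one_div_of_le (by positivity) (by linarith)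
      calc _ ≤ 2 / x * (‖β t - βo‖ ^ 2 + ‖γ t - D₁ βo‖ ^ 2) +
            1 / (8 * x) * (‖β t - βo‖ ^ 2 + ‖γ t - D₁ βo‖ ^ 2) := by
            refine add_le_add (hb.trans ?_) (by gcongr)
            gcongr
            nlinarith [sq_nonneg ‖β t - βo‖]
        _ = 17 / 8 / x * (‖β t - βo‖ ^ 2 + ‖γ t - D₁ βo‖ ^ 2) := by field_simp; norm_num
        _ ≤ _ := by gcongr)
  have h1 := (H.form_ge _ (hF.mem_orthogonal hβo hTm) (γ T - D₁ βo)).trans_lt hlt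
  have h2 := lt_of_mul_lt_mul_left h1 hH.le
  have h3 : |γ T j - D₁ βo j| ≤ ‖γ T - D₁ βo‖ := by
    simpa using PiLp.norm_apply_le (γ T - D₁ βo) j
  refine sign_eq_of_abs_sub_lt ((h3.trans_lt ?_).trans_le (hxo j))
  exact lt_of_pow_lt_pow_left₀ 2 hx.le (by nlinarith [sq_nonneg ‖β T - βo‖])

end SplitFlow

/-! ### The irrepresentable condition -/

/-- `(kE, kF)` is a row of `H_{Sᶜ,(β,S)} H_{(β,S),(β,S)}†`, with `φ` the coordinate of that row,
for which the irrepresentable condition holds with constant `η`. -/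
structure IrrRow (A : E →L[ℝ] N) (D₁ : E →L[ℝ] EuclideanSpace ℝ ι) (D₂ : E →L[ℝ] F₂)
    (ν η : ℝ) (φ : F₂ →L[ℝ] ℝ) (kE : E →L[ℝ] ℝ) (kF : EuclideanSpace ℝ ι →L[ℝ] ℝ) : Prop where
  norm_φ : ∀ v, |φ v| ≤ ‖v‖
  factor : ∀ w g, kE (LinearMap.adjoint A.toLinearMap (A w) +
      ν⁻¹ • (LinearMap.adjoint D₂.toLinearMap (D₂ w) +
        LinearMap.adjoint D₁.toLinearMap (D₁ w - g))) + kF (ν⁻¹ • (g - D₁ w)) = -(ν⁻¹ * φ (D₂ w))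
  irr : ∀ r : EuclideanSpace ℝ ι, (∀ j, |r j| ≤ 1) → |kF r| ≤ 1 - η

namespace IrrRow

variable {φ : F₂ →L[ℝ] ℝ} {kE : E →L[ℝ] ℝ} {kF : EuclideanSpace ℝ ι →L[ℝ] ℝ}

/-- Irrepresentability bounds the functional on the cube, which contains the Euclidean unit ball. -/
theorem abs_kF_le (hk : IrrRow A D₁ D₂ ν η φ kE kF) (hη : 0 ≤ η) (v : EuclideanSpace ℝ ι) :
    |kF v| ≤ ‖v‖ := by
  rcases (norm_nonneg v).eq_or_lt with h | h
  · have : v = 0 := by simpa using h.symm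
    simp [this]
  · have h1 := hk.irr (‖v‖⁻¹ • v) (fun j => by
      rw [PiLp.smul_apply, smul_eq_mul, abs_mul, abs_of_pos (inv_pos.2 h), inv_mul_le_iff₀ h,
        mul_one]
      simpa using PiLp.norm_apply_le v j)
    rw [map_smul, smul_eq_mul, abs_mul, abs_of_pos (inv_pos.2 h), inv_mul_le_iff₀ h] at h1
    nlinarith

/-- A vector orthogonal to all elements of the proposed form is killed by the transform, and then,
being admissible as `f`, also by the design. It hence lies in the common kernel, and taking
complements gives the claim. -/
theorem exists_decomposition {b : E} (hb : b ∈ (commonKer A D₁ D₂)ᗮ) :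
    ∃ f x, D₁ f = 0 ∧ D₂ f = 0 ∧ b = LinearMap.adjoint A.toLinearMap (A f) +
      (LinearMap.adjoint D₁.toLinearMap (D₁ x) + LinearMap.adjoint D₂.toLinearMap (D₂ x)) := by
  set P : E →ₗ[ℝ] E := LinearMap.adjoint A.toLinearMap ∘ₗ A.toLinearMap with hP
  set Q : E →ₗ[ℝ] E := LinearMap.adjoint D₁.toLinearMap ∘ₗ D₁.toLinearMap +
    LinearMap.adjoint D₂.toLinearMap ∘ₗ D₂.toLinearMap with hQ
  set K := LinearMap.ker D₁.toLinearMap ⊓ LinearMap.ker D₂.toLinearMap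
  have hle : (commonKer A D₁ D₂)ᗮ ≤ K.map P ⊔ LinearMap.range Q := by
    rw [← Submodule.orthogonal_orthogonal (K.map P ⊔ LinearMap.range Q)]
    refine Submodule.orthogonal_le fun z hz => ?_
    rw [Submodule.mem_orthogonal] at hz
    have h1 := hz (Q z) (Submodule.mem_sup_right ⟨z, rfl⟩)
    simp only [hQ, LinearMap.add_apply, LinearMap.comp_apply, inner_add_left,
      LinearMap.adjoint_inner_left, real_inner_self_eq_norm_sq] at h1
    change ‖D₁ z‖ ^ 2 + ‖D₂ z‖ ^ 2 = 0 at h1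
    have hD1 : D₁ z = 0 := by
      rw [← norm_eq_zero]; nlinarith [sq_nonneg ‖D₁ z‖, sq_nonneg ‖D₂ z‖]
    have hD2 : D₂ z = 0 := by
      rw [← norm_eq_zero]; nlinarith [sq_nonneg ‖D₁ z‖, sq_nonneg ‖D₂ z‖]
    have h2 := hz (P z) (Submodule.mem_sup_left (Submodule.mem_map_of_mem ⟨hD1, hD2⟩))
    simp only [hP, LinearMap.comp_apply, LinearMap.adjoint_inner_left,
      real_inner_self_eq_norm_sq] at h2
    have hA : A z = 0 := by simpa using h2
    exact mem_commonKer.2 ⟨hA, hD1, hD2⟩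
  obtain ⟨y, ⟨f, hf, rfl⟩, z, ⟨x, rfl⟩, hyz⟩ := Submodule.mem_sup.1 (hle hb)
  exact ⟨f, x, hf.1, hf.2, hyz.symm⟩

/-- The row is evaluated piecewise on the decomposition of `b`, without any norm bound for the
pseudoinverse. The design part contributes 0, the on-support part becomes a value of `kF`, and the
off-support part is the off-support transform of a normal-equation solution. The last two have size
at most ‖Dx‖, which accounts for the factor 2. -/
theorem abs_le (hk : IrrRow A D₁ D₂ ν η φ kE kF) (hη : 0 ≤ η)
    (H : SplitBounds A D₁ D₂ ν lamD LamD LamX lamH iL) {b : E}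
    (hb : b ∈ (commonKer A D₁ D₂)ᗮ) (c : EuclideanSpace ℝ ι) :
    |kE b + kF c| ≤ ‖c‖ + 2 * ((1 + LamX * iL) / lamD) * ‖b‖ := by
  have hν := H.ν_pos
  have hX := H.LamX_pos
  obtain ⟨f, x, hf1, hf2, hbe⟩ := exists_decomposition hb
  have k1 : kE (LinearMap.adjoint A.toLinearMap (A f)) = 0 := by
    have := hk.factor f 0
    simpa [hf1, hf2] using this
  have k2 : kE (LinearMap.adjoint D₁.toLinearMap (D₁ x)) = kF (D₁ x) := by
    have := hk.factor 0 (ν • D₁ x)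
    simp only [map_zero, zero_add, zero_sub, map_neg, map_smul, smul_neg, sub_zero,
      smul_smul, inv_mul_cancel₀ hν.ne', one_smul, mul_zero, neg_zero] at this
    linarith
  obtain ⟨w, hw, hwn⟩ : ∃ w, NormalEq A D₂ ν w (LinearMap.adjoint D₂.toLinearMap (D₂ x)) ∧
      ν⁻¹ * ‖D₂ w‖ ≤ ‖D₂ x‖ := by
    obtain ⟨R, hR⟩ := H.exists_normalEq_inverse
    obtain ⟨-, hw⟩ := hR _ (SplitBounds.adjoint_D₂_mem (A := A) (D₁ := D₁) (D₂ := D₂) (D₂ x))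
    refine ⟨_, hw, ?_⟩
    set w := R (LinearMap.adjoint D₂.toLinearMap (D₂ x))
    have h1 := hw w
    rw [LinearMap.adjoint_inner_left, real_inner_self_eq_norm_sq, real_inner_self_eq_norm_sq] at h1
    have h2 := real_inner_le_norm (D₂ x) (D₂ w)
    change _ = ⟪D₂ x, D₂ w⟫ at h1
    rcases (norm_nonneg (D₂ w)).eq_or_lt with h | h
    · rw [← h]; simp
    · refine le_of_mul_le_mul_right ?_ h
      nlinarith [sq_nonneg ‖A w‖]
  have k3 : kE (LinearMap.adjoint D₂.toLinearMap (D₂ x)) = -(ν⁻¹ * φ (D₂ w)) := by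
    have h1 : LinearMap.adjoint D₂.toLinearMap (D₂ x) = LinearMap.adjoint A.toLinearMap (A w) +
        ν⁻¹ • (LinearMap.adjoint D₂.toLinearMap (D₂ w)) := by
      refine ext_inner_right ℝ fun v => ?_
      rw [← hw v, inner_add_left, inner_smul_left, LinearMap.adjoint_inner_left,
        LinearMap.adjoint_inner_left]
      rfl
    have := hk.factor w (D₁ w)
    rw [sub_self, map_zero, add_zero, smul_zero, map_zero, add_zero] at this
    rw [h1, this]
  -- the size of the part in the image of the transpose of the transform
  have hAf : ‖A f‖ ≤ iL * ‖b‖ := by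
    obtain ⟨f', h1, h2, h3, h4⟩ := H.lift_A f hf1 hf2
    have h5 : ⟪b, f'⟫ = ‖A f‖ ^ 2 := by
      rw [hbe, inner_add_left, inner_add_left, LinearMap.adjoint_inner_left,
        LinearMap.adjoint_inner_left, LinearMap.adjoint_inner_left]
      simp [h1, h2, h3]
    have h6 := real_inner_le_norm b f'
    rw [h5] at h6
    rcases (norm_nonneg (A f)).eq_or_lt with h | h
    · rw [← h]; have := H.iL_nonneg; positivity
    · refine le_of_mul_le_mul_right ?_ h
      nlinarith [mul_le_mul_of_nonneg_left h4 (norm_nonneg b)]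
  set Z := √(‖D₁ x‖ ^ 2 + ‖D₂ x‖ ^ 2) with hZ
  have hZ2 : Z ^ 2 = ‖D₁ x‖ ^ 2 + ‖D₂ x‖ ^ 2 := Real.sq_sqrt (by positivity)
  have hZ0 : 0 ≤ Z := Real.sqrt_nonneg _
  have hZ1 : ‖D₁ x‖ ≤ Z := le_of_sq_le_sq (by rw [hZ2]; nlinarith [sq_nonneg ‖D₂ x‖]) hZ0
  have hZ3 : ‖D₂ x‖ ≤ Z := le_of_sq_le_sq (by rw [hZ2]; nlinarith [sq_nonneg ‖D₁ x‖]) hZ0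
  have hZb : Z ≤ (1 + LamX * iL) / lamD * ‖b‖ := by
    obtain ⟨x', h1, h2, h3⟩ := H.lift_D x
    have h4 : ⟪b - LinearMap.adjoint A.toLinearMap (A f), x'⟫ = Z ^ 2 := by
      rw [hbe, add_sub_cancel_left, inner_add_left, LinearMap.adjoint_inner_left,
        LinearMap.adjoint_inner_left, hZ2]
      simp [h1, h2]
    have h5 : lamD * ‖x'‖ ≤ Z := by
      refine Real.le_sqrt_of_sq_le ?_
      rw [mul_pow]; exact h3
    have h6 : ⟪b - LinearMap.adjoint A.toLinearMap (A f), x'⟫ ≤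
        (1 + LamX * iL) * ‖b‖ * ‖x'‖ := by
      rw [inner_sub_left, LinearMap.adjoint_inner_left]
      have h7 := real_inner_le_norm b x'
      have h8 : -⟪A f, A x'⟫ ≤ ‖A f‖ * ‖A x'‖ := (neg_le_abs _).trans (abs_real_inner_le_norm _ _)
      have h9 : ‖A f‖ * ‖A x'‖ ≤ (iL * ‖b‖) * (LamX * ‖x'‖) :=
        mul_le_mul hAf (H.norm_A x') (norm_nonneg _) ((norm_nonneg _).trans hAf)
      change ⟪b, x'⟫ - ⟪A f, A x'⟫ ≤ _
      linarith
    rw [h4] at h6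
    have hL := H.iL_nonneg
    have hlam := H.lamD_pos
    rcases hZ0.eq_or_lt with h | h
    · rw [← h]; positivity
    · rw [div_mul_eq_mul_div, le_div_iff₀ hlam]
      refine le_of_mul_le_mul_right ?_ h
      have := mul_le_mul_of_nonneg_left h5 (show 0 ≤ (1 + LamX * iL) * ‖b‖ by positivity)
      nlinarith
  have hk3 : |kE (LinearMap.adjoint D₂.toLinearMap (D₂ x))| ≤ Z := by
    rw [k3, abs_neg, abs_mul, abs_of_pos (inv_pos.2 hν)]
    have := mul_le_mul_of_nonneg_left (hk.norm_φ (D₂ w)) (inv_pos.2 hν).le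
    linarith
  have hsum : kE b + kF c = kF (c + D₁ x) + kE (LinearMap.adjoint D₂.toLinearMap (D₂ x)) := by
    rw [hbe, map_add, map_add, k1, k2, map_add]; ring
  rw [hsum]
  calc _ ≤ |kF (c + D₁ x)| + |kE (LinearMap.adjoint D₂.toLinearMap (D₂ x))| := abs_add_le _ _
    _ ≤ (‖c‖ + Z) + Z := by
      refine add_le_add ?_ hk3
      exact (hk.abs_kF_le hη _).trans ((norm_add_le _ _).trans (by linarith))
    _ ≤ _ := by linarith

/-- The dual variable off the support stays inside the unit interval. -/
theorem abs_dual_le (hk : IrrRow A D₁ D₂ ν η φ kE kF) (hη : 0 < η)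
    (H : SplitBounds A D₁ D₂ ν lamD LamD LamX lamH iL)
    (hF : SplitFlow A D₁ D₂ ν κ T βo ρ γ ρ' γ' β β') (hβo : βo ∈ (commonKer A D₁ D₂)ᗮ)
    {r : ℝ → ℝ} (hr0 : r 0 = 0) (hr : ContinuousOn r (Icc 0 T))
    (hr' : ∀ t ∈ Ico 0 T, HasDerivWithinAt r (ν⁻¹ * φ (D₂ (β t))) (Ici t) t)
    {R B : ℝ} (hR : 0 ≤ R) (hB1 : ‖βo‖ ≤ B) (hB2 : ‖D₁ βo‖ ≤ B)
    (hRB : splitForm A D₁ D₂ ν βo (D₁ βo) ≤ lamH * (R * B) ^ 2)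
    (hκ : 4 / η * (1 + 1 / lamD + LamX * iL / lamD) * (1 + R) * B ≤ κ)
    (hT : T * (ν⁻¹ * |φ (D₂ βo)|) ≤ η / 4) : |r T| ≤ 1 - η / 4 := by
  have hκ0 := hF.κ_pos
  have hB0 : 0 ≤ B := (norm_nonneg _).trans hB1
  have hTm : T ∈ Icc 0 T := ⟨hF.T_nonneg, le_rfl⟩
  -- Both sides vanish at time 0 and have the same right derivative: applying the row to the
  -- on-support dynamics reproduces the off-support gradient up to its constant value at the oracle.
  have heq : r T = kE (κ⁻¹ • β T) + kF (ρ T + κ⁻¹ • γ T) + T * (ν⁻¹ * φ (D₂ βo)) := by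
    refine eq_of_has_deriv_right_eq (f' := fun t => ν⁻¹ * φ (D₂ (β t))) hr' (fun t ht => ?_) hr ?_
      ?_ T hTm (g := fun t => kE (κ⁻¹ • β t) + kF (ρ t + κ⁻¹ • γ t) + t * (ν⁻¹ * φ (D₂ βo)))
    · have d1 := kE.hasFDerivAt.comp_hasDerivWithinAt t ((hF.deriv_β t ht).const_smul κ⁻¹)
      have d2 := kF.hasFDerivAt.comp_hasDerivWithinAt t
        ((hF.deriv_ρ t ht).add ((hF.deriv_γ t ht).const_smul κ⁻¹))
      have d3 := (hasDerivWithinAt_id t (Ici t)).mul_const (ν⁻¹ * φ (D₂ βo))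
      refine ((d1.add d2).add d3).congr_deriv ?_
      have e1 : κ⁻¹ • β' t = -(LinearMap.adjoint A.toLinearMap (A (β t - βo)) +
          ν⁻¹ • (LinearMap.adjoint D₂.toLinearMap (D₂ (β t - βo)) +
          LinearMap.adjoint D₁.toLinearMap (D₁ (β t - βo) - (γ t - D₁ βo)))) := by
        refine ext_inner_right ℝ fun v => ?_
        rw [inner_smul_left, inner_neg_left, inner_add_left, inner_smul_left, inner_add_left,
          LinearMap.adjoint_inner_left, LinearMap.adjoint_inner_left,
          LinearMap.adjoint_inner_left, show D₁ (β t - βo) - (γ t - D₁ βo) = D₁ (β t) - γ t by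
            rw [map_sub]; abel]
        exact hF.flow_β t ht v
      have e2 : ρ' t + κ⁻¹ • γ' t = -(ν⁻¹ • ((γ t - D₁ βo) - D₁ (β t - βo))) := by
        rw [hF.flow_γ t ht, ← smul_neg, map_sub]; congr 1; abel
      have e3 := hk.factor (β t - βo) (γ t - D₁ βo)
      change kE (κ⁻¹ • β' t) + kF (ρ' t + κ⁻¹ • γ' t) + 1 * (ν⁻¹ * φ (D₂ βo)) = _
      rw [e1, e2, map_neg, map_neg]
      rw [map_sub D₂, map_sub φ] at e3
      rw [map_sub D₂]
      linear_combination -e3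
    · have c1 := kE.continuous.comp_continuousOn (hF.cont_β.const_smul κ⁻¹)
      have c2 := kF.continuous.comp_continuousOn (hF.cont_ρ.add (hF.cont_γ.const_smul κ⁻¹))
      exact (c1.add c2).add (continuousOn_id.mul continuousOn_const)
    · simp [hr0, hF.β_zero, hF.γ_zero, hF.ρ_zero]
  have hβT : β T ∈ (commonKer A D₁ D₂)ᗮ := by
    have := Submodule.add_mem _ (hF.mem_orthogonal hβo hTm) hβo
    simpa using this
  obtain ⟨h1, h2⟩ := hF.errors_le H hβo hTm (mul_nonneg hR hB0)
    ((hF.form_le_init H hTm).trans hRB)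
  have h3 : ‖β T‖ ≤ (1 + R) * B := by
    have := norm_add_le (β T - βo) βo
    rw [sub_add_cancel] at this
    linarith
  have h4 : ‖γ T‖ ≤ (1 + R) * B := by
    have := norm_add_le (γ T - D₁ βo) (D₁ βo)
    rw [sub_add_cancel] at this
    linarith
  have h5 := hk.abs_le hη.le H hβT (γ T)
  have h6 := hk.irr (ρ T) (hF.abs_ρ_le T hF.T_nonneg)
  have h7 : kE (κ⁻¹ • β T) + kF (ρ T + κ⁻¹ • γ T) = kF (ρ T) + κ⁻¹ * (kE (β T) + kF (γ T)) := by
    simp only [map_add, map_smul, smul_eq_mul]; ring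
  have hlam := H.lamD_pos
  have hX := H.LamX_pos
  have hL := H.iL_nonneg
  have h8 : κ⁻¹ * |kE (β T) + kF (γ T)| ≤ η / 2 := by
    rw [inv_mul_le_iff₀ hκ0]
    calc |kE (β T) + kF (γ T)|
        ≤ (1 + R) * B + 2 * ((1 + LamX * iL) / lamD) * ((1 + R) * B) := by
          refine h5.trans ?_
          gcongr
      _ ≤ 2 * (1 + 1 / lamD + LamX * iL / lamD) * ((1 + R) * B) := by
          rw [add_div]
          nlinarith [mul_nonneg (add_nonneg zero_le_one hR) hB0]
      _ = η / 2 * (4 / η * (1 + 1 / lamD + LamX * iL / lamD) * (1 + R) * B) := by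
          field_simp; ring
      _ ≤ η / 2 * κ := by gcongr
      _ = κ * (η / 2) := mul_comm _ _
  rw [heq, h7]
  have hT0 := hF.T_nonneg
  calc _ ≤ |kF (ρ T)| + |κ⁻¹ * (kE (β T) + kF (γ T))| + |T * (ν⁻¹ * φ (D₂ βo))| :=
        abs_add_three _ _ _
    _ ≤ (1 - η) + η / 2 + η / 4 := by
        rw [abs_mul κ⁻¹, abs_of_pos (inv_pos.2 hκ0), abs_mul T, abs_of_nonneg hT0, abs_mul ν⁻¹,
          abs_of_pos (inv_pos.2 H.ν_pos)]
        linarith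
    _ = _ := by ring

end IrrRow

end FlowBounds

/-! ### Confinement of the full path to the support, and deterministic consistency. -/

section FullFlow

variable {ι₁ ι₂ E N : Type*} [Fintype ι₁] [Fintype ι₂]
  [NormedAddCommGroup E] [InnerProductSpace ℝ E] [FiniteDimensional ℝ E]
  [NormedAddCommGroup N] [InnerProductSpace ℝ N] [FiniteDimensional ℝ N]
  {A : E →L[ℝ] N} {D₁ : E →L[ℝ] EuclideanSpace ℝ ι₁} {D₂ : E →L[ℝ] EuclideanSpace ℝ ι₂}
  {ν κ lamD LamD LamX lamH iL T τ η : ℝ} {βs δ : E} {e : N}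
  {ρ₁ γ₁ ρ₁' γ₁' : ℝ → EuclideanSpace ℝ ι₁} {ρ₂ γ₂ ρ₂' γ₂' : ℝ → EuclideanSpace ℝ ι₂}
  {β β' : ℝ → E}

/-- The Split LBISS dynamics for the response `A βs + e`, with the coordinates on and off the
support separated. -/
structure FullFlow (A : E →L[ℝ] N) (D₁ : E →L[ℝ] EuclideanSpace ℝ ι₁)
    (D₂ : E →L[ℝ] EuclideanSpace ℝ ι₂) (ν κ : ℝ) (βs : E) (e : N)
    (ρ₁ γ₁ ρ₁' γ₁' : ℝ → EuclideanSpace ℝ ι₁) (ρ₂ γ₂ ρ₂' γ₂' : ℝ → EuclideanSpace ℝ ι₂)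
    (β β' : ℝ → E) : Prop where
  κ_pos : 0 < κ
  ρ₁_zero : ρ₁ 0 = 0
  ρ₂_zero : ρ₂ 0 = 0
  γ₁_zero : γ₁ 0 = 0
  γ₂_zero : γ₂ 0 = 0
  β_zero : β 0 = 0
  cont_ρ₁ : ContinuousOn ρ₁ (Ici 0)
  cont_ρ₂ : ContinuousOn ρ₂ (Ici 0)
  cont_γ₁ : ContinuousOn γ₁ (Ici 0)
  cont_γ₂ : ContinuousOn γ₂ (Ici 0)
  cont_β : ContinuousOn β (Ici 0)
  deriv_ρ₁ : ∀ t, 0 ≤ t → HasDerivWithinAt ρ₁ (ρ₁' t) (Ici t) t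
  deriv_ρ₂ : ∀ t, 0 ≤ t → HasDerivWithinAt ρ₂ (ρ₂' t) (Ici t) t
  deriv_γ₁ : ∀ t, 0 ≤ t → HasDerivWithinAt γ₁ (γ₁' t) (Ici t) t
  deriv_γ₂ : ∀ t, 0 ≤ t → HasDerivWithinAt γ₂ (γ₂' t) (Ici t) t
  deriv_β : ∀ t, 0 ≤ t → HasDerivWithinAt β (β' t) (Ici t) t
  flow_β : ∀ t, 0 ≤ t → ∀ x, κ⁻¹ * ⟪β' t, x⟫ = -(⟪A (β t - βs) - e, A x⟫ +
    ν⁻¹ * (⟪D₁ (β t) - γ₁ t, D₁ x⟫ + ⟪D₂ (β t) - γ₂ t, D₂ x⟫))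
  flow_γ₁ : ∀ t, 0 ≤ t → ρ₁' t + κ⁻¹ • γ₁' t = ν⁻¹ • (D₁ (β t) - γ₁ t)
  flow_γ₂ : ∀ t, 0 ≤ t → ρ₂' t + κ⁻¹ • γ₂' t = ν⁻¹ • (D₂ (β t) - γ₂ t)
  abs_ρ₁_le : ∀ t, 0 ≤ t → ∀ j, |ρ₁ t j| ≤ 1
  ρ₁_mul_γ₁ : ∀ t, 0 ≤ t → ∀ j, ρ₁ t j * γ₁ t j = |γ₁ t j|
  ρ₂_mul_γ₂ : ∀ t, 0 ≤ t → ∀ j, ρ₂ t j * γ₂ t j = |γ₂ t j|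

namespace FullFlow

variable (hG : FullFlow A D₁ D₂ ν κ βs e ρ₁ γ₁ ρ₁' γ₁' ρ₂ γ₂ ρ₂' γ₂' β β')
include hG

theorem toSplitFlow (hβs : D₂ βs = 0)
    (hδ : NormalEq A D₂ ν δ (LinearMap.adjoint A.toLinearMap e)) (hT : 0 ≤ T)
    (h0 : ∀ t ∈ Ico 0 T, γ₂ t = 0) :
    SplitFlow A D₁ D₂ ν κ T (βs + δ) ρ₁ γ₁ ρ₁' γ₁' β β' where
  κ_pos := hG.κ_pos
  T_nonneg := hT
  ρ_zero := hG.ρ₁_zero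
  γ_zero := hG.γ₁_zero
  β_zero := hG.β_zero
  cont_ρ := hG.cont_ρ₁.mono Icc_subset_Ici_self
  cont_γ := hG.cont_γ₁.mono Icc_subset_Ici_self
  cont_β := hG.cont_β.mono Icc_subset_Ici_self
  deriv_ρ t ht := hG.deriv_ρ₁ t ht.1
  deriv_γ t ht := hG.deriv_γ₁ t ht.1
  deriv_β t ht := hG.deriv_β t ht.1
  flow_β t ht x := by
    have h1 := hδ x
    rw [LinearMap.adjoint_inner_left] at h1
    change _ = ⟪e, A x⟫ at h1
    rw [hG.flow_β t ht.1 x, h0 t ht, sub_zero, inner_sub_left (A (β t - βs)), ← h1]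
    simp only [map_sub, map_add, hβs, inner_sub_left, inner_add_left, inner_zero_left]
    ring
  flow_γ t ht := hG.flow_γ₁ t ht.1
  abs_ρ_le := hG.abs_ρ₁_le
  ρ_mul_γ := hG.ρ₁_mul_γ₁

/-- A nonzero coordinate of `γ₂` puts the dual coordinate at ±1 with the same sign, so the sum would
exceed 1 in modulus. -/
theorem eq_zero_of_abs_lt {t : ℝ} (ht : 0 ≤ t) {j : ι₂} (h : |ρ₂ t j + κ⁻¹ * γ₂ t j| < 1) :
    γ₂ t j = 0 := by
  by_contra h0
  have hκ := inv_pos.2 hG.κ_pos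
  have h1 := hG.ρ₂_mul_γ₂ t ht j
  have h2 := abs_lt.1 h
  rcases lt_or_gt_of_ne h0 with hn | hp
  · rw [abs_of_neg hn] at h1
    have : ρ₂ t j = -1 := mul_right_cancel₀ hn.ne (by linarith)
    nlinarith
  · rw [abs_of_pos hp] at h1
    have : ρ₂ t j = 1 := mul_right_cancel₀ hp.ne' (by linarith)
    nlinarith

/-- If the dual variable off the support cannot reach the boundary of the unit interval as long as
the flow stays on the support, then the flow stays on the support. -/
theorem offSupport_eq_zero {c : ℝ} (hc : c < 1)
    (h : ∀ T ∈ Icc 0 τ, (∀ t ∈ Icc 0 T, γ₂ t = 0) → ∀ j, |ρ₂ T j + κ⁻¹ * γ₂ T j| ≤ c) :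
    ∀ t ∈ Icc 0 τ, γ₂ t = 0 := by
  by_contra! hbad
  obtain ⟨t₁, ht₁, hne⟩ := hbad
  set Bad : Set ℝ := {t | t ∈ Icc 0 τ ∧ γ₂ t ≠ 0} with hBad
  have hbdd : BddBelow Bad := ⟨0, fun t ht => ht.1.1⟩
  have hne' : Bad.Nonempty := ⟨t₁, ht₁, hne⟩
  set t₀ := sInf Bad with ht₀
  have h0 : 0 ≤ t₀ := le_csInf hne' fun t ht => ht.1.1
  have hτ : t₀ ≤ τ := (csInf_le hbdd ⟨ht₁, hne⟩).trans ht₁.2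
  have hbefore : ∀ t ∈ Ico 0 t₀, γ₂ t = 0 := by
    intro t ht
    by_contra hcon
    exact absurd (csInf_le hbdd (show t ∈ Bad from ⟨⟨ht.1, ht.2.le.trans hτ⟩, hcon⟩))
      (not_le.2 ht.2)
  have hupto : ∀ t ∈ Icc 0 t₀, γ₂ t = 0 := by
    rcases h0.eq_or_lt with h | h
    · intro t ht
      rw [← h, Icc_self] at ht
      rw [ht, hG.γ₂_zero]
    · have hcl : IsClosed (Icc 0 t₀ ∩ γ₂ ⁻¹' {0}) :=
        (hG.cont_γ₂.mono Icc_subset_Ici_self).preimage_isClosed_of_isClosed isClosed_Icc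
          isClosed_singleton
      have hsub : Ico 0 t₀ ⊆ Icc 0 t₀ ∩ γ₂ ⁻¹' {0} := fun t ht =>
        ⟨Ico_subset_Icc_self ht, hbefore t ht⟩
      have := closure_minimal hsub hcl
      rw [closure_Ico h.ne] at this
      exact fun t ht => (this ht).2
  -- At the infimum of the exit times the bound `c` is still valid and strictly below 1; continuity
  -- extends it past that time, where some exit must occur.
  have hlt : ∀ᶠ t in 𝓝[Ici 0] t₀, ∀ j, |ρ₂ t j + κ⁻¹ * γ₂ t j| < 1 := by
    rw [eventually_all]
    intro j
    have hcont : ContinuousWithinAt (fun t => |ρ₂ t j + κ⁻¹ * γ₂ t j|) (Ici 0) t₀ := by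
      have c1 : ContinuousWithinAt (fun t => ρ₂ t j) (Ici 0) t₀ :=
        (EuclideanSpace.proj (𝕜 := ℝ) j).continuous.continuousAt.comp_continuousWithinAt
          (hG.cont_ρ₂ t₀ h0)
      have c2 : ContinuousWithinAt (fun t => γ₂ t j) (Ici 0) t₀ :=
        (EuclideanSpace.proj (𝕜 := ℝ) j).continuous.continuousAt.comp_continuousWithinAt
          (hG.cont_γ₂ t₀ h0)
      exact (c1.add (c2.const_smul κ⁻¹)).abs
    exact hcont.eventually (gt_mem_nhds ((h t₀ ⟨h0, hτ⟩ hupto j).trans_lt hc))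
  obtain ⟨u, hu, hsub⟩ := Metric.mem_nhdsWithin_iff.1 hlt
  obtain ⟨t, htB, htlt⟩ := exists_lt_of_csInf_lt hne' (show sInf Bad < t₀ + u by linarith)
  have ht1 : t₀ ≤ t := csInf_le hbdd htB
  have ht2 := hsub ⟨by rw [Metric.mem_ball, Real.dist_eq, abs_lt]; constructor <;> linarith,
    htB.1.1⟩
  refine htB.2 ?_
  ext j
  exact hG.eq_zero_of_abs_lt htB.1.1 (ht2 j)

end FullFlow

/-- The event on which the estimates hold, in terms of the oracle error `δ`; `ℓ` stands for
`√(log m / n)` and `rl` for `√(r' log m / n)`. -/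
structure NoiseEvent (A : E →L[ℝ] N) (D₁ : E →L[ℝ] EuclideanSpace ℝ ι₁)
    (D₂ : E →L[ℝ] EuclideanSpace ℝ ι₂) (ν lamD LamX lamH σ ℓ rl : ℝ) (e : N) (δ : E) : Prop where
  mem : δ ∈ (commonKer A D₁ D₂)ᗮ
  normalEq : NormalEq A D₂ ν δ (LinearMap.adjoint A.toLinearMap e)
  off_le : ∀ j, ν⁻¹ * |D₂ δ j| ≤ 2 * σ * (LamX / lamD) * ℓ
  on_le : ∀ j, lamH * |D₁ δ j| ≤ 2 * σ * (LamX / lamD) * ℓ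
  norm_le : ‖e‖ ≤ 2 * σ
  ker_le : ∀ f, D₁ f = 0 → D₂ f = 0 → ⟪e, A f⟫ ≤ 2 * σ * rl * ‖A f‖

namespace NoiseEvent

variable {σ ℓ rl : ℝ}

theorem sqrt_norm_le (H : SplitBounds A D₁ D₂ ν lamD LamD LamX lamH iL)
    (hN : NoiseEvent A D₁ D₂ ν lamD LamX lamH σ ℓ rl e δ) :
    √(‖D₁ δ‖ ^ 2 + ‖D₂ δ‖ ^ 2) ≤ 2 * σ / lamH * (LamX / lamD) := by
  have h1 := H.norm_D_normalEq_le hN.normalEq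
  have hH := H.lamH_pos
  have hX := div_pos H.LamX_pos H.lamD_pos
  rw [div_mul_eq_mul_div, le_div_iff₀ hH]
  nlinarith [mul_le_mul_of_nonneg_left hN.norm_le hX.le]

theorem norm_on_le (H : SplitBounds A D₁ D₂ ν lamD LamD LamX lamH iL)
    (hN : NoiseEvent A D₁ D₂ ν lamD LamX lamH σ ℓ rl e δ) (hσ : 0 < σ) (hℓ : 0 < ℓ) :
    ‖D₁ δ‖ ≤ 2 * σ / lamH * (LamX / lamD) * (√(Fintype.card ι₁) * ℓ) := by
  have hH := H.lamH_pos
  have hX := div_pos H.LamX_pos H.lamD_pos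
  refine le_of_sq_le_sq ?_ (by positivity)
  rw [EuclideanSpace.norm_sq_eq, mul_pow, mul_pow _ ℓ, Real.sq_sqrt (by positivity)]
  calc ∑ j, ‖D₁ δ j‖ ^ 2 ≤ ∑ _j : ι₁, (2 * σ / lamH * (LamX / lamD) * ℓ) ^ 2 := by
        refine Finset.sum_le_sum fun j _ => pow_le_pow_left₀ (norm_nonneg _) ?_ 2
        have := hN.on_le j
        rw [← le_div_iff₀' hH] at this
        rw [Real.norm_eq_abs]
        refine this.trans_eq ?_
        ring
    _ = _ := by rw [Finset.sum_const, Finset.card_univ, nsmul_eq_mul]; ring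

theorem norm_off_le (H : SplitBounds A D₁ D₂ ν lamD LamD LamX lamH iL)
    (hN : NoiseEvent A D₁ D₂ ν lamD LamX lamH σ ℓ rl e δ) :
    ‖D₂ δ‖ ≤ ν * (2 * σ) * (LamX / lamD) := by
  have h1 := H.norm_D₂_normalEq_le hN.normalEq
  have hX := div_pos H.LamX_pos H.lamD_pos
  rw [inv_mul_le_iff₀ H.ν_pos] at h1
  refine h1.trans ?_
  have := mul_le_mul_of_nonneg_left hN.norm_le (mul_pos H.ν_pos hX).le
  nlinarith

/-- The on-support transform uses the coordinatewise noise bound, whence √s. The off-support one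
uses the full noise norm and produces the term proportional to ν. -/
theorem norm_le_log (H : SplitBounds A D₁ D₂ ν lamD LamD LamX lamH iL)
    (hN : NoiseEvent A D₁ D₂ ν lamD LamX lamH σ ℓ rl e δ) (hσ : 0 < σ) (hℓ : 0 < ℓ)
    (hrl : 0 ≤ rl) :
    ‖δ‖ ≤ 2 * σ / lamH * ((LamX + LamX ^ 2 * iL) / lamD ^ 2) * (√(Fintype.card ι₁) * ℓ) +
      2 * σ * iL * rl + ν * (2 * σ) * ((LamX + LamX ^ 2 * iL) / lamD ^ 2) := by
  have hX := H.LamX_pos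
  have hL := H.iL_nonneg
  have hlam := H.lamD_pos
  have h1 := H.norm_normalEq_le hN.mem hN.normalEq hN.ker_le (by positivity)
  have h2 : √(‖D₁ δ‖ ^ 2 + ‖D₂ δ‖ ^ 2) ≤ ‖D₁ δ‖ + ‖D₂ δ‖ := by
    rw [Real.sqrt_le_left (by positivity)]
    nlinarith [norm_nonneg (D₁ δ), norm_nonneg (D₂ δ)]
  have h3 := h2.trans (add_le_add (hN.norm_on_le H hσ hℓ) (hN.norm_off_le H))
  calc ‖δ‖ ≤ (1 + LamX * iL) * ((2 * σ / lamH * (LamX / lamD) * (√(Fintype.card ι₁) * ℓ) +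
        ν * (2 * σ) * (LamX / lamD)) / lamD) + iL * (2 * σ * rl) := by
        refine h1.trans ?_
        gcongr
    _ = _ := by field_simp; ring

/-- This cruder bound uses only the noise norm. It controls the size of the oracle in the condition
on κ. -/
theorem norm_le_const (H : SplitBounds A D₁ D₂ ν lamD LamD LamX lamH iL)
    (hN : NoiseEvent A D₁ D₂ ν lamD LamX lamH σ ℓ rl e δ) (hσ : 0 < σ) :
    ‖δ‖ ≤ 2 * σ / lamH * (LamX / lamD ^ 2 + (lamH * lamD ^ 2 + LamX ^ 2) * iL / lamD ^ 2) := by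
  have hX := H.LamX_pos
  have hL := H.iL_nonneg
  have hlam := H.lamD_pos
  have hH := H.lamH_pos
  have h1 := H.norm_normalEq_le (B := 2 * σ) hN.mem hN.normalEq (fun f _ _ =>
    (real_inner_le_norm _ _).trans (mul_le_mul_of_nonneg_right hN.norm_le (norm_nonneg _)))
    (by positivity)
  calc ‖δ‖ ≤ (1 + LamX * iL) * (2 * σ / lamH * (LamX / lamD) / lamD) + iL * (2 * σ) := by
        refine h1.trans ?_
        have := hN.sqrt_norm_le H
        gcongr
    _ = _ := by field_simp; ring

end NoiseEvent

set_option maxHeartbeats 1000000 in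
/-- The deterministic part of the consistency theorem. -/
theorem FullFlow.consistency {σ ℓ rl : ℝ} [Nonempty ι₁]
    (hG : FullFlow A D₁ D₂ ν κ βs e ρ₁ γ₁ ρ₁' γ₁' ρ₂ γ₂ ρ₂' γ₂' β β')
    (H : SplitBounds A D₁ D₂ ν lamD LamD LamX lamH iL)
    (hN : NoiseEvent A D₁ D₂ ν lamD LamX lamH σ ℓ rl e δ)
    (hβs : βs ∈ (commonKer A D₁ D₂)ᗮ) (hβs0 : D₂ βs = 0)
    (hσ : 0 < σ) (hℓ : 0 < ℓ) (hrl : 0 ≤ rl) (hη : 0 < η) (hη1 : η ≤ 1)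
    (hirr : ∀ j, ∃ kE kF, IrrRow A D₁ D₂ ν η (EuclideanSpace.proj j) kE kF)
    (hκ : kappaLower iL lamD LamD LamX lamH η σ ν ‖βs‖ ≤ κ)
    (hτ : τ = η / (8 * σ) * (lamD / LamX) * ℓ⁻¹) :
    (∀ t ∈ Icc 0 τ, γ₂ t = 0) ∧
    (∀ M : ℝ, 0 ≤ M →
      (∀ j, 16 * σ / (η * lamH) * (LamX * LamD / lamD ^ 2) *
        (2 * Real.log (Fintype.card ι₁) + 5 + M) * ℓ ≤ |D₁ βs j|) →
      ∀ j, SignType.sign (γ₁ τ j) = SignType.sign (D₁ βs j)) ∧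
    ‖γ₁ τ - D₁ βs‖ ≤ 42 * σ / (η * lamH) * (LamX / lamD) * (√(Fintype.card ι₁) * ℓ) ∧
    ‖β τ - βs‖ ≤ 42 * σ / (η * lamH) * ((LamX * (1 + lamD) + LamX ^ 2 * iL) / lamD ^ 2) *
        (√(Fintype.card ι₁) * ℓ) + 2 * σ * iL * rl +
      ν * (2 * σ) * ((LamX + LamX ^ 2 * iL) / lamD ^ 2) := by
  have hX := H.LamX_pos
  have hL := H.iL_nonneg
  have hlam := H.lamD_pos
  have hLam := H.LamD_pos
  have hH := H.lamH_pos
  have hν := H.ν_pos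
  have hκ0 := hG.κ_pos
  have hτ0 : 0 < τ := by rw [hτ]; positivity
  have hc : (1 : ℝ) ≤ Fintype.card ι₁ := by exact_mod_cast Fintype.card_pos
  have hβo : βs + δ ∈ (commonKer A D₁ D₂)ᗮ := Submodule.add_mem _ hβs hN.mem
  have hD2o : D₂ (βs + δ) = D₂ δ := by rw [map_add, hβs0, zero_add]
  -- size of the oracle estimator
  set B := (1 + LamD) * ‖βs‖ + 2 * σ / lamH *
    (LamX / lamD + LamX / lamD ^ 2 + (lamH * lamD ^ 2 + LamX ^ 2) * iL / lamD ^ 2) with hB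
  set R := √(2 * (1 + ν * LamX ^ 2 + LamD ^ 2) / (lamH * ν)) with hR
  have hR0 : 0 ≤ R := Real.sqrt_nonneg _
  have hq0 : 0 ≤ 2 * σ / lamH * (LamX / lamD) := by positivity
  have hq1 : 0 ≤ 2 * σ / lamH *
    (LamX / lamD ^ 2 + (lamH * lamD ^ 2 + LamX ^ 2) * iL / lamD ^ 2) := by positivity
  have hB1 : ‖βs + δ‖ ≤ B := by
    have := norm_add_le βs δ
    have := hN.norm_le_const H hσ
    have := mul_nonneg hLam.le (norm_nonneg βs)
    rw [hB]; linarith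
  have hB2 : ‖D₁ (βs + δ)‖ ≤ B := by
    have h1 : ‖D₁ βs‖ ≤ LamD * ‖βs‖ := by
      refine le_of_sq_le_sq ?_ (by positivity)
      rw [mul_pow]
      nlinarith [H.norm_D βs, sq_nonneg ‖D₂ βs‖]
    have h2 : ‖D₁ δ‖ ≤ 2 * σ / lamH * (LamX / lamD) := by
      refine (Real.le_sqrt_of_sq_le ?_).trans (hN.sqrt_norm_le H)
      nlinarith [sq_nonneg ‖D₂ δ‖]
    have h3 := norm_add_le (D₁ βs) (D₁ δ)
    rw [← map_add] at h3
    have := norm_nonneg βs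
    rw [hB]; linarith
  have hB0 : 0 ≤ B := (norm_nonneg _).trans hB1
  have hRB : splitForm A D₁ D₂ ν (βs + δ) (D₁ (βs + δ)) ≤ lamH * (R * B) ^ 2 := by
    have hR2 : R ^ 2 = 2 * (1 + ν * LamX ^ 2 + LamD ^ 2) / (lamH * ν) :=
      Real.sq_sqrt (by positivity)
    have h1 : ‖A (βs + δ)‖ ^ 2 ≤ LamX ^ 2 * B ^ 2 := by
      rw [← mul_pow]
      exact pow_le_pow_left₀ (norm_nonneg _) ((H.norm_A _).trans (by gcongr)) 2
    have h2 : ‖D₂ (βs + δ)‖ ^ 2 ≤ LamD ^ 2 * B ^ 2 := by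
      have := H.norm_D (βs + δ)
      have h3 : LamD ^ 2 * ‖βs + δ‖ ^ 2 ≤ LamD ^ 2 * B ^ 2 := by gcongr
      nlinarith [sq_nonneg ‖D₁ (βs + δ)‖]
    have h3 : lamH * (R * B) ^ 2 = 2 * (LamX ^ 2 * B ^ 2) + 2 * (ν⁻¹ * (LamD ^ 2 * B ^ 2)) +
        2 * ν⁻¹ * B ^ 2 := by
      rw [mul_pow, hR2]; field_simp; ring
    have h4 := mul_le_mul_of_nonneg_left h2 (inv_pos.2 hν).le
    have h5 : 0 ≤ 2 * ν⁻¹ * B ^ 2 := by positivity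
    have h6 : 0 ≤ ν⁻¹ * (LamD ^ 2 * B ^ 2) := by positivity
    have h7 : 0 ≤ LamX ^ 2 * B ^ 2 := by positivity
    rw [h3, splitForm, sub_self, norm_zero]
    linarith
  have hκ' : 4 / η * (1 + 1 / lamD + LamX * iL / lamD) * (1 + R) * B ≤ κ := hκ
  have hκ4 : splitForm A D₁ D₂ ν (βs + δ) (D₁ (βs + δ)) ≤ lamH * (κ / 4) ^ 2 := by
    refine hRB.trans ?_
    have h1 : 4 * (R * B) ≤ 4 / η * (1 + 1 / lamD + LamX * iL / lamD) * (1 + R) * B := by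
      have e1 : (4 : ℝ) ≤ 4 / η := by rw [le_div_iff₀ hη]; linarith
      have e2 : 1 ≤ 1 + 1 / lamD + LamX * iL / lamD := by
        have : 0 ≤ 1 / lamD + LamX * iL / lamD := by positivity
        linarith
      calc 4 * (R * B) = 4 * 1 * R * B := by ring
        _ ≤ _ := by gcongr; linarith
    have h2 : R * B ≤ κ / 4 := by linarith
    gcongr
  -- no false positives
  have hnofp : ∀ t ∈ Icc 0 τ, γ₂ t = 0 := by
    refine hG.offSupport_eq_zero (c := 1 - η / 4) (by linarith) fun T hT h0 j => ?_
    obtain ⟨kE, kF, hk⟩ := hirr j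
    have hF := hG.toSplitFlow hβs0 hN.normalEq hT.1 fun t ht => h0 t (Ico_subset_Icc_self ht)
    refine hk.abs_dual_le hη H hF hβo (r := fun t => ρ₂ t j + κ⁻¹ * γ₂ t j) ?_ ?_ ?_ hR0 hB1 hB2
      hRB hκ' ?_
    · simp [hG.ρ₂_zero, hG.γ₂_zero]
    · have c1 := (EuclideanSpace.proj (𝕜 := ℝ) j).continuous.comp_continuousOn
        (hG.cont_ρ₂.mono (Icc_subset_Ici_self : Icc 0 T ⊆ Ici 0))
      have c2 := (EuclideanSpace.proj (𝕜 := ℝ) j).continuous.comp_continuousOn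
        (hG.cont_γ₂.mono (Icc_subset_Ici_self : Icc 0 T ⊆ Ici 0))
      exact c1.add (c2.const_smul κ⁻¹)
    · intro t ht
      have d1 := hasDerivWithinAt_coord (hG.deriv_ρ₂ t ht.1) j
      have d2 := hasDerivWithinAt_coord (hG.deriv_γ₂ t ht.1) j
      refine (d1.add (d2.const_mul κ⁻¹)).congr_deriv ?_
      have := congrArg (fun v => v j) (hG.flow_γ₂ t ht.1)
      rw [h0 t (Ico_subset_Icc_self ht), sub_zero] at this
      exact this
    · rw [hD2o]
      calc T * (ν⁻¹ * |D₂ δ j|) ≤ τ * (2 * σ * (LamX / lamD) * ℓ) :=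
            mul_le_mul hT.2 (hN.off_le j) (by positivity) hτ0.le
        _ = η / 4 := by rw [hτ]; field_simp; norm_num
  have hF := hG.toSplitFlow hβs0 hN.normalEq hτ0.le fun t ht => hnofp t (Ico_subset_Icc_self ht)
  obtain ⟨hβerr, hγerr⟩ := hF.errors_le_at_end H hβo hκ4 hτ0
  have herr : 17 / 4 * √(Fintype.card ι₁) / (lamH * τ) =
      34 * σ / (η * lamH) * (LamX / lamD) * (√(Fintype.card ι₁) * ℓ) := by
    rw [hτ]; field_simp; norm_num
  rw [herr] at hβerr hγerr
  have hηH : 2 * σ / lamH ≤ 2 * σ / (η * lamH) := by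
    apply div_le_div_of_nonneg_left (by positivity) (by positivity)
    nlinarith
  refine ⟨hnofp, fun M hM hmin j => ?_, ?_, ?_⟩
  · have hlog : 0 ≤ Real.log (Fintype.card ι₁) := Real.log_nonneg hc
    -- In this unit the true entries are at least 16q and the oracle error is at most q. The oracle
    -- entries are thus at least 15q, and 15/8 · (2 log s + 5) covers 3.6 log s + 9.
    set q := σ / (η * lamH) * (LamX / lamD) * (2 * Real.log (Fintype.card ι₁) + 5) * ℓ with hq
    have hqpos : 0 < q := by positivity
    -- The signal has a nonzero transform, so its short preimage is nonzero and sees both singular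
    -- value bounds.
    have hlamle : 1 ≤ LamD / lamD := by
      have hpos : 0 < |D₁ βs j| := lt_of_lt_of_le (by positivity) (hmin j)
      obtain ⟨x, h1, h2, h3⟩ := H.lift_D βs
      have h4 := H.norm_D x
      rw [h1, h2] at h4
      have hne : x ≠ 0 := by
        rintro rfl
        rw [map_zero] at h1
        rw [← h1] at hpos
        simp at hpos
      have hx : 0 < ‖x‖ ^ 2 := by positivity
      have := le_of_mul_le_mul_right (h3.trans h4) hx
      rw [one_le_div hlam]
      exact le_of_sq_le_sq this hLam.le
    have hmin' : ∀ j, 16 * q ≤ |D₁ βs j| := fun j => by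
      refine le_trans ?_ (hmin j)
      calc 16 * q = 16 * σ / (η * lamH) * (LamX / lamD * 1) *
            (2 * Real.log (Fintype.card ι₁) + 5 + 0) * ℓ := by rw [hq]; ring
        _ ≤ 16 * σ / (η * lamH) * (LamX / lamD * (LamD / lamD)) *
            (2 * Real.log (Fintype.card ι₁) + 5 + M) * ℓ := by gcongr
        _ = _ := by ring
    have hδle : ∀ j, |D₁ δ j| ≤ q := fun j => by
      have h1 := hN.on_le j
      rw [← le_div_iff₀' hH] at h1
      calc |D₁ δ j| ≤ 2 * σ / lamH * ((LamX / lamD) * ℓ) := h1.trans_eq (by ring)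
        _ ≤ 2 * σ / (η * lamH) * ((LamX / lamD) * ℓ) := by gcongr
        _ = σ / (η * lamH) * (LamX / lamD) * (2 : ℝ) * ℓ := by ring
        _ ≤ q := by rw [hq]; gcongr; linarith
    have hdiff : ∀ j, D₁ (βs + δ) j - D₁ βs j = D₁ δ j := fun j => by simp
    have hsign := hF.sign_at_end H hβo hκ4 (x := 15 * q) (by positivity) (fun j => by
      have h1 := abs_sub_abs_le_abs_sub (D₁ βs j) (D₁ (βs + δ) j)
      rw [abs_sub_comm, hdiff] at h1
      linarith [hδle j, hmin' j]) (by
      have : lamH * (15 * q) * τ = 15 / 8 * (2 * Real.log (Fintype.card ι₁) + 5) := by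
        rw [hq, hτ]; field_simp
      rw [this]
      linarith) j
    rw [hsign]
    refine sign_eq_of_abs_sub_lt ?_
    rw [hdiff]
    linarith [hδle j, hmin' j]
  · have h1 := norm_add_le (γ₁ τ - D₁ (βs + δ)) (D₁ δ)
    rw [show γ₁ τ - D₁ (βs + δ) + D₁ δ = γ₁ τ - D₁ βs by rw [map_add]; abel] at h1
    have h2 := hN.norm_on_le H hσ hℓ
    have h3 : 2 * σ / lamH * (LamX / lamD) * (√(Fintype.card ι₁) * ℓ) ≤
        2 * σ / (η * lamH) * (LamX / lamD) * (√(Fintype.card ι₁) * ℓ) := by gcongr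
    have h4 : 0 ≤ σ / (η * lamH) * (LamX / lamD) * (√(Fintype.card ι₁) * ℓ) := by positivity
    have h5 : ∀ a : ℝ, a * σ / (η * lamH) * (LamX / lamD) * (√(Fintype.card ι₁) * ℓ) =
        a * (σ / (η * lamH) * (LamX / lamD) * (√(Fintype.card ι₁) * ℓ)) := fun a => by ring
    rw [h5] at h3 hγerr ⊢
    linarith
  · have h1 := norm_add_le (β τ - (βs + δ)) δ
    rw [show β τ - (βs + δ) + δ = β τ - βs by abel] at h1
    have h2 := hN.norm_le_log H hσ hℓ hrl
    have h3 : 2 * σ / lamH * ((LamX + LamX ^ 2 * iL) / lamD ^ 2) * (√(Fintype.card ι₁) * ℓ) ≤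
        42 * σ / (η * lamH) * ((LamX + LamX ^ 2 * iL) / lamD ^ 2) * (√(Fintype.card ι₁) * ℓ) := by
      have : 2 * σ / (η * lamH) ≤ 42 * σ / (η * lamH) := by gcongr; norm_num
      exact mul_le_mul_of_nonneg_right (mul_le_mul_of_nonneg_right (hηH.trans this)
        (by positivity)) (by positivity)
    have h4 : 34 * σ / (η * lamH) * (LamX / lamD) * (√(Fintype.card ι₁) * ℓ) ≤
        42 * σ / (η * lamH) * (LamX / lamD) * (√(Fintype.card ι₁) * ℓ) := by gcongr; norm_num
    have h5 : 42 * σ / (η * lamH) * ((LamX * (1 + lamD) + LamX ^ 2 * iL) / lamD ^ 2) *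
        (√(Fintype.card ι₁) * ℓ) =
        42 * σ / (η * lamH) * (LamX / lamD) * (√(Fintype.card ι₁) * ℓ) +
        42 * σ / (η * lamH) * ((LamX + LamX ^ 2 * iL) / lamD ^ 2) * (√(Fintype.card ι₁) * ℓ) := by
      field_simp; ring
    rw [h5]
    linarith

end FullFlow

/-! ### Concentration of sub-Gaussian vectors -/

section Gaussian

theorem gaussianPDFReal_smul_exp_sq (x : ℝ) :
    gaussianPDFReal 0 1 x • Real.exp (3 / 8 * x ^ 2) =
      (√(2 * Real.pi))⁻¹ * Real.exp (-(1 / 8) * x ^ 2) := by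
  rw [gaussianPDFReal, smul_eq_mul, mul_assoc, ← Real.exp_add]
  congr 2
  · simp
  · push_cast; ring

theorem integrable_exp_sq_gaussianReal :
    Integrable (fun x : ℝ => Real.exp (3 / 8 * x ^ 2)) (gaussianReal 0 1) := by
  rw [gaussianReal_of_var_ne_zero _ one_ne_zero, integrable_withDensity_iff_integrable_smul'
    (measurable_gaussianPDF 0 1) (ae_of_all _ fun x => by simp [gaussianPDF])]
  simp only [toReal_gaussianPDF, gaussianPDFReal_smul_exp_sq]
  exact (integrable_exp_neg_mul_sq (by norm_num)).const_mul _

theorem integral_exp_sq_gaussianReal :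
    ∫ x : ℝ, Real.exp (3 / 8 * x ^ 2) ∂(gaussianReal 0 1) = 2 := by
  rw [integral_gaussianReal_eq_integral_smul one_ne_zero]
  simp only [gaussianPDFReal_smul_exp_sq]
  rw [integral_const_mul, integral_gaussian, ← Real.sqrt_inv, ← Real.sqrt_mul (by positivity)]
  rw [show (2 * Real.pi)⁻¹ * (Real.pi / (1 / 8)) = 2 ^ 2 by
    have := Real.pi_pos.ne'; field_simp; norm_num]
  exact Real.sqrt_sq (by norm_num)

theorem lintegral_pi_gaussian_exp_inner {k : ℕ} (x : Fin k → ℝ) :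
    ∫⁻ g : Fin k → ℝ, ENNReal.ofReal (Real.exp (∑ i, x i * g i))
      ∂(Measure.pi fun _ => gaussianReal 0 1) = ENNReal.ofReal (Real.exp (∑ i, x i ^ 2 / 2)) := by
  simp only [Real.exp_sum]
  rw [← ofReal_integral_eq_lintegral_ofReal
    (Integrable.fintype_prod fun i => integrable_exp_mul_gaussianReal (x i))
    (ae_of_all _ fun g => Finset.prod_nonneg fun i _ => (Real.exp_pos _).le),
    integral_fintype_prod_eq_prod (fun i y => Real.exp (x i * y))]
  congr 1
  refine Finset.prod_congr rfl fun i _ => ?_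
  have := congrFun (mgf_id_gaussianReal (μ := 0) (v := 1)) (x i)
  simpa [mgf] using this

theorem lintegral_pi_gaussian_exp_sq (k : ℕ) :
    ∫⁻ g : Fin k → ℝ, ENNReal.ofReal (Real.exp (∑ i, 3 / 8 * g i ^ 2))
      ∂(Measure.pi fun _ => gaussianReal 0 1) = ENNReal.ofReal (2 ^ k) := by
  simp only [Real.exp_sum]
  rw [← ofReal_integral_eq_lintegral_ofReal
    (Integrable.fintype_prod fun i => integrable_exp_sq_gaussianReal)
    (ae_of_all _ fun g => Finset.prod_nonneg fun i _ => (Real.exp_pos _).le),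
    integral_fintype_prod_eq_prod (fun _ y => Real.exp (3 / 8 * y ^ 2))]
  simp [integral_exp_sq_gaussianReal]

end Gaussian

section Subgaussian

variable {Ω : Type*} [MeasurableSpace Ω] {P : Measure Ω} [IsProbabilityMeasure P]
  {n : ℕ} {σ : ℝ} {ε : Fin n → Ω → ℝ}

/-- The noise vector. -/
noncomputable def noiseVec (ε : Fin n → Ω → ℝ) (ω : Ω) : EuclideanSpace ℝ (Fin n) :=
  WithLp.toLp 2 fun i => ε i ω

theorem inner_noiseVec (a : EuclideanSpace ℝ (Fin n)) (ω : Ω) :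
    ⟪a, noiseVec ε ω⟫ = ∑ i, a i * ε i ω := by
  simp [noiseVec, PiLp.inner_apply, mul_comm]

theorem measurable_inner_noiseVec (hεm : ∀ i, Measurable (ε i)) (a : EuclideanSpace ℝ (Fin n)) :
    Measurable fun ω => ⟪a, noiseVec ε ω⟫ := by
  simp only [inner_noiseVec]
  fun_prop

theorem hasSubgaussianMGF_inner (hεi : iIndepFun ε P)
    (hεs : ∀ i, HasSubgaussianMGF (ε i) (Real.toNNReal (σ ^ 2)) P)
    (a : EuclideanSpace ℝ (Fin n)) {K : ℝ} (hK : ‖a‖ ≤ K) :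
    HasSubgaussianMGF (fun ω => ⟪a, noiseVec ε ω⟫) (Real.toNNReal (σ ^ 2 * K ^ 2)) P := by
  have hind : iIndepFun (fun i ω => a i * ε i ω) P :=
    hεi.comp (fun i x => a i * x) (fun i => measurable_const_mul _)
  have hcoord : ∀ i, HasSubgaussianMGF (fun ω => a i * ε i ω)
      (Real.toNNReal (a i ^ 2 * σ ^ 2)) P := fun i => by
    rw [Real.toNNReal_mul (sq_nonneg _), Real.toNNReal_of_nonneg (sq_nonneg (a i))]
    exact (hεs i).const_mul (a i)
  have h := HasSubgaussianMGF.sum_of_iIndepFun hind (s := Finset.univ) fun i _ => hcoord i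
  simp only [inner_noiseVec]
  refine ⟨h.integrable_exp_mul, fun t => (h.mgf_le t).trans (Real.exp_le_exp.2 ?_)⟩
  have h1 : ((∑ i, Real.toNNReal (a i ^ 2 * σ ^ 2) : ℝ≥0) : ℝ) = σ ^ 2 * ‖a‖ ^ 2 := by
    rw [EuclideanSpace.norm_sq_eq, Finset.mul_sum, NNReal.coe_sum]
    refine Finset.sum_congr rfl fun i _ => ?_
    rw [Real.coe_toNNReal _ (by positivity), Real.norm_eq_abs, sq_abs, mul_comm]
  rw [h1, Real.coe_toNNReal _ (by positivity)]
  gcongr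

theorem measureReal_abs_inner_gt_le (hσ : 0 < σ) (hεi : iIndepFun ε P)
    (hεs : ∀ i, HasSubgaussianMGF (ε i) (Real.toNNReal (σ ^ 2)) P)
    (a : EuclideanSpace ℝ (Fin n)) {K L : ℝ} (hK0 : 0 < K) (hK : ‖a‖ ≤ K) (hL : 0 ≤ L) :
    P.real {ω | 2 * σ * K * √L < |⟪a, noiseVec ε ω⟫|} ≤ 2 * Real.exp (-(2 * L)) := by
  have hv : -(2 * σ * K * √L) ^ 2 / (2 * (Real.toNNReal (σ ^ 2 * K ^ 2) : ℝ)) = -(2 * L) := by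
    rw [Real.coe_toNNReal _ (by positivity), mul_pow, Real.sq_sqrt hL]
    field_simp
  have h1 := (hasSubgaussianMGF_inner hεi hεs a hK).measure_ge_le
    (ε := 2 * σ * K * √L) (by positivity)
  have h2 := (hasSubgaussianMGF_inner hεi hεs (-a) (K := K) (by rwa [norm_neg])).measure_ge_le
    (ε := 2 * σ * K * √L) (by positivity)
  rw [hv] at h1 h2
  calc P.real {ω | 2 * σ * K * √L < |⟪a, noiseVec ε ω⟫|}
      ≤ P.real ({ω | 2 * σ * K * √L ≤ ⟪a, noiseVec ε ω⟫} ∪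
          {ω | 2 * σ * K * √L ≤ ⟪-a, noiseVec ε ω⟫}) := by
        refine measureReal_mono fun ω hω => ?_
        rcases lt_abs.1 (show _ < |⟪a, noiseVec ε ω⟫| from hω) with h | h
        · exact Or.inl h.le
        · refine Or.inr ?_
          change _ ≤ ⟪-a, noiseVec ε ω⟫
          rw [inner_neg_left]
          exact h.le
    _ ≤ _ := (measureReal_union_le _ _).trans (by linarith)

/-- A sub-Gaussian vector projected to a space of dimension `k` has squared norm at most
`4 σ² k L` with high probability. -/
theorem measureReal_sum_sq_inner_ge_le (hσ : 0 < σ) (hεm : ∀ i, Measurable (ε i))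
    (hεi : iIndepFun ε P) (hεs : ∀ i, HasSubgaussianMGF (ε i) (Real.toNNReal (σ ^ 2)) P)
    {k : ℕ} {u : Fin k → EuclideanSpace ℝ (Fin n)} (hu : Orthonormal ℝ u) (L : ℝ) :
    P.real {ω | 4 * σ ^ 2 * (k * L) ≤ ∑ i, ⟪u i, noiseVec ε ω⟫ ^ 2} ≤
      (2 * Real.exp (-(3 / 2 * L))) ^ k := by
  -- Chosen so that σ²c²/2 = 3/8: the Gaussian average of exp(3g²/8) is exactly 2. The square is
  -- linearized by averaging exp(c⟪·, g⟫) over a standard Gaussian `g`; after the swap, `g` becomes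
  -- a fixed direction for the noise.
  set c : ℝ := √3 / (2 * σ) with hc
  have hc2 : c ^ 2 = 3 / (4 * σ ^ 2) := by
    rw [hc, div_pow, Real.sq_sqrt (by norm_num)]; ring
  set Q : Ω → ℝ := fun ω => ∑ i, ⟪u i, noiseVec ε ω⟫ ^ 2 with hQ
  have hQm : Measurable Q :=
    Finset.measurable_sum _ fun i _ => (measurable_inner_noiseVec hεm (u i)).pow_const 2
  have hlin : ∫⁻ ω, ENNReal.ofReal (Real.exp (3 / (8 * σ ^ 2) * Q ω)) ∂P ≤
      ENNReal.ofReal (2 ^ k) := by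
    calc ∫⁻ ω, ENNReal.ofReal (Real.exp (3 / (8 * σ ^ 2) * Q ω)) ∂P
        = ∫⁻ ω, ∫⁻ g : Fin k → ℝ,
            ENNReal.ofReal (Real.exp (∑ i, (c * ⟪u i, noiseVec ε ω⟫) * g i))
            ∂(Measure.pi fun _ => gaussianReal 0 1) ∂P := by
          refine lintegral_congr fun ω => ?_
          rw [lintegral_pi_gaussian_exp_inner]
          congr 2
          rw [hQ, Finset.mul_sum]
          refine Finset.sum_congr rfl fun i _ => ?_
          rw [mul_pow, hc2]
          field_simp
          ring
      _ = ∫⁻ g : Fin k → ℝ, ∫⁻ ω,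
            ENNReal.ofReal (Real.exp (∑ i, (c * ⟪u i, noiseVec ε ω⟫) * g i)) ∂P
            ∂(Measure.pi fun _ => gaussianReal 0 1) := by
          refine lintegral_lintegral_swap (Measurable.aemeasurable ?_)
          refine ENNReal.measurable_ofReal.comp (Real.measurable_exp.comp ?_)
          refine Finset.measurable_sum _ fun i _ => ?_
          exact (((measurable_inner_noiseVec hεm (u i)).comp measurable_fst).const_mul c).mul
            ((measurable_pi_apply i).comp measurable_snd)
      _ ≤ ∫⁻ g : Fin k → ℝ, ENNReal.ofReal (Real.exp (∑ i, 3 / 8 * g i ^ 2))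
            ∂(Measure.pi fun _ => gaussianReal 0 1) := by
          refine lintegral_mono fun g => ?_
          have hnorm : ‖∑ i, g i • u i‖ ^ 2 = ∑ i, g i ^ 2 := by
            rw [← real_inner_self_eq_norm_sq, hu.inner_sum]
            simp [sq]
          have hs := hasSubgaussianMGF_inner hεi hεs (∑ i, g i • u i) le_rfl
          have heq : ∀ ω, ∑ i, (c * ⟪u i, noiseVec ε ω⟫) * g i =
              c * ⟪∑ i, g i • u i, noiseVec ε ω⟫ := by
            intro ω
            rw [sum_inner, Finset.mul_sum]
            refine Finset.sum_congr rfl fun i _ => ?_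
            rw [inner_smul_left, RCLike.conj_to_real]
            ring
          simp only [heq]
          rw [← ofReal_integral_eq_lintegral_ofReal (hs.integrable_exp_mul c)
            (ae_of_all _ fun _ => (Real.exp_pos _).le)]
          refine ENNReal.ofReal_le_ofReal ((hs.mgf_le c).trans_eq ?_)
          rw [Real.coe_toNNReal _ (by positivity), hnorm, hc2, ← Finset.mul_sum]
          congr 1
          field_simp
          ring
      _ = _ := lintegral_pi_gaussian_exp_sq k
  have hmark := mul_meas_ge_le_lintegral (μ := P)
    (f := fun ω => ENNReal.ofReal (Real.exp (3 / (8 * σ ^ 2) * Q ω))) (by fun_prop)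
    (ENNReal.ofReal (Real.exp (3 / 2 * L) ^ k))
  have hsub : {ω | 4 * σ ^ 2 * (k * L) ≤ Q ω} ⊆ {ω | ENNReal.ofReal (Real.exp (3 / 2 * L) ^ k) ≤
      ENNReal.ofReal (Real.exp (3 / (8 * σ ^ 2) * Q ω))} := by
    intro ω hω
    refine ENNReal.ofReal_le_ofReal ?_
    rw [← Real.exp_nat_mul]
    refine Real.exp_le_exp.2 ?_
    have := mul_le_mul_of_nonneg_left (show 4 * σ ^ 2 * (k * L) ≤ Q ω from hω)
      (show 0 ≤ 3 / (8 * σ ^ 2) by positivity)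
    refine le_trans (le_of_eq ?_) this
    field_simp
    ring
  have hpos : 0 < Real.exp (3 / 2 * L) ^ k := by positivity
  have h3 : ENNReal.ofReal (Real.exp (3 / 2 * L) ^ k) * P {ω | 4 * σ ^ 2 * (k * L) ≤ Q ω} ≤
      ENNReal.ofReal (2 ^ k) :=
    (mul_le_mul_right (measure_mono hsub) _).trans (hmark.trans hlin)
  have h4 := ENNReal.toReal_mono ENNReal.ofReal_ne_top h3
  rw [ENNReal.toReal_mul, ENNReal.toReal_ofReal hpos.le, ENNReal.toReal_ofReal (by positivity)]
    at h4
  rw [mul_pow, Real.exp_neg, inv_pow, ← div_eq_mul_inv, le_div_iff₀ hpos, mul_comm]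
  exact h4

end Subgaussian

/-! ### The high-probability noise event. -/

section NoiseProbability

/-- Riesz representation turns the deterministic bounds on coordinates of the oracle error into
inner products of the noise with vectors of controlled length. -/
theorem exists_inner_eq_of_abs_le {N : Type*} [NormedAddCommGroup N] [InnerProductSpace ℝ N]
    [FiniteDimensional ℝ N] (f : N →ₗ[ℝ] ℝ) {K : ℝ} (hK : 0 ≤ K) (hf : ∀ e, |f e| ≤ K * ‖e‖) :
    ∃ a : N, ‖a‖ ≤ K ∧ ∀ e, f e = ⟪a, e⟫ := by
  have : CompleteSpace N := FiniteDimensional.complete ℝ N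
  set a := (InnerProductSpace.toDual ℝ N).symm (LinearMap.toContinuousLinearMap f) with ha
  have h : ∀ e, f e = ⟪a, e⟫ := fun e => by
    rw [ha, InnerProductSpace.toDual_symm_apply]; rfl
  refine ⟨a, ?_, h⟩
  have h1 := (le_abs_self _).trans (hf a)
  rw [h, real_inner_self_eq_norm_sq] at h1
  rcases (norm_nonneg a).eq_or_lt with h0 | h0
  · rwa [← h0]
  · rw [pow_two] at h1
    exact le_of_mul_le_mul_right h1 h0

variable {Ω : Type*} [MeasurableSpace Ω] {P : Measure Ω} [IsProbabilityMeasure P]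
  {n m : ℕ} {σ : ℝ} {ε : Fin n → Ω → ℝ}

theorem inner_le_of_sum_sq_le {U : Submodule ℝ (EuclideanSpace ℝ (Fin n))}
    {v w : EuclideanSpace ℝ (Fin n)} (hw : w ∈ U) {c : ℝ} (hc : 0 ≤ c)
    (h : ∑ i, ⟪(stdOrthonormalBasis ℝ U i : EuclideanSpace ℝ (Fin n)), v⟫ ^ 2 ≤ c ^ 2) :
    ⟪v, w⟫ ≤ c * ‖w‖ := by
  set b := stdOrthonormalBasis ℝ U
  have h1 : ⟪v, w⟫ = ∑ i, ⟪(b i : EuclideanSpace ℝ (Fin n)), v⟫ *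
      ⟪(b i : EuclideanSpace ℝ (Fin n)), w⟫ := by
    have h2 := congrArg Subtype.val (b.sum_repr' ⟨w, hw⟩)
    simp only [Submodule.coe_sum, Submodule.coe_smul, Submodule.coe_inner] at h2
    nth_rw 1 [← h2]
    rw [inner_sum]
    refine Finset.sum_congr rfl fun i _ => ?_
    rw [inner_smul_right, real_inner_comm v, mul_comm]
  have h2 : ∑ i, ⟪(b i : EuclideanSpace ℝ (Fin n)), w⟫ ^ 2 = ‖w‖ ^ 2 := by
    have := b.sum_sq_norm_inner_right ⟨w, hw⟩
    simpa using this
  refine le_of_sq_le_sq ?_ (by positivity)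
  rw [h1, mul_pow, ← h2]
  exact (Finset.sum_mul_sq_le_sq_mul_sq _ _ _).trans
    (mul_le_mul_of_nonneg_right h (Finset.sum_nonneg fun i _ => sq_nonneg _))

/-- For `k ≥ 1` the base of the power is at most 2/m ≤ 1, so the power is at most its base. For `k =
0` the strict inequality makes the event empty. -/
theorem measureReal_sum_sq_inner_gt_le_inv (hσ : 0 < σ) (hm : 2 ≤ m)
    (hεm : ∀ i, Measurable (ε i))
    (hεi : iIndepFun ε P) (hεs : ∀ i, HasSubgaussianMGF (ε i) (Real.toNNReal (σ ^ 2)) P)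
    {k : ℕ} {u : Fin k → EuclideanSpace ℝ (Fin n)} (hu : Orthonormal ℝ u) :
    P.real {ω | 4 * σ ^ 2 * (k * Real.log m) < ∑ i, ⟪u i, noiseVec ε ω⟫ ^ 2} ≤ 2 / m := by
  have hm0 : (2 : ℝ) ≤ m := by exact_mod_cast hm
  rcases Nat.eq_zero_or_pos k with rfl | hk
  · simpa using div_nonneg zero_le_two (zero_le_two.trans hm0)
  have hlog : 0 ≤ Real.log m := Real.log_nonneg (by linarith)
  have h1 : 2 * Real.exp (-(3 / 2 * Real.log m)) ≤ 2 / m := by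
    rw [div_eq_mul_inv]
    refine mul_le_mul_of_nonneg_left ?_ zero_le_two
    calc Real.exp (-(3 / 2 * Real.log m)) ≤ Real.exp (-Real.log m) :=
          Real.exp_le_exp.2 (by linarith)
      _ = (m : ℝ)⁻¹ := by rw [Real.exp_neg, Real.exp_log (by linarith)]
  have h2 : (2 : ℝ) / m ≤ 1 := by rw [div_le_one (by linarith)]; exact hm0
  calc _ ≤ P.real {ω | 4 * σ ^ 2 * (k * Real.log m) ≤ ∑ i, ⟪u i, noiseVec ε ω⟫ ^ 2} :=
        measureReal_mono (Set.ofPred_subset_ofPred.2 fun _ => le_of_lt)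
    _ ≤ (2 * Real.exp (-(3 / 2 * Real.log m))) ^ k :=
        measureReal_sum_sq_inner_ge_le hσ hεm hεi hεs hu _
    _ ≤ 2 * Real.exp (-(3 / 2 * Real.log m)) :=
        pow_le_of_le_one (by positivity) (h1.trans h2) hk.ne'
    _ ≤ _ := h1

theorem sum_sq_inner_basisFun (v : EuclideanSpace ℝ (Fin n)) :
    ∑ i, ⟪EuclideanSpace.basisFun (Fin n) ℝ i, v⟫ ^ 2 = ‖v‖ ^ 2 := by
  have := (EuclideanSpace.basisFun (Fin n) ℝ).sum_sq_norm_inner_right v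
  simpa only [Real.norm_eq_abs, sq_abs] using this

theorem measureReal_norm_noiseVec_gt_le (hσ : 0 < σ) (hεm : ∀ i, Measurable (ε i))
    (hεi : iIndepFun ε P) (hεs : ∀ i, HasSubgaussianMGF (ε i) (Real.toNNReal (σ ^ 2)) P) :
    P.real {ω | 4 * σ ^ 2 * n < ‖noiseVec ε ω‖ ^ 2} ≤ Real.exp (-(4 * (n : ℝ) / 5)) := by
  have h := measureReal_sum_sq_inner_ge_le hσ hεm hεi hεs
    (EuclideanSpace.basisFun (Fin n) ℝ).orthonormal 1
  simp only [sum_sq_inner_basisFun, mul_one] at h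
  have hsub : {ω | 4 * σ ^ 2 * n < ‖noiseVec ε ω‖ ^ 2} ⊆
      {ω | 4 * σ ^ 2 * n ≤ ‖noiseVec ε ω‖ ^ 2} := Set.ofPred_subset_ofPred.2 fun _ => le_of_lt
  refine (measureReal_mono hsub).trans (h.trans ?_)
  -- This is log 2 ≤ 7/10.
  have h1 : 2 * Real.exp (-(3 / 2)) ≤ Real.exp (-(4 / 5)) := by
    have h2 : (2 : ℝ) ≤ Real.exp (7 / 10) := by
      rw [← Real.log_le_iff_le_exp (by norm_num)]
      linarith [Real.log_two_lt_d9]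
    calc 2 * Real.exp (-(3 / 2)) ≤ Real.exp (7 / 10) * Real.exp (-(3 / 2)) := by gcongr
      _ = Real.exp (-(4 / 5)) := by rw [← Real.exp_add]; norm_num
  calc _ ≤ Real.exp (-(4 / 5)) ^ n := pow_le_pow_left₀ (by positivity) h1 n
    _ = _ := by rw [← Real.exp_nat_mul]; congr 1; ring

variable {ι₁ ι₂ E : Type*} [Fintype ι₁] [Fintype ι₂]
  [NormedAddCommGroup E] [InnerProductSpace ℝ E] [FiniteDimensional ℝ E]
  {A : E →L[ℝ] EuclideanSpace ℝ (Fin n)} {D₁ : E →L[ℝ] EuclideanSpace ℝ ι₁}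
  {D₂ : E →L[ℝ] EuclideanSpace ℝ ι₂} {ν lamD LamD LamX lamH iL : ℝ}

theorem exists_noiseEvent (H : SplitBounds A D₁ D₂ ν lamD LamD LamX lamH iL) (hn : 1 ≤ n)
    (hm : 2 ≤ m) (hcard : Fintype.card ι₁ + Fintype.card ι₂ = m) (hσ : 0 < σ)
    (hεm : ∀ i, Measurable (ε i)) (hεi : iIndepFun ε P)
    (hεs : ∀ i, HasSubgaussianMGF (ε i) (Real.toNNReal (σ ^ 2)) P) :
    ∃ (𝓔 : Set Ω) (δ : Ω → E), MeasurableSet 𝓔 ∧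
      1 - 6 / (m : ℝ) - 3 * Real.exp (-(4 * (n : ℝ) / 5)) ≤ P.real 𝓔 ∧
      ∀ ω ∈ 𝓔, NoiseEvent A D₁ D₂ ν lamD LamX lamH σ √(Real.log m / n)
        √(Module.finrank ℝ ((LinearMap.ker D₁.toLinearMap ⊓ LinearMap.ker D₂.toLinearMap).map
          A.toLinearMap) * Real.log m / n) ((√(n : ℝ))⁻¹ • noiseVec ε ω) (δ ω) := by
  have hH := H.lamH_pos
  have hν := H.ν_pos
  have hm0 : (2 : ℝ) ≤ m := by exact_mod_cast hm
  have hn0 : (0 : ℝ) < n := by exact_mod_cast hn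
  have hlog : 0 ≤ Real.log m := Real.log_nonneg (by linarith)
  set K := LamX / lamD with hKdef
  have hK : 0 < K := div_pos H.LamX_pos H.lamD_pos
  obtain ⟨R, hR⟩ := H.exists_normalEq_inverse
  set W : EuclideanSpace ℝ (Fin n) →ₗ[ℝ] E := R ∘ₗ LinearMap.adjoint A.toLinearMap with hW
  have hWL : ∀ e, W e ∈ (commonKer A D₁ D₂)ᗮ := fun e =>
    (hR _ (SplitBounds.adjoint_A_mem e)).1
  have hWn : ∀ e, NormalEq A D₂ ν (W e) (LinearMap.adjoint A.toLinearMap e) := fun e =>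
    (hR _ (SplitBounds.adjoint_A_mem (D₁ := D₁) (D₂ := D₂) e)).2
  have hoff : ∀ j, ∃ a : EuclideanSpace ℝ (Fin n), ‖a‖ ≤ K ∧ ∀ e, ν⁻¹ * D₂ (W e) j = ⟪a, e⟫ := by
    intro j
    refine exists_inner_eq_of_abs_le
      (ν⁻¹ • ((EuclideanSpace.proj (𝕜 := ℝ) j).toLinearMap ∘ₗ D₂.toLinearMap ∘ₗ W)) hK.le
      fun e => ?_
    refine le_trans ?_ (H.norm_D₂_normalEq_le (hWn e))
    change |ν⁻¹ * D₂ (W e) j| ≤ _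
    rw [abs_mul, abs_of_pos (inv_pos.2 hν)]
    exact mul_le_mul_of_nonneg_left (PiLp.norm_apply_le (D₂ (W e)) j) (inv_pos.2 hν).le
  have hon : ∀ j, ∃ a : EuclideanSpace ℝ (Fin n), ‖a‖ ≤ K ∧ ∀ e, lamH * D₁ (W e) j = ⟪a, e⟫ := by
    intro j
    refine exists_inner_eq_of_abs_le
      (lamH • ((EuclideanSpace.proj (𝕜 := ℝ) j).toLinearMap ∘ₗ D₁.toLinearMap ∘ₗ W)) hK.le
      fun e => ?_
    refine le_trans ?_ (H.norm_D_normalEq_le (hWn e))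
    change |lamH * D₁ (W e) j| ≤ _
    rw [abs_mul, abs_of_pos hH]
    refine mul_le_mul_of_nonneg_left ((PiLp.norm_apply_le (D₁ (W e)) j).trans ?_) hH.le
    refine Real.le_sqrt_of_sq_le ?_
    nlinarith [sq_nonneg ‖D₂ (W e)‖]
  choose a₂ ha₂ ha₂' using hoff
  choose a₁ ha₁ ha₁' using hon
  set U := (LinearMap.ker D₁.toLinearMap ⊓ LinearMap.ker D₂.toLinearMap).map A.toLinearMap with hU
  set u : Fin (Module.finrank ℝ U) → EuclideanSpace ℝ (Fin n) :=
    fun i => (stdOrthonormalBasis ℝ U i : EuclideanSpace ℝ (Fin n)) with hu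
  have huo : Orthonormal ℝ u :=
    (stdOrthonormalBasis ℝ U).orthonormal.comp_linearIsometry U.subtypeₗᵢ
  set B₁ : Set Ω := ⋃ j, {ω | 2 * σ * K * √(Real.log m) < |⟪a₁ j, noiseVec ε ω⟫|} with hB₁
  set B₂ : Set Ω := ⋃ j, {ω | 2 * σ * K * √(Real.log m) < |⟪a₂ j, noiseVec ε ω⟫|} with hB₂
  set B₃ : Set Ω := {ω | 4 * σ ^ 2 * n < ‖noiseVec ε ω‖ ^ 2} with hB₃
  set B₄ : Set Ω := {ω | 4 * σ ^ 2 * (Module.finrank ℝ U * Real.log m) <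
    ∑ i, ⟪u i, noiseVec ε ω⟫ ^ 2} with hB₄
  have hlin : ∀ a : EuclideanSpace ℝ (Fin n), Measurable fun ω => ⟪a, noiseVec ε ω⟫ :=
    measurable_inner_noiseVec hεm
  have hM₁ : MeasurableSet B₁ :=
    MeasurableSet.iUnion fun j => measurableSet_lt measurable_const (hlin _).abs
  have hM₂ : MeasurableSet B₂ :=
    MeasurableSet.iUnion fun j => measurableSet_lt measurable_const (hlin _).abs
  have hM₃ : MeasurableSet B₃ := by
    simp only [hB₃, ← sum_sq_inner_basisFun]
    exact measurableSet_lt measurable_const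
      (Finset.measurable_sum _ fun i _ => (hlin _).pow_const 2)
  have hM₄ : MeasurableSet B₄ := measurableSet_lt measurable_const
    (Finset.measurable_sum _ fun i _ => (hlin _).pow_const 2)
  have hexp : 2 * Real.exp (-(2 * Real.log m)) = 2 / (m : ℝ) ^ 2 := by
    rw [Real.exp_neg, show 2 * Real.log (m : ℝ) = ((2 : ℕ) : ℝ) * Real.log m by norm_num,
      Real.exp_nat_mul, Real.exp_log (by linarith), div_eq_mul_inv]
  have hP₁ : P.real B₁ ≤ Fintype.card ι₁ * (2 / (m : ℝ) ^ 2) := by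
    refine (measureReal_iUnion_fintype_le _).trans ?_
    refine (Finset.sum_le_sum fun j _ =>
      measureReal_abs_inner_gt_le hσ hεi hεs (a₁ j) hK (ha₁ j) hlog).trans_eq ?_
    rw [hexp, Finset.sum_const, Finset.card_univ, nsmul_eq_mul]
  have hP₂ : P.real B₂ ≤ Fintype.card ι₂ * (2 / (m : ℝ) ^ 2) := by
    refine (measureReal_iUnion_fintype_le _).trans ?_
    refine (Finset.sum_le_sum fun j _ =>
      measureReal_abs_inner_gt_le hσ hεi hεs (a₂ j) hK (ha₂ j) hlog).trans_eq ?_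
    rw [hexp, Finset.sum_const, Finset.card_univ, nsmul_eq_mul]
  have hP₃ := measureReal_norm_noiseVec_gt_le hσ hεm hεi hεs
  have hP₄ := measureReal_sum_sq_inner_gt_le_inv hσ hm hεm hεi hεs huo
  -- The `m` coordinates on and off the support cost 2/m² each, the projected noise 2/m, and the
  -- noise norm one exponential. The actual total is 4/m plus one exponential.
  have hbad : P.real ((B₁ ∪ B₂) ∪ (B₃ ∪ B₄)) ≤ 6 / m + 3 * Real.exp (-(4 * (n : ℝ) / 5)) := by
    have h1 := measureReal_union_le (μ := P) (B₁ ∪ B₂) (B₃ ∪ B₄)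
    have h2 := measureReal_union_le (μ := P) B₁ B₂
    have h3 := measureReal_union_le (μ := P) B₃ B₄
    have h4 : (Fintype.card ι₁ : ℝ) * (2 / (m : ℝ) ^ 2) + Fintype.card ι₂ * (2 / (m : ℝ) ^ 2) =
        2 / m := by
      rw [← add_mul, ← Nat.cast_add, hcard]; field_simp
    have h5 : (6 : ℝ) / m = 2 / m + 2 / m + 2 / m := by ring
    have h6 : (0 : ℝ) ≤ 2 / m := by positivity
    have h7 := Real.exp_pos (-(4 * (n : ℝ) / 5))
    linarith
  refine ⟨((B₁ ∪ B₂) ∪ (B₃ ∪ B₄))ᶜ, fun ω => W ((√(n : ℝ))⁻¹ • noiseVec ε ω),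
    ((hM₁.union hM₂).union (hM₃.union hM₄)).compl, ?_, fun ω hω => ?_⟩
  · rw [probReal_compl_eq_one_sub ((hM₁.union hM₂).union (hM₃.union hM₄))]
    linarith
  have hω' : ω ∉ B₁ ∧ ω ∉ B₂ ∧ ω ∉ B₃ ∧ ω ∉ B₄ := by
    simp only [Set.mem_compl_iff, Set.mem_union, not_or] at hω
    exact ⟨hω.1.1, hω.1.2, hω.2.1, hω.2.2⟩
  obtain ⟨h1, h2, h3, h4⟩ := hω'
  have hsn : 0 < √(n : ℝ) := Real.sqrt_pos.2 hn0
  have hcoord : ∀ a : EuclideanSpace ℝ (Fin n),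
      ¬ 2 * σ * K * √(Real.log m) < |⟪a, noiseVec ε ω⟫| →
      |⟪a, (√(n : ℝ))⁻¹ • noiseVec ε ω⟫| ≤ 2 * σ * K * √(Real.log m / n) := by
    intro a ha
    rw [inner_smul_right, abs_mul, abs_of_pos (inv_pos.2 hsn), inv_mul_le_iff₀ hsn,
      Real.sqrt_div' _ hn0.le]
    refine (not_lt.1 ha).trans_eq ?_
    field_simp
  refine ⟨hWL _, hWn _, fun j => ?_, fun j => ?_, ?_, fun f hf1 hf2 => ?_⟩
  · have := hcoord (a₂ j) fun h => h2 (Set.mem_iUnion.2 ⟨j, h⟩)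
    rwa [← ha₂', abs_mul, abs_of_pos (inv_pos.2 hν)] at this
  · have := hcoord (a₁ j) fun h => h1 (Set.mem_iUnion.2 ⟨j, h⟩)
    rwa [← ha₁', abs_mul, abs_of_pos hH] at this
  · rw [norm_smul, Real.norm_eq_abs, abs_of_pos (inv_pos.2 hsn), inv_mul_le_iff₀ hsn]
    refine le_of_sq_le_sq ((not_lt.1 h3).trans_eq ?_) (by positivity)
    rw [mul_pow, Real.sq_sqrt hn0.le]; ring
  · have hw : A f ∈ U := Submodule.mem_map_of_mem (f := A.toLinearMap) ⟨hf1, hf2⟩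
    have := inner_le_of_sum_sq_le (v := noiseVec ε ω) hw
      (c := 2 * σ * √(Module.finrank ℝ U * Real.log m)) (by positivity) ((not_lt.1 h4).trans_eq (by
        rw [mul_pow, Real.sq_sqrt (by positivity)]; ring))
    rw [inner_smul_left, RCLike.conj_to_real, inv_mul_le_iff₀ hsn, Real.sqrt_div' _ hn0.le]
    refine this.trans_eq ?_
    field_simp

end NoiseProbability

/-! ### From matrices to linear maps between Euclidean spaces -/

section Translation

variable {n p m : ℕ} {a b : Type*} [Fintype a] [Fintype b] [DecidableEq a] [DecidableEq b]

/-- A matrix as a continuous linear map between Euclidean spaces. -/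
noncomputable def matCLM (M : Matrix a b ℝ) : EuclideanSpace ℝ b →L[ℝ] EuclideanSpace ℝ a :=
  LinearMap.toContinuousLinearMap (Matrix.toEuclideanLin M)

theorem matCLM_toLp (M : Matrix a b ℝ) (v : b → ℝ) :
    matCLM M (WithLp.toLp 2 v) = WithLp.toLp 2 (M *ᵥ v) := rfl

theorem ofLp_matCLM (M : Matrix a b ℝ) (x : EuclideanSpace ℝ b) :
    (matCLM M x).ofLp = M *ᵥ x.ofLp := rfl

theorem inner_eq_dotProduct (x y : EuclideanSpace ℝ a) : ⟪x, y⟫ = x.ofLp ⬝ᵥ y.ofLp := by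
  rw [EuclideanSpace.inner_eq_star_dotProduct, star_trivial, dotProduct_comm]

theorem norm_sq_eq_dotProduct (x : EuclideanSpace ℝ a) : ‖x‖ ^ 2 = x.ofLp ⬝ᵥ x.ofLp := by
  rw [← real_inner_self_eq_norm_sq, inner_eq_dotProduct]

theorem transpose_mulVec_dotProduct (M : Matrix a b ℝ) (v : a → ℝ) (w : b → ℝ) :
    (Mᵀ *ᵥ v) ⬝ᵥ w = v ⬝ᵥ (M *ᵥ w) := by
  rw [Matrix.mulVec_transpose, Matrix.dotProduct_mulVec]

theorem adjoint_matCLM (M : Matrix a b ℝ) (x : EuclideanSpace ℝ a) :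
    LinearMap.adjoint (matCLM M).toLinearMap x = WithLp.toLp 2 (Mᵀ *ᵥ x.ofLp) := by
  refine ext_inner_right ℝ fun y => ?_
  rw [LinearMap.adjoint_inner_left, inner_eq_dotProduct, inner_eq_dotProduct]
  exact (transpose_mulVec_dotProduct M _ _).symm

/-- The normalized design. -/
noncomputable def designMap (X : Matrix (Fin n) (Fin p) ℝ) :
    EuclideanSpace ℝ (Fin p) →L[ℝ] EuclideanSpace ℝ (Fin n) :=
  matCLM ((√(n : ℝ))⁻¹ • X)

/-- The rows of `D` in `S`. -/
def rowsOn (D : Matrix (Fin m) (Fin p) ℝ) (S : Finset (Fin m)) : Matrix {j // j ∈ S} (Fin p) ℝ :=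
  D.submatrix Subtype.val id

variable (X : Matrix (Fin n) (Fin p) ℝ) (D : Matrix (Fin m) (Fin p) ℝ) (S : Finset (Fin m)) (ν : ℝ)

theorem dotProduct_split (v w : Fin m → ℝ) :
    v ⬝ᵥ w = (fun j : {j // j ∈ S} => v j) ⬝ᵥ (fun j => w j) +
      (fun j : {j // j ∉ S} => v j) ⬝ᵥ (fun j => w j) := by
  refine (Fintype.sum_subtype_add_sum_subtype (fun j => j ∈ S) fun j => v j * w j).symm.trans ?_
  unfold dotProduct
  congr!

theorem transpose_mul_self_split :
    Dᵀ * D = (rowsOn D S)ᵀ * rowsOn D S + (rowsCompl D S)ᵀ * rowsCompl D S := by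
  ext i j
  exact dotProduct_split S (fun k => D k i) (fun k => D k j)

theorem inner_designMap (x y : EuclideanSpace ℝ (Fin p)) :
    ⟪designMap X x, designMap X y⟫ = (n : ℝ)⁻¹ * ((X *ᵥ x.ofLp) ⬝ᵥ (X *ᵥ y.ofLp)) := by
  rw [inner_eq_dotProduct, designMap, ofLp_matCLM, ofLp_matCLM, Matrix.smul_mulVec,
    Matrix.smul_mulVec, smul_dotProduct, dotProduct_smul, smul_eq_mul, smul_eq_mul, ← mul_assoc,
    ← mul_inv, Real.mul_self_sqrt (Nat.cast_nonneg n)]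

theorem adjoint_designMap (x : EuclideanSpace ℝ (Fin p)) :
    LinearMap.adjoint (designMap X).toLinearMap (designMap X x) =
      WithLp.toLp 2 ((starMat X * X) *ᵥ x.ofLp) := by
  refine ext_inner_right ℝ fun y => ?_
  rw [LinearMap.adjoint_inner_left]
  change ⟪designMap X x, designMap X y⟫ = _
  rw [inner_designMap, inner_eq_dotProduct, starMat, Matrix.smul_mul, Matrix.smul_mulVec,
    smul_dotProduct, ← Matrix.mulVec_mulVec, transpose_mulVec_dotProduct, smul_eq_mul]

theorem norm_designMap_sq (x : EuclideanSpace ℝ (Fin p)) :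
    ‖designMap X x‖ ^ 2 = x.ofLp ⬝ᵥ ((starMat X * X) *ᵥ x.ofLp) := by
  have h := congrArg (fun v => ⟪x, v⟫) (adjoint_designMap X x)
  simp only [LinearMap.adjoint_inner_right] at h
  rw [← real_inner_self_eq_norm_sq]
  refine h.trans ?_
  rw [inner_eq_dotProduct]

theorem hessianS_eq_fromBlocks : hessianS X D S ν =
    Matrix.fromBlocks (starMat X * X + ν⁻¹ • (Dᵀ * D)) (-(ν⁻¹ • (rowsOn D S)ᵀ))
      (-(ν⁻¹ • rowsOn D S)) (ν⁻¹ • 1) := by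
  ext (i | i) (j | j)
  · rfl
  · rfl
  · rfl
  · by_cases h : i = j
    · simp [hessianS, hessian, h]
    · have h' : (i : Fin m) ≠ j := fun h' => h (Subtype.ext h')
      simp [hessianS, hessian, h, h']

theorem hessianS_mulVec (β : Fin p → ℝ) (γ : {j // j ∈ S} → ℝ) :
    hessianS X D S ν *ᵥ Sum.elim β γ =
      Sum.elim ((starMat X * X) *ᵥ β + ν⁻¹ • ((rowsCompl D S)ᵀ *ᵥ (rowsCompl D S *ᵥ β) +
        (rowsOn D S)ᵀ *ᵥ (rowsOn D S *ᵥ β - γ))) (ν⁻¹ • (γ - rowsOn D S *ᵥ β)) := by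
  rw [hessianS_eq_fromBlocks, Matrix.fromBlocks_mulVec, Sum.elim_comp_inl, Sum.elim_comp_inr,
    transpose_mul_self_split D S]
  congr 1
  · simp only [Matrix.add_mulVec, Matrix.neg_mulVec, Matrix.smul_mulVec, ← Matrix.mulVec_mulVec,
      Matrix.mulVec_sub, smul_add, smul_sub]
    abel
  · simp only [Matrix.neg_mulVec, Matrix.smul_mulVec, Matrix.one_mulVec, smul_sub]
    abel

theorem hessianSc_mulVec (β : Fin p → ℝ) (γ : {j // j ∈ S} → ℝ) :
    hessianSc X D S ν *ᵥ Sum.elim β γ = -(ν⁻¹ • (rowsCompl D S *ᵥ β)) := by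
  have h : hessianSc X D S ν = Matrix.fromCols (-(ν⁻¹ • rowsCompl D S)) 0 := by
    ext i (j | j)
    · rfl
    · have : (i : Fin m) ≠ j := fun h => i.2 (h ▸ j.2)
      simp [hessianSc, hessian, this]
  rw [h, Matrix.fromCols_mulVec, Sum.elim_comp_inl, Matrix.zero_mulVec, add_zero,
    Matrix.neg_mulVec, Matrix.smul_mulVec]

theorem norm_onMap_add_norm_offMap (x : EuclideanSpace ℝ (Fin p)) :
    ‖matCLM (rowsOn D S) x‖ ^ 2 + ‖matCLM (rowsCompl D S) x‖ ^ 2 = ‖matCLM D x‖ ^ 2 := by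
  simp only [norm_sq_eq_dotProduct, ofLp_matCLM]
  exact (dotProduct_split S (D *ᵥ x.ofLp) (D *ᵥ x.ofLp)).symm

theorem matCLM_eq_iff {x y : EuclideanSpace ℝ (Fin p)} : matCLM D x = matCLM D y ↔
    matCLM (rowsOn D S) x = matCLM (rowsOn D S) y ∧
    matCLM (rowsCompl D S) x = matCLM (rowsCompl D S) y := by
  have h := norm_onMap_add_norm_offMap D S (x - y)
  simp only [map_sub] at h
  constructor
  · intro hxy
    rw [hxy, sub_self, norm_zero] at h
    have h1 := sq_nonneg ‖matCLM (rowsOn D S) x - matCLM (rowsOn D S) y‖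
    have h2 := sq_nonneg ‖matCLM (rowsCompl D S) x - matCLM (rowsCompl D S) y‖
    constructor <;> rw [← sub_eq_zero, ← norm_eq_zero] <;> nlinarith
  · rintro ⟨h1, h2⟩
    rw [h1, h2, sub_self, sub_self, norm_zero, norm_zero] at h
    rw [← sub_eq_zero, ← norm_eq_zero]
    nlinarith

theorem hessianS_form (β : Fin p → ℝ) (γ : {j // j ∈ S} → ℝ) :
    Sum.elim β γ ⬝ᵥ (hessianS X D S ν *ᵥ Sum.elim β γ) =
      splitForm (designMap X) (matCLM (rowsOn D S)) (matCLM (rowsCompl D S)) ν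
        (WithLp.toLp 2 β) (WithLp.toLp 2 γ) := by
  rw [hessianS_mulVec, sumElim_dotProduct_sumElim, splitForm, norm_designMap_sq,
    norm_sq_eq_dotProduct, norm_sq_eq_dotProduct, matCLM_toLp, matCLM_toLp]
  simp only [WithLp.ofLp_sub]
  have t1 : ∀ v, β ⬝ᵥ ((rowsOn D S)ᵀ *ᵥ v) = (rowsOn D S *ᵥ β) ⬝ᵥ v := fun v => by
    rw [dotProduct_comm, transpose_mulVec_dotProduct, dotProduct_comm]
  have t2 : ∀ v, β ⬝ᵥ ((rowsCompl D S)ᵀ *ᵥ v) = (rowsCompl D S *ᵥ β) ⬝ᵥ v := fun v => by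
    rw [dotProduct_comm, transpose_mulVec_dotProduct, dotProduct_comm]
  simp only [dotProduct_add, dotProduct_smul, t1, t2, smul_eq_mul, dotProduct_sub, sub_dotProduct]
  ring

theorem l2norm_sumElim_sq (β : a → ℝ) (γ : b → ℝ) : l2norm (Sum.elim β γ) ^ 2 =
    ‖(WithLp.toLp 2 β : EuclideanSpace ℝ a)‖ ^ 2 + ‖(WithLp.toLp 2 γ : EuclideanSpace ℝ b)‖ ^ 2 := by
  rw [l2norm_sq, sumElim_dotProduct_sumElim, norm_sq_eq_dotProduct, norm_sq_eq_dotProduct]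

theorem mem_commonKer_iff {z : EuclideanSpace ℝ (Fin p)} :
    z ∈ commonKer (designMap X) (matCLM (rowsOn D S)) (matCLM (rowsCompl D S)) ↔
      X *ᵥ z.ofLp = 0 ∧ D *ᵥ z.ofLp = 0 := by
  have h1 : designMap X z = 0 ↔ X *ᵥ z.ofLp = 0 := by
    rw [← inner_self_eq_zero (𝕜 := ℝ), inner_designMap, mul_eq_zero, inv_eq_zero, Nat.cast_eq_zero,
      dotProduct_self_eq_zero]
    refine or_iff_right_of_imp fun h => ?_
    subst h
    exact Subsingleton.elim _ _
  have h2 := matCLM_eq_iff D S (x := z) (y := 0)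
  rw [map_zero, map_zero, map_zero] at h2
  have h3 : matCLM D z = 0 ↔ D *ᵥ z.ofLp = 0 := by
    rw [← inner_self_eq_zero (𝕜 := ℝ), inner_eq_dotProduct, dotProduct_self_eq_zero, ofLp_matCLM]
  rw [mem_commonKer, ← h2, h1, h3]

/-- The sum of the ranges of the transposes is the orthogonal complement of the joint kernel. The
harder inclusion is proved after passing to complements. -/
theorem mem_subspaceL_iff (β : Fin p → ℝ) : β ∈ subspaceL X D ↔ WithLp.toLp 2 β ∈
    (commonKer (designMap X) (matCLM (rowsOn D S)) (matCLM (rowsCompl D S)))ᗮ := by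
  constructor
  · intro h
    obtain ⟨_, ⟨u, rfl⟩, _, ⟨v, rfl⟩, rfl⟩ := Submodule.mem_sup.1 h
    rw [Submodule.mem_orthogonal']
    intro z hz
    obtain ⟨h1, h2⟩ := (mem_commonKer_iff X D S).1 hz
    rw [inner_eq_dotProduct]
    simp only [Matrix.mulVecLin_apply, add_dotProduct, transpose_mulVec_dotProduct, h1, h2,
      dotProduct_zero, add_zero]
  · intro h
    set e := (WithLp.linearEquiv 2 ℝ (Fin p → ℝ)).symm with he
    set L := (subspaceL X D).map e.toLinearMap with hL
    have hle : (commonKer (designMap X) (matCLM (rowsOn D S)) (matCLM (rowsCompl D S)))ᗮ ≤ L := by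
      rw [← Submodule.orthogonal_orthogonal L]
      refine Submodule.orthogonal_le fun z hz => ?_
      rw [Submodule.mem_orthogonal] at hz
      have hx : ∀ u, (Xᵀ *ᵥ u) ⬝ᵥ z.ofLp = 0 := fun u => by
        have := hz (e (Xᵀ *ᵥ u))
          (Submodule.mem_map_of_mem (Submodule.mem_sup_left ⟨u, rfl⟩))
        rwa [inner_eq_dotProduct] at this
      have hd : ∀ u, (Dᵀ *ᵥ u) ⬝ᵥ z.ofLp = 0 := fun u => by
        have := hz (e (Dᵀ *ᵥ u))
          (Submodule.mem_map_of_mem (Submodule.mem_sup_right ⟨u, rfl⟩))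
        rwa [inner_eq_dotProduct] at this
      rw [mem_commonKer_iff]
      refine ⟨dotProduct_self_eq_zero.1 ?_, dotProduct_self_eq_zero.1 ?_⟩
      · rw [← transpose_mulVec_dotProduct, hx]
      · rw [← transpose_mulVec_dotProduct, hd]
    obtain ⟨y, hy, hye⟩ := hle h
    have : y = β := congrArg WithLp.ofLp hye
    exact this ▸ hy

variable {X D S ν}

theorem hessianBound_iff {C : ℝ} : HessianBound X D S ν C ↔
    ∀ β ∈ (commonKer (designMap X) (matCLM (rowsOn D S)) (matCLM (rowsCompl D S)))ᗮ, ∀ γ,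
      C / (1 + ν) * (‖β‖ ^ 2 + ‖γ‖ ^ 2) ≤
        splitForm (designMap X) (matCLM (rowsOn D S)) (matCLM (rowsCompl D S)) ν β γ := by
  constructor
  · intro h β hβ γ
    have := h β.ofLp ((mem_subspaceL_iff X D S _).2 hβ) γ.ofLp
    rwa [hessianS_form, l2norm_sumElim_sq] at this
  · intro h β hβ γ
    rw [hessianS_form, l2norm_sumElim_sq]
    exact h _ ((mem_subspaceL_iff X D S _).1 hβ) _

set_option maxHeartbeats 1000000 in
-- Restricted strong convexity makes (β, γ) ↦ (Aβ, D₂β, D₁β - γ) injective on the relevant space,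
-- and injectivity in finite dimension is quantitative, with a constant `K` free of ν. The
-- dependence on ν enters only through (1 + ν)(u + v/ν) ≥ u + v for nonnegative u, v.
theorem RSC.exists_hessianBound (h : RSC X D S) :
    ∃ C : ℝ, 0 < C ∧ ∀ ν : ℝ, 0 < ν → HessianBound X D S ν C := by
  obtain ⟨lam, hlam, hrsc⟩ := h
  set A := designMap X with hA
  set D₁ := matCLM (rowsOn D S) with hD₁
  set D₂ := matCLM (rowsCompl D S) with hD₂
  set L := (commonKer A D₁ D₂)ᗮ
  set T : (L × EuclideanSpace ℝ {j // j ∈ S}) →ₗ[ℝ] (EuclideanSpace ℝ (Fin n) ×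
      EuclideanSpace ℝ {j // j ∉ S} × EuclideanSpace ℝ {j // j ∈ S}) :=
    ((A.toLinearMap ∘ₗ L.subtype) ∘ₗ LinearMap.fst ℝ _ _).prod
      (((D₂.toLinearMap ∘ₗ L.subtype) ∘ₗ LinearMap.fst ℝ _ _).prod
        ((D₁.toLinearMap ∘ₗ L.subtype) ∘ₗ LinearMap.fst ℝ _ _ - LinearMap.snd ℝ _ _)) with hT
  have hTa : ∀ β γ, T (β, γ) = (A β, D₂ β, D₁ β - γ) := fun β γ => rfl
  have hker : LinearMap.ker T = ⊥ := by
    rw [LinearMap.ker_eq_bot']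
    rintro ⟨⟨β, hβ⟩, γ⟩ h0
    rw [hTa] at h0
    simp only [Prod.mk_eq_zero] at h0
    obtain ⟨h1, h2, h3⟩ := h0
    have hβ0 : β = 0 := by
      have h4 := hrsc β.ofLp ⟨(mem_subspaceL_iff X D S _).2 hβ, by
        change rowsCompl D S *ᵥ β.ofLp = 0
        exact congrArg WithLp.ofLp h2⟩
      rw [← norm_designMap_sq, ← hA, h1, norm_zero] at h4
      have h5 : l2norm β.ofLp = ‖β‖ := rfl
      rw [h5] at h4
      rw [← norm_eq_zero]
      have h6 : ‖β‖ ^ 2 ≤ 0 := by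
        by_contra! hc
        nlinarith [mul_pos hlam hc]
      nlinarith [norm_nonneg β]
    subst hβ0
    rw [map_zero, zero_sub, neg_eq_zero] at h3
    simp [h3]
  obtain ⟨K, hK, hanti⟩ := T.exists_antilipschitzWith hker
  have hK' : (0 : ℝ) < K := hK
  refine ⟨1 / (2 * (K : ℝ) ^ 2), by positivity, fun ν hν => hessianBound_iff.2 fun β hβ γ => ?_⟩
  have hb := hanti.le_mul_dist ((⟨β, hβ⟩ : L), γ) 0
  rw [map_zero, dist_zero_right, dist_zero_right, hTa] at hb
  set q := ‖A β‖ ^ 2 + (‖D₂ β‖ ^ 2 + ‖D₁ β - γ‖ ^ 2) with hq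
  have hq0 : 0 ≤ q := by positivity
  have hTn : ‖(A β, D₂ β, D₁ β - γ)‖ ≤ √q := by
    simp only [norm_prod_le_iff]
    refine ⟨Real.le_sqrt_of_sq_le ?_, Real.le_sqrt_of_sq_le ?_, Real.le_sqrt_of_sq_le ?_⟩ <;>
    · rw [hq]
      nlinarith [sq_nonneg ‖A β‖, sq_nonneg ‖D₂ β‖, sq_nonneg ‖D₁ β - γ‖]
  have hle := hb.trans (mul_le_mul_of_nonneg_left hTn hK'.le)
  rw [norm_prod_le_iff] at hle
  have e1 : ‖β‖ ^ 2 ≤ K ^ 2 * q := by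
    have := pow_le_pow_left₀ (norm_nonneg _) hle.1 2
    rwa [mul_pow, Real.sq_sqrt hq0] at this
  have e2 : ‖γ‖ ^ 2 ≤ K ^ 2 * q := by
    have := pow_le_pow_left₀ (norm_nonneg _) hle.2 2
    rwa [mul_pow, Real.sq_sqrt hq0] at this
  have h1ν : 0 < 1 + ν := by linarith
  have e3 : q ≤ (1 + ν) * splitForm A D₁ D₂ ν β γ := by
    have e4 : (1 + ν) * splitForm A D₁ D₂ ν β γ =
        q + ν * ‖A β‖ ^ 2 + ν⁻¹ * (‖D₂ β‖ ^ 2 + ‖D₁ β - γ‖ ^ 2) := by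
      rw [splitForm, hq]; field_simp; ring
    have := inv_pos.2 hν
    have e5 : 0 ≤ ν * ‖A β‖ ^ 2 + ν⁻¹ * (‖D₂ β‖ ^ 2 + ‖D₁ β - γ‖ ^ 2) := by positivity
    rw [e4]; linarith
  rw [div_div, div_mul_eq_mul_div, one_mul, div_le_iff₀ (by positivity)]
  nlinarith [mul_le_mul_of_nonneg_left e3 (sq_nonneg (K : ℝ))]

theorem norm_matCLM_le {M : Matrix a b ℝ} {c : ℝ} (h : MaxSingLE M c) (x : EuclideanSpace ℝ b) :
    ‖matCLM M x‖ ≤ c * ‖x‖ :=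
  norm_map_le_of_singularValues (Matrix.toEuclideanLin M) h x

theorem exists_matCLM_eq_norm_le {M : Matrix a b ℝ} {c : ℝ} (hc : 0 ≤ c) (h : MinPosSingGE M c)
    (x : EuclideanSpace ℝ b) : ∃ x', matCLM M x' = matCLM M x ∧ c * ‖x'‖ ≤ ‖matCLM M x‖ :=
  exists_map_eq_norm_le (Matrix.toEuclideanLin M) hc h x

theorem invLambdaOne_nonneg (X : Matrix (Fin n) (Fin p) ℝ) (D : Matrix (Fin m) (Fin p) ℝ) :
    0 ≤ invLambdaOne X D := by
  unfold invLambdaOne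
  split_ifs with h
  · refine one_div_nonneg.2 ((Finset.le_inf'_iff h _).2 fun i _ => ?_)
    exact (restrictedX X D).singularValues_nonneg i
  · exact le_rfl

theorem exists_designMap_eq_norm_le {x : EuclideanSpace ℝ (Fin p)} (hx : matCLM D x = 0) :
    ∃ x', matCLM D x' = 0 ∧ designMap X x' = designMap X x ∧
      ‖x'‖ ≤ invLambdaOne X D * ‖designMap X x‖ := by
  have hT : ∀ y : LinearMap.ker (Matrix.toEuclideanLin D), restrictedX X D y = designMap X y :=
    fun y => rfl
  unfold invLambdaOne
  split_ifs with h
  · set c := (restrictedX X D).singularValues.support.inf' h (restrictedX X D).singularValues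
      with hc
    have hc0 : 0 < c := by
      rw [hc, Finset.lt_inf'_iff]
      intro i hi
      exact ((restrictedX X D).singularValues_pos_iff_ne_zero i).2 (Finsupp.mem_support_iff.1 hi)
    obtain ⟨x', h1, h2⟩ := exists_map_eq_norm_le (restrictedX X D) hc0.le
      (fun i hi => Finset.inf'_le _ hi) ⟨x, hx⟩
    refine ⟨x', x'.2, by rw [← hT, h1, hT], ?_⟩
    rw [one_div, inv_mul_eq_div, le_div_iff₀ hc0, mul_comm]
    exact h2
  · rw [Finset.not_nonempty_iff_eq_empty, Finsupp.support_eq_empty,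
      LinearMap.singularValues_eq_zero_iff] at h
    refine ⟨0, map_zero _, ?_, by simp⟩
    rw [← hT ⟨x, hx⟩, h, map_zero, LinearMap.zero_apply]

theorem splitBounds_of_hessianBound {lamD LamD LamX C : ℝ} (hν : 0 < ν) (hlamD : 0 < lamD)
    (hLamD : 0 < LamD) (hLamX : 0 < LamX) (hC : 0 < C) (hS : S.Nonempty)
    (hD1 : MinPosSingGE D lamD) (hD2 : MinPosSingGE (rowsCompl D S) lamD) (hD3 : MaxSingLE D LamD)
    (hX : MaxSingLE (starMat X * X) (LamX ^ 2)) (hH : HessianBound X D S ν C) :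
    SplitBounds (designMap X) (matCLM (rowsOn D S)) (matCLM (rowsCompl D S)) ν lamD LamD LamX
      (C / (1 + ν)) (invLambdaOne X D) where
  ν_pos := hν
  lamD_pos := hlamD
  LamD_pos := hLamD
  LamX_pos := hLamX
  lamH_pos := by positivity
  lamH_le := by
    obtain ⟨j, hj⟩ := hS
    -- At `β = 0` and a unit vector the form equals ν⁻¹, which bounds the coercivity constant; this
    -- needs a nonempty support.
    have := hessianBound_iff.1 hH 0 (Submodule.zero_mem _) (EuclideanSpace.single ⟨j, hj⟩ 1)
    simpa [splitForm] using this
  iL_nonneg := invLambdaOne_nonneg X D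
  norm_A x := by
    refine le_of_sq_le_sq ?_ (by positivity)
    have h1 := norm_matCLM_le hX x
    have h2 := real_inner_le_norm x (matCLM (starMat X * X) x)
    rw [inner_eq_dotProduct, ofLp_matCLM, ← norm_designMap_sq] at h2
    calc ‖designMap X x‖ ^ 2 ≤ ‖x‖ * (LamX ^ 2 * ‖x‖) :=
          h2.trans (mul_le_mul_of_nonneg_left h1 (norm_nonneg _))
      _ = _ := by ring
  norm_D x := by
    rw [norm_onMap_add_norm_offMap, ← mul_pow]
    exact pow_le_pow_left₀ (norm_nonneg _) (norm_matCLM_le hD3 x) 2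
  lift_D x := by
    obtain ⟨x', h1, h2⟩ := exists_matCLM_eq_norm_le hlamD.le hD1 x
    obtain ⟨h3, h4⟩ := (matCLM_eq_iff D S).1 h1
    refine ⟨x', h3, h4, ?_⟩
    rw [norm_onMap_add_norm_offMap, ← mul_pow]
    exact pow_le_pow_left₀ (by positivity) h2 2
  lift_D₂ x := exists_matCLM_eq_norm_le hlamD.le hD2 x
  lift_A x h1 h2 := by
    have h0 : matCLM D x = 0 := by
      rw [← map_zero (matCLM D), matCLM_eq_iff D S]
      simp [h1, h2]
    obtain ⟨x', h3, h4, h5⟩ := exists_designMap_eq_norm_le (X := X) h0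
    rw [← map_zero (matCLM D), matCLM_eq_iff D S] at h3
    simp only [map_zero] at h3
    exact ⟨x', h3.1, h3.2, h4, h5⟩
  form_ge := hessianBound_iff.1 hH

/-- The pseudoinverse recovers a vector only up to the kernel of the restricted Hessian. On that
kernel the form vanishes, hence so does the off-support transform, and the off-support block does
not see the difference. -/
theorem hessianSc_pinv_mulVec (hν : 0 < ν) (w : Fin p → ℝ) (g : {j // j ∈ S} → ℝ) :
    (hessianSc X D S ν * pinv (hessianS X D S ν)) *ᵥ (hessianS X D S ν *ᵥ Sum.elim w g) =
      -(ν⁻¹ • (rowsCompl D S *ᵥ w)) := by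
  set G := hessianS X D S ν with hG
  set v := pinv G *ᵥ (G *ᵥ Sum.elim w g) - Sum.elim w g with hv
  have hGv : G *ᵥ v = 0 := by
    rw [hv, Matrix.mulVec_sub, Matrix.mulVec_mulVec, Matrix.mulVec_mulVec,
      (pinv_spec G).mul_mul_left, sub_self]
  have hvs : v = Sum.elim (v ∘ Sum.inl) (v ∘ Sum.inr) := (Sum.elim_comp_inl_inr v).symm
  have h0 : rowsCompl D S *ᵥ (v ∘ Sum.inl) = 0 := by
    have h1 := hessianS_form X D S ν (v ∘ Sum.inl) (v ∘ Sum.inr)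
    rw [← hvs, ← hG, hGv, dotProduct_zero, splitForm] at h1
    have hνi := inv_pos.2 hν
    have h2 : ‖matCLM (rowsCompl D S) (WithLp.toLp 2 (v ∘ Sum.inl))‖ = 0 := by
      have e1 := sq_nonneg ‖designMap X (WithLp.toLp 2 (v ∘ Sum.inl))‖
      have e2 := mul_nonneg hνi.le (sq_nonneg ‖matCLM (rowsOn D S) (WithLp.toLp 2 (v ∘ Sum.inl)) -
        WithLp.toLp 2 (v ∘ Sum.inr)‖)
      have e3 : ν⁻¹ * ‖matCLM (rowsCompl D S) (WithLp.toLp 2 (v ∘ Sum.inl))‖ ^ 2 ≤ 0 := by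
        linarith
      by_contra hne
      have : 0 < ‖matCLM (rowsCompl D S) (WithLp.toLp 2 (v ∘ Sum.inl))‖ ^ 2 := by positivity
      nlinarith [mul_pos hνi this]
    exact congrArg WithLp.ofLp (norm_eq_zero.1 h2)
  have h1 : hessianSc X D S ν *ᵥ v = 0 := by
    rw [hvs, hessianSc_mulVec, h0, smul_zero, neg_zero]
  rw [← Matrix.mulVec_mulVec, ← sub_add_cancel (pinv G *ᵥ (G *ᵥ Sum.elim w g)) (Sum.elim w g),
    ← hv, Matrix.mulVec_add, h1, zero_add, hessianSc_mulVec]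

theorem IRR.exists_irrRow {η : ℝ} (hν : 0 < ν) (h : IRR X D S ν η) (j : {j // j ∉ S}) :
    ∃ kE kF, IrrRow (designMap X) (matCLM (rowsOn D S)) (matCLM (rowsCompl D S)) ν η
      (EuclideanSpace.proj j) kE kF := by
  set M := hessianSc X D S ν * pinv (hessianS X D S ν) with hM
  set kE : EuclideanSpace ℝ (Fin p) →ₗ[ℝ] ℝ :=
    { toFun := fun x => (M *ᵥ Sum.elim x.ofLp 0) j
      map_add' := fun x y => by
        rw [← Pi.add_apply, ← Matrix.mulVec_add, ← Sum.elim_add_add, add_zero]; rfl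
      map_smul' := fun c x => by
        rw [RingHom.id_apply, ← Pi.smul_apply, ← Matrix.mulVec_smul]
        congr 2
        ext (i | i) <;> simp } with hkE
  set kF : EuclideanSpace ℝ {j // j ∈ S} →ₗ[ℝ] ℝ :=
    { toFun := fun x => (M *ᵥ Sum.elim 0 x.ofLp) j
      map_add' := fun x y => by
        rw [← Pi.add_apply, ← Matrix.mulVec_add, ← Sum.elim_add_add, add_zero]; rfl
      map_smul' := fun c x => by
        rw [RingHom.id_apply, ← Pi.smul_apply, ← Matrix.mulVec_smul]
        congr 2
        ext (i | i) <;> simp } with hkF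
  refine ⟨LinearMap.toContinuousLinearMap kE, LinearMap.toContinuousLinearMap kF,
    fun v => PiLp.norm_apply_le v j, fun w g => ?_, fun r hr => ?_⟩
  · have h1 := congrFun (hessianSc_pinv_mulVec (X := X) (D := D) hν w.ofLp g.ofLp) j
    rw [hessianS_mulVec, ← hM] at h1
    rw [adjoint_designMap, adjoint_matCLM, adjoint_matCLM]
    refine Eq.trans ?_ h1
    change (M *ᵥ Sum.elim _ 0) j + (M *ᵥ Sum.elim 0 _) j = _
    rw [← Pi.add_apply, ← Matrix.mulVec_add, ← Sum.elim_add_add, add_zero, zero_add]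
    rfl
  · exact h r.ofLp (fun i => abs_le.1 (hr i)) j

end Translation

/-! ### Solutions of Split LBISS -/

section Solutions

variable {n p m : ℕ} {X : Matrix (Fin n) (Fin p) ℝ} {D : Matrix (Fin m) (Fin p) ℝ}
  {S : Finset (Fin m)} {ν κ : ℝ}

theorem IsSubgradL1.coord {ρ γ : Fin m → ℝ} (h : IsSubgradL1 ρ γ) (j : Fin m) (x : ℝ) :
    |γ j| + ρ j * (x - γ j) ≤ |x| := by
  have h1 := h (Function.update γ j x)
  rw [← Finset.add_sum_erase _ _ (Finset.mem_univ j), ← Finset.add_sum_erase _ _ (Finset.mem_univ j),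
    ← Finset.add_sum_erase _ _ (Finset.mem_univ j), Function.update_self] at h1
  have h2 : ∀ i ∈ Finset.univ.erase j, ρ i * (Function.update γ j x i - γ i) = 0 := fun i hi => by
    rw [Function.update_of_ne (Finset.ne_of_mem_erase hi), sub_self, mul_zero]
  have h3 : ∀ i ∈ Finset.univ.erase j, |Function.update γ j x i| = |γ i| := fun i hi => by
    rw [Function.update_of_ne (Finset.ne_of_mem_erase hi)]
  rw [Finset.sum_eq_zero h2, Finset.sum_congr rfl h3] at h1
  linarith

theorem IsSubgradL1.abs_le_one {ρ γ : Fin m → ℝ} (h : IsSubgradL1 ρ γ) (j : Fin m) :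
    |ρ j| ≤ 1 := by
  have h1 := h.coord j (γ j + 1)
  have h2 := h.coord j (γ j - 1)
  have h3 := abs_add_le (γ j) 1
  have h4 := abs_sub (γ j) 1
  rw [abs_one] at h3 h4
  rw [abs_le]
  constructor <;> linarith

theorem IsSubgradL1.mul_eq_abs {ρ γ : Fin m → ℝ} (h : IsSubgradL1 ρ γ) (j : Fin m) :
    ρ j * γ j = |γ j| := by
  have h1 := h.coord j 0
  have h2 := le_abs_self (ρ j * γ j)
  rw [abs_mul] at h2
  have h3 := mul_le_mul_of_nonneg_right (h.abs_le_one j) (abs_nonneg (γ j))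
  rw [abs_zero] at h1
  linarith

/-- The coordinates of a vector along an indexing function, as a vector in Euclidean space. -/
noncomputable def pick {a : Type*} [Fintype a] {k : ℕ} (f : a → Fin k) :
    (Fin k → ℝ) →L[ℝ] EuclideanSpace ℝ a :=
  LinearMap.toContinuousLinearMap
    ((WithLp.linearEquiv 2 ℝ (a → ℝ)).symm.toLinearMap ∘ₗ LinearMap.funLeft ℝ ℝ f)

theorem RightC1.continuousOn_pick {a : Type*} [Fintype a] {k : ℕ} {g g' : ℝ → Fin k → ℝ}
    (h : RightC1 g g') (f : a → Fin k) : ContinuousOn (fun t => pick f (g t)) (Ici 0) :=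
  (pick f).continuous.comp_continuousOn h.cont

theorem RightC1.hasDerivWithinAt_pick {a : Type*} [Fintype a] {k : ℕ} {g g' : ℝ → Fin k → ℝ}
    (h : RightC1 g g') (f : a → Fin k) (t : ℝ) (ht : 0 ≤ t) :
    HasDerivWithinAt (fun t => pick f (g t)) (pick f (g' t)) (Ici t) t :=
  (pick f).hasFDerivAt.comp_hasDerivWithinAt t (h.deriv t ht)

theorem IsSplitLBISS.fullFlow {βs : Fin p → ℝ} {ε : Fin n → ℝ} {ρ γ : ℝ → Fin m → ℝ}
    {β : ℝ → Fin p → ℝ} (h : IsSplitLBISS X D (X *ᵥ βs + ε) ν κ ρ β γ) (hκ : 0 < κ) :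
    ∃ ρ₁' γ₁' ρ₂' γ₂' β', FullFlow (designMap X) (matCLM (rowsOn D S)) (matCLM (rowsCompl D S)) ν κ
      (WithLp.toLp 2 βs) ((√(n : ℝ))⁻¹ • WithLp.toLp 2 ε)
      (fun t => pick Subtype.val (ρ t)) (fun t => pick Subtype.val (γ t)) ρ₁' γ₁'
      (fun t => pick Subtype.val (ρ t)) (fun t => pick Subtype.val (γ t)) ρ₂' γ₂'
      (fun t => pick id (β t)) β' := by
  obtain ⟨hρ0, hβ0, hγ0, ρ', β', γ', hρ, hβ, hγ, hflow⟩ := h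
  have hγf : ∀ t, 0 ≤ t → ∀ j, ρ' t j + κ⁻¹ * γ' t j = ν⁻¹ * ((D *ᵥ β t) j - γ t j) := by
    intro t ht j
    have := congrFun (hflow t ht).2.1 j
    simp only [gradGamma, Pi.add_apply, Pi.smul_apply, Pi.neg_apply, Pi.sub_apply,
      smul_eq_mul] at this
    rw [this]
    ring
  refine ⟨fun t => pick Subtype.val (ρ' t), fun t => pick Subtype.val (γ' t),
    fun t => pick Subtype.val (ρ' t), fun t => pick Subtype.val (γ' t), fun t => pick id (β' t),
    hκ, ?_, ?_, ?_, ?_, ?_, hρ.continuousOn_pick _, hρ.continuousOn_pick _, hγ.continuousOn_pick _,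
    hγ.continuousOn_pick _, hβ.continuousOn_pick _, hρ.hasDerivWithinAt_pick _,
    hρ.hasDerivWithinAt_pick _, hγ.hasDerivWithinAt_pick _, hγ.hasDerivWithinAt_pick _,
    hβ.hasDerivWithinAt_pick _, fun t ht x => ?_, fun t ht => ?_, fun t ht => ?_,
    fun t ht j => (hflow t ht).2.2.abs_le_one j, fun t ht j => (hflow t ht).2.2.mul_eq_abs j,
    fun t ht j => (hflow t ht).2.2.mul_eq_abs j⟩
  · simp only [hρ0, map_zero]
  · simp only [hρ0, map_zero]
  · simp only [hγ0, map_zero]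
  · simp only [hγ0, map_zero]
  · simp only [hβ0, map_zero]
  · have h1 := congrArg (fun v => v ⬝ᵥ x.ofLp) (hflow t ht).1
    simp only [gradBeta, starMat, smul_dotProduct, neg_dotProduct, add_dotProduct, smul_eq_mul,
      Matrix.smul_mulVec, transpose_mulVec_dotProduct] at h1
    rw [dotProduct_split S (D *ᵥ β t - γ t)] at h1
    have e1 : ⟪pick id (β' t), x⟫ = β' t ⬝ᵥ x.ofLp := inner_eq_dotProduct _ _
    have e2 : ⟪designMap X (pick id (β t) - WithLp.toLp 2 βs) -
        (√(n : ℝ))⁻¹ • WithLp.toLp 2 ε, designMap X x⟫ =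
        (n : ℝ)⁻¹ * ((X *ᵥ β t - (X *ᵥ βs + ε)) ⬝ᵥ (X *ᵥ x.ofLp)) := by
      have hx : designMap X x = (√(n : ℝ))⁻¹ • WithLp.toLp 2 (X *ᵥ x.ofLp) := by
        rw [designMap, ← WithLp.toLp_smul, ← Matrix.smul_mulVec]; rfl
      have e3 : ⟪(√(n : ℝ))⁻¹ • (WithLp.toLp 2 ε : EuclideanSpace ℝ (Fin n)), designMap X x⟫ =
          (n : ℝ)⁻¹ * (ε ⬝ᵥ (X *ᵥ x.ofLp)) := by
        rw [hx, inner_smul_left, inner_smul_right, inner_eq_dotProduct, ← mul_assoc]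
        simp only [conj_trivial, ← mul_inv, Real.mul_self_sqrt (Nat.cast_nonneg n)]
      rw [inner_sub_left, inner_designMap, e3, ← mul_sub, ← sub_dotProduct]
      congr 2
      change X *ᵥ (β t - βs) - ε = _
      rw [Matrix.mulVec_sub, sub_sub]
    rw [e1, e2, inner_eq_dotProduct, inner_eq_dotProduct]
    exact h1
  · ext j
    exact hγf t ht j
  · ext j
    exact hγf t ht j

theorem rPrime_eq : rPrime X D = Module.finrank ℝ
    ((LinearMap.ker (matCLM (rowsOn D S)).toLinearMap ⊓
      LinearMap.ker (matCLM (rowsCompl D S)).toLinearMap).map (designMap X).toLinearMap) := by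
  have hk : LinearMap.ker (matCLM (rowsOn D S)).toLinearMap ⊓
      LinearMap.ker (matCLM (rowsCompl D S)).toLinearMap =
      LinearMap.ker (Matrix.toEuclideanLin D) := by
    ext x
    have := matCLM_eq_iff D S (x := x) (y := 0)
    rw [map_zero, map_zero, map_zero] at this
    exact this.symm
  have hA : (designMap X).toLinearMap = (√(n : ℝ))⁻¹ • Matrix.toEuclideanLin X :=
    LinearMap.ext fun x => congrArg (WithLp.toLp 2) (Matrix.smul_mulVec _ X x.ofLp)
  rw [hk, hA, rPrime]
  rcases n.eq_zero_or_pos with rfl | hn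
  · have h0 : (√((0 : ℕ) : ℝ))⁻¹ • Matrix.toEuclideanLin X = Matrix.toEuclideanLin X :=
      LinearMap.ext fun x => PiLp.ext fun i => i.elim0
    rw [h0]
  · rw [Submodule.map_smul _ _ _ (by positivity)]

theorem kappaLower_pos {iL lamD LamD LamX lamH η σ b : ℝ} (hiL : 0 ≤ iL) (hlamD : 0 < lamD)
    (hLamD : 0 < LamD) (hLamX : 0 < LamX) (hlamH : 0 < lamH) (hη : 0 < η) (hσ : 0 < σ)
    (hb : 0 ≤ b) : 0 < kappaLower iL lamD LamD LamX lamH η σ ν b := by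
  unfold kappaLower
  positivity

theorem minAbs_le (v : Fin m → ℝ) {j : Fin m} (hj : j ∈ S) : minAbs v S ≤ |v j| :=
  ciInf_le (f := fun j : {j // j ∈ S} => |v j|) (Set.finite_range _).bddBelow ⟨j, hj⟩

end Solutions

end SplitLBISS

/-! ### Assembly of the consistency theorem. -/

theorem mainTheorem1 {Ω : Type*} [MeasurableSpace Ω] (P : Measure Ω) [IsProbabilityMeasure P]
    {n p m : ℕ} (hn : 1 ≤ n) (hm : 2 ≤ m)
    -- the data of the model
    (X : Matrix (Fin n) (Fin p) ℝ) (D : Matrix (Fin m) (Fin p) ℝ)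
    (βs : Fin p → ℝ) (hβs : βs ∈ SplitLBISS.subspaceL X D)
    (S : Finset (Fin m)) (hS : S = SplitLBISS.supp (D *ᵥ βs)) (hS0 : S.Nonempty)
    -- the noise: i.i.d. sub-Gaussian with parameter `σ²`
    (σ : ℝ) (hσ : 0 < σ) (ε : Fin n → Ω → ℝ) (hεm : ∀ i, Measurable (ε i))
    (hεi : iIndepFun ε P) (hεd : ∀ i j, IdentDistrib (ε i) (ε j) P P)
    (hεs : ∀ i, HasSubgaussianMGF (ε i) (Real.toNNReal (σ ^ 2)) P)
    -- the constants bounding the singular values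
    (lamD LamD LamX : ℝ) (hlamD : 0 < lamD) (hLamD : 0 < LamD) (hLamX : 0 < LamX)
    (hD1 : SplitLBISS.MinPosSingGE D lamD)
    (hD2 : SplitLBISS.MinPosSingGE (SplitLBISS.rowsCompl D S) lamD)
    (hD3 : SplitLBISS.MaxSingLE D LamD)
    (hX : SplitLBISS.MaxSingLE (SplitLBISS.starMat X * X) (LamX ^ 2))
    -- restricted strong convexity and the irrepresentable condition
    (hRSC : SplitLBISS.RSC X D S)
    (ν : ℝ) (hν : 0 < ν) (η : ℝ) (hη0 : 0 < η) (hη1 : η ≤ 1)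
    (hIRR : SplitLBISS.IRR X D S ν η) :
    (∃ C : ℝ, 0 < C ∧ ∀ ν' : ℝ, 0 < ν' → SplitLBISS.HessianBound X D S ν' C) ∧
    ∀ C : ℝ, 0 < C → SplitLBISS.HessianBound X D S ν C →
    ∀ lamH : ℝ, lamH = C / (1 + ν) →
    ∀ iL : ℝ, iL = SplitLBISS.invLambdaOne X D →
    ∀ κ : ℝ,
      SplitLBISS.kappaLower iL lamD LamD LamX lamH η σ ν (SplitLBISS.l2norm βs) ≤ κ →
    ∀ τ : ℝ, τ = SplitLBISS.tauBar n m lamD LamX η σ →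
    ∃ E : Set Ω, MeasurableSet E ∧
      1 - 6 / (m : ℝ) - 3 * Real.exp (-(4 * (n : ℝ) / 5)) ≤ P.real E ∧
      ∀ ω ∈ E, ∀ (ρ : ℝ → Fin m → ℝ) (β : ℝ → Fin p → ℝ) (γ : ℝ → Fin m → ℝ),
        SplitLBISS.IsSplitLBISS X D (X *ᵥ βs + fun i => ε i ω) ν κ ρ β γ →
        -- no false positives
        (∀ t : ℝ, 0 ≤ t → t ≤ τ → SplitLBISS.supp (γ t) ⊆ S) ∧
        -- sign consistency
        (16 * σ / (η * lamH) * (LamX * LamD / lamD ^ 2)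
            * (2 * Real.log S.card + 5 + max 0 (Real.log (8 * LamD)))
            * √(Real.log m / n) ≤ SplitLBISS.minAbs (D *ᵥ βs) S →
          ∀ j, SignType.sign (γ τ j) = SignType.sign ((D *ᵥ βs) j)) ∧
        -- error bound for `γ`
        SplitLBISS.l2norm (γ τ - D *ᵥ βs) ≤
          42 * σ / (η * lamH) * (LamX / lamD) * √(S.card * Real.log m / n) ∧
        -- error bound for `β`
        SplitLBISS.l2norm (β τ - βs) ≤
          42 * σ / (η * lamH) * ((LamX * (1 + lamD) + LamX ^ 2 * iL) / lamD ^ 2)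
              * √(S.card * Real.log m / n)
            + 2 * σ * iL * √(SplitLBISS.rPrime X D * Real.log m / n)
            + ν * (2 * σ) * ((LamX + LamX ^ 2 * iL) / lamD ^ 2) := by
  open SplitLBISS in
  refine ⟨hRSC.exists_hessianBound, fun C hC hH lamH hlamH iL hiL κ hκ τ hτ => ?_⟩
  have H : SplitBounds (designMap X) (matCLM (rowsOn D S)) (matCLM (rowsCompl D S)) ν lamD LamD
      LamX lamH iL := by
    rw [hlamH, hiL]
    exact splitBounds_of_hessianBound hν hlamD hLamD hLamX hC hS0 hD1 hD2 hD3 hX hH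
  have hκ0 : 0 < κ := (kappaLower_pos H.iL_nonneg hlamD hLamD hLamX H.lamH_pos hη0 hσ
    (norm_nonneg _)).trans_le hκ
  have hm0 : (2 : ℝ) ≤ m := by exact_mod_cast hm
  have hn0 : (0 : ℝ) < n := by exact_mod_cast hn
  have hlog : 0 < Real.log m := Real.log_pos (by linarith)
  have hoff : ∀ j, j ∉ S → (D *ᵥ βs) j = 0 := fun j hj => by
    simpa [hS, supp] using hj
  have hoff' : matCLM (rowsCompl D S) (WithLp.toLp 2 βs) = 0 := by
    ext j
    exact hoff j j.2
  have hcard : Fintype.card {j // j ∈ S} + Fintype.card {j // j ∉ S} = m := by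
    rw [Fintype.card_subtype_compl, Fintype.card_fin]
    have := Fintype.card_subtype_le (fun j => j ∈ S)
    rw [Fintype.card_fin] at this
    omega
  have : Nonempty {j // j ∈ S} := hS0.to_subtype
  obtain ⟨𝓔, δ, h𝓔, hP, hN⟩ := exists_noiseEvent H hn hm hcard hσ hεm hεi hεs
  refine ⟨𝓔, h𝓔, hP, fun ω hω ρ β γ hsol => ?_⟩
  obtain ⟨ρ₁', γ₁', ρ₂', γ₂', β', hG⟩ := hsol.fullFlow (S := S) hκ0
  obtain ⟨h1, h2, h3, h4⟩ := hG.consistency H (hN ω hω) ((mem_subspaceL_iff X D S βs).1 hβs) hoff'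
    hσ (Real.sqrt_pos.2 (div_pos hlog hn0)) (Real.sqrt_nonneg _) hη0 hη1
    (fun j => hIRR.exists_irrRow hν j) hκ
    (hτ.trans (by rw [tauBar, ← Real.sqrt_inv, inv_div]))
  have hγ0 : ∀ t, 0 ≤ t → t ≤ τ → ∀ j, j ∉ S → γ t j = 0 := fun t ht0 htτ j hj =>
    congrArg (fun v : EuclideanSpace ℝ {j // j ∉ S} => v ⟨j, hj⟩) (h1 t ⟨ht0, htτ⟩)
  have hτ0 : 0 ≤ τ := by
    rw [hτ, tauBar]
    positivity
  have hsq : √(S.card * Real.log m / n) = √(Fintype.card {j // j ∈ S}) * √(Real.log m / n) := by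
    rw [Fintype.card_coe, mul_div_assoc, Real.sqrt_mul (Nat.cast_nonneg _)]
  refine ⟨fun t ht0 htτ j hj => ?_, fun hmin j => ?_, ?_, ?_⟩
  · by_contra hjS
    exact (Finset.mem_filter.1 hj).2 (hγ0 t ht0 htτ j hjS)
  · by_cases hj : j ∈ S
    -- The logarithm of Λ_D enters only as nonnegative slack in the signal condition.
    · refine h2 (max 0 (Real.log (8 * LamD))) (le_max_left _ _) (fun i => ?_) ⟨j, hj⟩
      rw [Fintype.card_coe]
      exact hmin.trans (minAbs_le _ i.2)
    · rw [hoff j hj, hγ0 τ hτ0 le_rfl j hj]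
  · rw [hsq]
    refine le_trans (le_of_eq ?_) h3
    refine (sq_eq_sq₀ (norm_nonneg _) (norm_nonneg _)).1 ?_
    rw [norm_sq_eq_dotProduct, norm_sq_eq_dotProduct, dotProduct_split S]
    refine add_eq_left.2 (Finset.sum_eq_zero fun j _ => ?_)
    have : (γ τ - D *ᵥ βs) j = 0 := by
      rw [Pi.sub_apply, hoff j j.2, hγ0 τ hτ0 le_rfl j j.2, sub_zero]
    exact mul_eq_zero_of_left this _
  · rw [hsq, rPrime_eq (S := S)]
    exact h4
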